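/- **Proposition 2.2.** Let $R$ be a local noetherian ring whose formal completion $\hat R=\varprojlim_n R/\mathfrak m_R^n$ is an integral domain. (Then $R\subset\hat R$ is an inclusion of domains.) Put $F=\operatorname{Frac}(R)\subset\operatorname{Frac}(\hat R)$ and let $p\geq 1$ be the characteristic exponent of these fields. Let $$R^{\mathrm{prc}}=\{\,b\in\hat R \mid b^{p^\nu}\in R \text{ for some } \nu\geq 0\,\}$$ be the $p$-radical closure of $R$, a subring of $\hat R$ containing $R$. A domain $A$ is called japanese if for every finite field extension $L$ of $\operatorname{Frac}(A)$ the integral closure of $A$ in $L$ is a finite $A$-module. Consider the following three conditions: 1. (i) The inclusion $R\subset R^{\mathrm{prc}}$ is an equality. 2. (ii) The generic formal fiber $\hat R\otimes_R F$ is geometrically reduced over $F$, that is, $\hat R\otimes_R L$ is reduced for every field extension $L$ of $F$ (equivalently, for $L$ an algebraic closure of $F$). 3. (iii) Every finitely generated $R$-subalgebra $R'\subset F$ is japanese. Then (ii) $\Leftrightarrow$ (iii). If $R$ is normal, then (ii) $\Rightarrow$ (i). If $\hat R$ is normal and the field extension $F\subset\operatorname{Frac}(\hat R)$ can be written as a purely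 inseparable extension $F\subset E$ followed by a separable, not necessarily algebraic, extension $E\subset\operatorname{Frac}(\hat R)$ (that is, $\operatorname{Frac}(\hat R)\otimes_E L$ is reduced for every field extension $L$ of $E$), then (i), (ii) and (iii) are equivalent. -/

import Mathlib

open scoped TensorProduct
open IsLocalRing

universe u

/-- For an algebra `A` over `R` that is a domain (here `A` will be the formal completion of a
local noetherian ring `R`), the `p`-radical closure of `R` in `A`: all `b : A` such that `b ^ (p ^ ν)`
lies in (the image of) `R` for some `ν ≥ 0`. Here `p ≥ 1` is the characteristic exponent of the
field of fractions of `A`. -/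
noncomputable def pRadicalClosureIn (R A : Type u) [CommRing R] [CommRing A] [IsDomain A]
    [Algebra R A] : Subalgebra R A where
  carrier := {b | ∃ ν : ℕ, b ^ (ringExpChar (FractionRing A)) ^ ν ∈ (algebraMap R A).range}
  algebraMap_mem' r := ⟨0, by simp⟩
  mul_mem' := by
    rintro a b ⟨m, hm⟩ ⟨n, hn⟩
    refine ⟨m + n, ?_⟩
    rw [mul_pow]
    refine mul_mem ?_ ?_
    · rw [pow_add, pow_mul]
      exact pow_mem hm _
    · rw [pow_add, mul_comm (_ ^ m), pow_mul]
      exact pow_mem hn _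
  add_mem' := by
    rintro a b ⟨m, hm⟩ ⟨n, hn⟩
    have : ExpChar A (ringExpChar (FractionRing A)) :=
      RingHom.expChar (algebraMap A (FractionRing A)) (IsFractionRing.injective _ _) _
    refine ⟨m + n, ?_⟩
    rw [add_pow_expChar_pow]
    refine add_mem ?_ ?_
    · rw [pow_add, pow_mul]
      exact pow_mem hm _
    · rw [pow_add, mul_comm (_ ^ m), pow_mul]
      exact pow_mem hn _

/-- The formal completion of a local ring. -/
abbrev FormalCompletion (R : Type u) [CommRing R] [IsLocalRing R] : Type u :=
  AdicCompletion (maximalIdeal R) R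

/-- The `p`-radical closure of a local ring whose formal completion is a domain, as a
subalgebra of the formal completion. -/
noncomputable abbrev pRadicalClosure (R : Type u) [CommRing R] [IsLocalRing R]
    [IsDomain (FormalCompletion R)] : Subalgebra R (FormalCompletion R) :=
  pRadicalClosureIn R (FormalCompletion R)

/-- A domain `A` is japanese if for every finite extension `L` of its field of fractions `K`,
the integral closure of `A` in `L` is a finite `A`-module. -/
def IsJapanese (A : Type u) [CommRing A] [IsDomain A] : Prop :=
  ∀ (K L : Type u) [Field K] [Field L] [Algebra A K] [IsFractionRing A K]
    [Algebra K L] [Algebra A L] [IsScalarTower A K L] [FiniteDimensional K L],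
    Module.Finite A (integralClosure A L)

/-- A not necessarily algebraic field extension `K` of `k` is separable if it stays reduced under
all extensions of the ground field `k`, that is, if `K` is a geometrically reduced `k`-algebra
(reducedness over an algebraic closure of `k` is enough, and is what Mathlib's notion asks).
Note that Mathlib's `Algebra.IsSeparable` covers algebraic extensions only. -/
def IsSeparableFieldExtension (k K : Type u) [Field k] [Field K] [Algebra k K] : Prop :=
  Algebra.IsGeometricallyReduced k K

/-- The generic formal fiber ring of a local domain `R` with field of fractions `F`. -/
abbrev GenericFormalFiber (R F : Type u) [CommRing R] [IsLocalRing R] [Field F] [Algebra R F] :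
    Type u :=
  F ⊗[R] FormalCompletion R

/-- The field extension `K` of `F` can be written as a purely inseparable extension followed by
a separable extension. -/
def IsPurelyInseparableThenSeparable (F K : Type u) [Field F] [Field K] [Algebra F K] : Prop :=
  ∃ E : IntermediateField F K, IsPurelyInseparable F E ∧ IsSeparableFieldExtension E K

/-! ### Finite generation over adically complete rings. -/

section AdicFinite

variable {R : Type*} [CommRing R] {I : Ideal R}

/-! Write `A` for the completion of `R` and `K` for its field of fractions. Then `A` is faithfully
flat over `R`, and `F ⊗ A` is a localization of `A` inside `K`, so (ii) says that `K` is
geometrically reduced over `F`.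

(ii) ⇒ (iii). Let `L/F` be finite and `N` the integral closure of `R'` in `L`. The ring `T = R' ⊗ A`
is a finitely generated `A`-subalgebra of `K`, and `K ⊗ L` is reduced, hence a finite product of
finite extensions of `K`. So `T ⊗ N` embeds in a product of integral closures of `T`; if these are
finite, `N` is finite by faithfully flat descent. Their finiteness is
`Module.Finite.integralClosure_of_isAdicComplete`: one has `T = A[J/a]`, a chart of the blow-up of
an ideal `J`, and a complete form of the Rees algebra of `J` inside `A⟦X⟧` is again a complete local
noetherian domain. All this rests on Nagata's theorem that such domains are japanese
(`isJapanese_of_isAdicComplete`): by Cohen's structure theory they are finite over power series over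
a field or a Cohen ring, and Tate's argument shows that those are japanese
(`PowerSeries.isJapanese`).

(iii) ⇒ (ii). The core is `isReduced_of_forall_isJapanese`. Let `S` be a domain finite over `R` and
`z` nilpotent in `S ⊗ A`. If `s` in `S` approximates `z` modulo `𝔪ⁿ`, then `s` is integral over the
ideal `𝔪ⁿS`, so `s/aⁿ` is integral over `R[𝔪/a]` for nonzero `a` in `𝔪`. Since this ring is
japanese, one denominator `c` serves all `n`, and `cz` is infinitely divisible by `a` in the chart.
Krull's intersection theorem yields `aʲz ∈ 𝔪ʲ⁺¹z`. Combining the charts, `𝔪ʲz` lies in all powers of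
`𝔪`, so it vanishes, and `z = 0`. The algebraic closure of `F` is reached by a direct limit and by
clearing denominators.

(i) and (ii). Geometric reducedness keeps new `p`-power roots out of `K`, and normality of `R` puts
the remaining ones into `R`. Conversely, if `A` is normal, (i) forces the purely inseparable step `F
⊆ E` to be trivial, so separability of `K` over `E` is (ii). -/

theorem IsPrecomplete.pi_fin [IsPrecomplete I R] (n : ℕ) : IsPrecomplete I (Fin n → R) := by
  have key : ∀ (k : ℕ) (v : Fin n → R),
      v ∈ (I ^ k • ⊤ : Submodule R (Fin n → R)) ↔ ∀ i, v i ∈ I ^ k := by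
    intro k v
    constructor
    · intro hv i
      have := Submodule.mem_map_of_mem (f := LinearMap.proj (R := R) (φ := fun _ : Fin n ↦ R) i) hv
      rw [Submodule.map_smul''] at this
      have h2 : v i ∈ I ^ k • (⊤ : Submodule R R) := Submodule.smul_mono le_rfl le_top this
      simpa using h2
    · intro hv
      rw [pi_eq_sum_univ' v]
      exact Submodule.sum_mem _ fun i _ ↦ Submodule.smul_mem_smul (hv i) trivial
  refine ⟨fun f hf ↦ ?_⟩
  have h1 : ∀ i, ∃ L : R, ∀ k, f k i ≡ L [SMOD (I ^ k • ⊤ : Submodule R R)] := by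
    intro i
    refine IsPrecomplete.prec' (fun k ↦ f k i) fun {a b} hab ↦ ?_
    have := hf hab
    rw [SModEq.sub_mem, key] at this
    rw [SModEq.sub_mem]
    simpa using this i
  choose L hL using h1
  refine ⟨L, fun k ↦ ?_⟩
  rw [SModEq.sub_mem, key]
  intro i
  have := hL i k
  rw [SModEq.sub_mem] at this
  simpa using this

/-- A separated module over an adically complete ring which is finitely generated modulo the ideal
is finitely generated. -/
theorem Module.Finite.of_isPrecomplete_of_isHausdorff [IsPrecomplete I R] {M : Type*}
    [AddCommGroup M] [Module R M] [IsHausdorff I M] (N : Submodule R M) (hN : N.FG)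
    (h : N ⊔ I • ⊤ = ⊤) : Module.Finite R M := by
  obtain ⟨n, s, hs⟩ := Submodule.fg_iff_exists_fin_generating_family.mp hN
  have := IsPrecomplete.pi_fin (I := I) n
  let f : (Fin n → R) →ₗ[R] M := Fintype.linearCombination R s
  have hf : LinearMap.range f = N := by rw [← hs]; exact Fintype.range_linearCombination R s
  -- The source is precomplete and the target separated, so surjectivity modulo `I` suffices.
  refine Module.Finite.of_surjective f (surjective_of_mkQ_comp_surjective (I := I) ?_)
  rw [← LinearMap.range_eq_top, LinearMap.range_comp, hf]
  refine (Submodule.map_mkQ_eq_top _ _).mpr ?_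
  rw [sup_comm, h]

end AdicFinite

/-! ### Completeness of power series rings. -/

namespace PowerSeries

section Complete

variable {R : Type*} [CommRing R] (I : Ideal R)

/-- The ideal is generated by `I` and `X`, so its `k`-th power is the sum of the `I ^ (k - i) X ^
i`. Truncated subtraction makes the condition void for `i ≥ k`. -/
theorem comap_constantCoeff_pow_eq (k : ℕ) (f : R⟦X⟧) :
    f ∈ (I.comap (constantCoeff (R := R))) ^ k ↔ ∀ i, coeff i f ∈ I ^ (k - i) := by
  constructor
  · intro hf
    induction k generalizing f with
    | zero => simp
    | succ k ih =>
      rw [pow_succ] at hf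
      refine Submodule.mul_induction_on hf (fun a ha b hb i ↦ ?_) fun a b ha hb i ↦ ?_
      · rw [coeff_mul]
        refine Ideal.sum_mem _ fun x hx ↦ ?_
        have hx : x.1 + x.2 = i := by simpa using hx
        have h2 : coeff x.2 b ∈ I ^ (1 - x.2) := by
          rcases x with ⟨x, _ | y⟩
          · simpa using hb
          · simp
        have h3 := Ideal.mul_mem_mul (ih a ha x.1) h2
        rw [← pow_add] at h3
        exact Ideal.pow_le_pow_right (by omega) h3
      · rw [map_add]; exact add_mem (ha i) (hb i)
  · intro hf
    induction k generalizing f with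
    | zero => simp
    | succ k ih =>
      rw [eq_X_mul_shift_add_const f]
      refine add_mem ?_ ?_
      · rw [pow_succ']
        refine Ideal.mul_mem_mul (by simp) (ih _ fun i ↦ ?_)
        simpa using hf (i + 1)
      · have h0 : I.map (C (R := R)) ≤ I.comap (constantCoeff (R := R)) :=
          Ideal.map_le_iff_le_comap.mpr fun x hx ↦ by simpa using hx
        refine Ideal.pow_right_mono h0 _ ?_
        rw [← Ideal.map_pow]
        exact Ideal.mem_map_of_mem _ (by simpa using hf 0)

instance isAdicComplete_comap_constantCoeff [IsAdicComplete I R] :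
    IsAdicComplete (I.comap (constantCoeff (R := R))) R⟦X⟧ where
  haus' f hf := by
    ext i
    rw [map_zero]
    refine IsHausdorff.haus' (I := I) _ fun n ↦ ?_
    -- The coefficient of degree `i` loses `i` powers of `I`; the index is shifted to compensate,
    -- here and in the construction of limits below.
    have := hf (n + i)
    rw [SModEq.zero, smul_eq_mul, Ideal.mul_top, comap_constantCoeff_pow_eq] at this
    rw [SModEq.zero, smul_eq_mul, Ideal.mul_top]
    simpa using this i
  prec' f hf := by
    have h1 : ∀ i, ∃ L : R, ∀ k, coeff i (f (k + i)) ≡ L [SMOD (I ^ k • ⊤ : Submodule R R)] := by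
      intro i
      refine IsPrecomplete.prec' (fun k ↦ coeff i (f (k + i))) fun {a b} hab ↦ ?_
      have := hf (show a + i ≤ b + i by omega)
      rw [SModEq.sub_mem, smul_eq_mul, Ideal.mul_top, comap_constantCoeff_pow_eq] at this
      rw [SModEq.sub_mem, smul_eq_mul, Ideal.mul_top]
      simpa using this i
    choose L hL using h1
    refine ⟨mk L, fun k ↦ ?_⟩
    rw [SModEq.sub_mem, smul_eq_mul, Ideal.mul_top, comap_constantCoeff_pow_eq]
    intro i
    rcases le_or_gt k i with hik | hik
    · simp [Nat.sub_eq_zero_of_le hik]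
    have := hL i (k - i)
    rw [SModEq.sub_mem, smul_eq_mul, Ideal.mul_top] at this
    simpa [Nat.sub_add_cancel hik.le] using this

theorem maximalIdeal_eq_comap [IsLocalRing R] :
    maximalIdeal R⟦X⟧ = (maximalIdeal R).comap (constantCoeff (R := R)) := by
  ext f
  simp [mem_maximalIdeal, mem_nonunits_iff, isUnit_iff_constantCoeff]

instance isAdicComplete_maximalIdeal [IsLocalRing R] [IsAdicComplete (maximalIdeal R) R] :
    IsAdicComplete (maximalIdeal R⟦X⟧) R⟦X⟧ := by
  rw [maximalIdeal_eq_comap]; infer_instance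

theorem maximalIdeal_eq_map_sup [IsLocalRing R] :
    maximalIdeal R⟦X⟧ = (maximalIdeal R).map (C (R := R)) ⊔ Ideal.span {X} := by
  rw [maximalIdeal_eq_comap]
  refine le_antisymm (fun f hf ↦ ?_) (sup_le (Ideal.map_le_iff_le_comap.mpr fun x hx ↦ by
    simpa using hx) ?_)
  · rw [eq_X_mul_shift_add_const f]
    refine add_mem (Ideal.mul_mem_right _ _ (Ideal.mem_sup_right (Ideal.mem_span_singleton_self _)))
      (Ideal.mem_sup_left (Ideal.mem_map_of_mem _ hf))
  · rw [Ideal.span_le, Set.singleton_subset_iff]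
    simp

end Complete

/-! ### Normality of power series rings, via almost integral elements. -/

section Normal

variable {S F : Type*} [CommRing S] [Field F] [Algebra S F]

theorem mem_range_algebraMap_iff (f : F⟦X⟧) :
    f ∈ (algebraMap S⟦X⟧ F⟦X⟧).range ↔ ∀ i, coeff i f ∈ (algebraMap S F).range := by
  constructor
  · rintro ⟨g, rfl⟩ i
    exact ⟨coeff i g, by simp [algebraMap_apply'']⟩
  · intro h
    choose g hg using h
    exact ⟨mk g, by ext i; simp [hg, algebraMap_apply'']⟩

theorem mem_range_of_X_pow_mul {f : F⟦X⟧} (n : ℕ)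
    (h : X ^ n * f ∈ (algebraMap S⟦X⟧ F⟦X⟧).range) : f ∈ (algebraMap S⟦X⟧ F⟦X⟧).range := by
  rw [mem_range_algebraMap_iff] at h ⊢
  intro i
  simpa [coeff_X_pow_mul] using h (i + n)

variable [IsDomain S] [IsFractionRing S F] [IsNoetherianRing S] [IsIntegrallyClosed S]

/-- After division by a power of `X`, the common denominator of the powers of `f` has nonzero
constant term, which is then a common denominator of the powers of the constant term of `f`. Over a
noetherian normal domain almost integral elements belong to the ring. -/
theorem _root_.IsAlmostIntegral.constantCoeff_mem_range {f : F⟦X⟧}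
    (hf : IsAlmostIntegral S⟦X⟧ f) : constantCoeff f ∈ (algebraMap S F).range := by
  obtain ⟨d, hd, h⟩ := hf
  have hd0 : d ≠ 0 := nonZeroDivisors.ne_zero hd
  obtain ⟨d', hd'⟩ := X_pow_order_dvd (φ := d)
  set k := d.order.toNat
  have hc : constantCoeff d' ≠ 0 := by
    have h0 : coeff k d ≠ 0 := coeff_order hd0
    intro h1
    refine h0 ?_
    rw [← coeff_zero_eq_constantCoeff_apply] at h1
    rw [hd']
    exact (coeff_X_pow_mul' d' k k).trans (by simpa using h1)
  have h2 : ∀ n, d' • f ^ n ∈ (algebraMap S⟦X⟧ F⟦X⟧).range := by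
    intro n
    refine mem_range_of_X_pow_mul k ?_
    convert h n using 1
    rw [hd', mul_smul]
    simp [Algebra.smul_def, algebraMap_apply'']
  have h3 : IsAlmostIntegral S (constantCoeff f) := by
    refine ⟨constantCoeff d', mem_nonZeroDivisors_of_ne_zero hc, fun n ↦ ?_⟩
    have := (mem_range_algebraMap_iff _).mp (h2 n) 0
    have hm : constantCoeff (map (algebraMap S F) d') = algebraMap S F (constantCoeff d') := by
      rw [← coeff_zero_eq_constantCoeff_apply, coeff_map, coeff_zero_eq_constantCoeff_apply]
    simpa [Algebra.smul_def, algebraMap_apply'', hm] using this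
  exact IsIntegrallyClosed.isIntegral_iff.mp h3.isIntegral

/-- The coefficients are peeled off one at a time: once the constant term is known to lie in `S`,
subtracting it and dividing by `X` preserves almost integrality, with the same denominator. -/
theorem _root_.IsAlmostIntegral.mem_range_powerSeries {f : F⟦X⟧}
    (hf : IsAlmostIntegral S⟦X⟧ f) : f ∈ (algebraMap S⟦X⟧ F⟦X⟧).range := by
  rw [mem_range_algebraMap_iff]
  intro i
  induction i generalizing f with
  | zero => simpa using hf.constantCoeff_mem_range
  | succ i ih =>
    obtain ⟨s, hs⟩ := hf.constantCoeff_mem_range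
    have h1 : f - algebraMap S⟦X⟧ F⟦X⟧ (C s) = X * mk fun n ↦ coeff (n + 1) f := by
      conv_lhs => rw [eq_X_mul_shift_add_const f]
      simp [algebraMap_apply'', hs]
    have h2 : IsAlmostIntegral S⟦X⟧ (X * mk fun n ↦ coeff (n + 1) f : F⟦X⟧) := by
      rw [← h1]
      exact (completeIntegralClosure S⟦X⟧ F⟦X⟧).sub_mem hf (Subalgebra.algebraMap_mem _ _)
    obtain ⟨d, hd, h⟩ := h2
    have h3 : IsAlmostIntegral S⟦X⟧ (mk fun n ↦ coeff (n + 1) f : F⟦X⟧) := by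
      refine ⟨d, hd, fun n ↦ mem_range_of_X_pow_mul n ?_⟩
      convert h n using 1
      rw [mul_pow, mul_smul_comm]
    simpa using ih h3

variable (S) in
/-- A power series ring over a noetherian normal domain is normal. -/
theorem isIntegrallyClosed : IsIntegrallyClosed S⟦X⟧ := by
  rw [isIntegrallyClosed_iff (FractionRing S⟦X⟧)]
  intro x hx
  let F := FractionRing S
  obtain ⟨d, hd, hdx⟩ := hx.isAlmostIntegral
  obtain ⟨g, h, hh, rfl⟩ := IsFractionRing.div_surjective (A := S⟦X⟧) x
  have hh0 : h ≠ 0 := nonZeroDivisors.ne_zero hh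
  have inj : Function.Injective (algebraMap S⟦X⟧ F⟦X⟧) := by
    intro a b hab
    ext i
    have := congr(coeff i $hab)
    simpa [algebraMap_apply''] using this
  have inj2 : Function.Injective (algebraMap S⟦X⟧ (FractionRing S⟦X⟧)) :=
    IsFractionRing.injective _ _
  have hι : algebraMap S⟦X⟧ F⟦X⟧ h ≠ 0 := (map_ne_zero_iff _ inj).mpr hh0
  -- `F⟦X⟧` is normal, so the integral fraction `g / h` becomes a power series `e` over `F`, to
  -- which the coefficientwise argument applies.
  obtain ⟨e, he⟩ : ∃ e : F⟦X⟧, algebraMap S⟦X⟧ F⟦X⟧ g = algebraMap S⟦X⟧ F⟦X⟧ h * e := by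
    let j : S⟦X⟧ →+* FractionRing F⟦X⟧ := (algebraMap F⟦X⟧ (FractionRing F⟦X⟧)).comp
      (algebraMap S⟦X⟧ F⟦X⟧)
    have hj : Function.Injective j := (IsFractionRing.injective F⟦X⟧ (FractionRing F⟦X⟧)).comp inj
    let l : FractionRing S⟦X⟧ →+* FractionRing F⟦X⟧ := IsFractionRing.lift hj
    have hl : ∀ a, l (algebraMap _ _ a) = j a := fun a ↦ IsFractionRing.lift_algebraMap hj a
    have h1 : IsIntegral F⟦X⟧ (l (algebraMap _ _ g / algebraMap _ _ h)) := by
      obtain ⟨P, hP, hP0⟩ := hx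
      refine ⟨P.map (algebraMap S⟦X⟧ F⟦X⟧), hP.map _, ?_⟩
      rw [Polynomial.eval₂_map]
      have := congr(l $hP0)
      rw [Polynomial.hom_eval₂, map_zero] at this
      have hc : l.comp (algebraMap S⟦X⟧ (FractionRing S⟦X⟧)) = (algebraMap F⟦X⟧
          (FractionRing F⟦X⟧)).comp (algebraMap S⟦X⟧ F⟦X⟧) := RingHom.ext hl
      rwa [hc] at this
    obtain ⟨e, he⟩ := IsIntegrallyClosed.isIntegral_iff.mp h1
    refine ⟨e, IsFractionRing.injective F⟦X⟧ (FractionRing F⟦X⟧) ?_⟩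
    rw [map_div₀, hl, hl, eq_div_iff ((map_ne_zero_iff _ hj).mpr hh0)] at he
    rw [map_mul, mul_comm]
    exact he.symm
  have hae : IsAlmostIntegral S⟦X⟧ e := by
    refine ⟨d, hd, fun n ↦ ?_⟩
    obtain ⟨z, hz⟩ := hdx n
    refine ⟨z, ?_⟩
    have h1 : d * g ^ n = z * h ^ n := by
      apply inj2
      rw [Algebra.smul_def, div_pow, ← mul_div_assoc, eq_div_iff] at hz
      · simp [hz]
      · exact pow_ne_zero _ ((map_ne_zero_iff _ inj2).mpr hh0)
    have h2 := congr(algebraMap S⟦X⟧ F⟦X⟧ $h1)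
    rw [map_mul, map_mul, map_pow, map_pow, he, mul_pow] at h2
    rw [Algebra.smul_def]
    refine mul_right_cancel₀ (pow_ne_zero n hι) ?_
    rw [← h2]; ring
  obtain ⟨y, hy⟩ := hae.mem_range_powerSeries
  refine ⟨y, ?_⟩
  rw [← hy, ← map_mul] at he
  rw [inj he, map_mul, mul_div_cancel_left₀]
  exact (map_ne_zero_iff _ inj2).mpr hh0

end Normal

end PowerSeries

/-! ### First properties of japanese domains. -/

section JapaneseBasic

theorem finite_integralClosure_of_injective {A L N : Type*} [CommRing A] [IsNoetherianRing A]
    [CommRing L] [CommRing N] [Algebra A L] [Algebra A N] (f : L →ₐ[A] N)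
    (hf : Function.Injective f)
    [Module.Finite A (integralClosure A N)] : Module.Finite A (integralClosure A L) := by
  let g : integralClosure A L →ₗ[A] integralClosure A N :=
    (f.toLinearMap.comp (integralClosure A L).val.toLinearMap).codRestrict
      (Subalgebra.toSubmodule (integralClosure A N)) fun x ↦ x.2.map f
  have hg : Function.Injective g := fun x y h ↦ Subtype.ext (hf congr(($h).1))
  exact Module.Finite.of_injective g hg

theorem finite_of_injective_integralClosure {A B L : Type*} [CommRing A] [IsNoetherianRing A]
    [CommRing B] [CommRing L] [Algebra A B] [Algebra A L] [Algebra.IsIntegral A B] (f : B →ₐ[A] L)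
    (hf : Function.Injective f) [Module.Finite A (integralClosure A L)] : Module.Finite A B := by
  let g : B →ₗ[A] integralClosure A L :=
    f.toLinearMap.codRestrict (Subalgebra.toSubmodule (integralClosure A L))
      fun x ↦ (Algebra.IsIntegral.isIntegral x).map f
  have hg : Function.Injective g := fun x y h ↦ hf congr(($h).1)
  exact Module.Finite.of_injective g hg

theorem finite_integralClosure_trans (P C N : Type*) [CommRing P] [IsNoetherianRing P]
    [CommRing C] [CommRing N] [Algebra P C] [Algebra C N] [Algebra P N] [IsScalarTower P C N]
    [Module.Finite P C] [Module.Finite C (integralClosure C N)] :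
    Module.Finite P (integralClosure P N) := by
  have : Module.Finite P (integralClosure C N) := Module.Finite.trans C _
  let g : integralClosure P N →ₗ[P] integralClosure C N :=
    { toFun x := ⟨x, x.2.tower_top⟩
      map_add' _ _ := rfl
      map_smul' r x := Subtype.ext (by
        simp [Algebra.smul_def, IsScalarTower.algebraMap_apply P C N]) }
  exact Module.Finite.of_injective g fun x y h ↦ Subtype.ext congr(($h).1)

/-- All finite extensions are separable here, and over a normal noetherian domain the trace form
gives finiteness. -/
theorem IsJapanese.of_charZero {A : Type u} [CommRing A] [IsDomain A] [IsNoetherianRing A]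
    [IsIntegrallyClosed A] [CharZero A] : IsJapanese A := by
  intro K L _ _ _ _ _ _ _ _
  have : CharZero K := charZero_of_injective_algebraMap (IsFractionRing.injective A K)
  exact IsIntegralClosure.finite A K L _

theorem isJapanese_of_field (k : Type u) [Field k] : IsJapanese k := by
  intro K L _ _ _ _ _ _ _ _
  have hk : Function.Surjective (algebraMap k K) := by
    intro x
    obtain ⟨a, b, _, rfl⟩ := IsFractionRing.div_surjective (A := k) x
    exact ⟨a / b, map_div₀ _ _ _⟩
  have h1 : Module.Finite k K := Module.Finite.of_surjective (Algebra.linearMap k K) hk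
  have h2 : Module.Finite k L := Module.Finite.trans K L
  exact Module.Finite.of_injective (integralClosure k L).val.toLinearMap Subtype.val_injective

/-- The bound on independent families bounds the degree of `Frac D` over `Frac S`, so `D` lies in
the integral closure of `S` in a finite extension. It serves when `D` is a quotient ring whose field
of fractions is not known in advance to be finite. -/
theorem IsJapanese.finite_of_linearIndependent_card_le {S : Type u} [CommRing S] [IsDomain S]
    [IsNoetherianRing S] (hS : IsJapanese S) {D : Type u} [CommRing D] [IsDomain D] [Algebra S D]
    [FaithfulSMul S D] [Algebra.IsIntegral S D] (n : ℕ)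
    (h : ∀ (m : ℕ) (v : Fin m → D), LinearIndependent S v → m ≤ n) : Module.Finite S D := by
  obtain ⟨κ, _, _, _⟩ : ∃ (κ : Type u) (_ : Field κ) (_ : Algebra D κ), IsFractionRing D κ :=
    ⟨FractionRing D, inferInstance, inferInstance, inferInstance⟩
  obtain ⟨F, _, _, _⟩ : ∃ (F : Type u) (_ : Field F) (_ : Algebra S F), IsFractionRing S F :=
    ⟨FractionRing S, inferInstance, inferInstance, inferInstance⟩
  let : Algebra S κ := ((algebraMap D κ).comp (algebraMap S D)).toAlgebra
  have : IsScalarTower S D κ := IsScalarTower.of_algebraMap_eq' rfl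
  have injD := FaithfulSMul.algebraMap_injective S D
  have injκ : Function.Injective (algebraMap S κ) := by
    rw [IsScalarTower.algebraMap_eq S D κ]
    exact (IsFractionRing.injective D κ).comp injD
  let : Algebra F κ := (IsFractionRing.lift injκ).toAlgebra
  have : IsScalarTower S F κ := IsScalarTower.of_algebraMap_eq fun x ↦
    (IsFractionRing.lift_algebraMap injκ x).symm
  have hfin : FiniteDimensional F κ := by
    have hrank : Module.rank F κ ≤ n := by
      refine rank_le fun s hs ↦ ?_
      -- Each denominator in `D` is integral over `S`, hence divides a nonzero element of `S`. So a
      -- family in `κ` can be scaled into `D` without losing independence.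
      have h1 : ∀ x : κ, ∃ c : S, c ≠ 0 ∧ ∃ d : D, algebraMap D κ d = algebraMap S κ c * x := by
        intro x
        obtain ⟨a, b, hb, rfl⟩ := IsFractionRing.div_surjective (A := D) x
        have hb0 : b ≠ 0 := nonZeroDivisors.ne_zero hb
        obtain ⟨c, hc, d, hd⟩ := (Algebra.IsIntegral.isIntegral (R := S) b).isAlgebraic
          |>.exists_nonzero_dvd (mem_nonZeroDivisors_of_ne_zero hb0)
        refine ⟨c, hc, d * a, ?_⟩
        rw [IsScalarTower.algebraMap_apply S D κ, hd, map_mul, map_mul]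
        have : algebraMap D κ b ≠ 0 := (map_ne_zero_iff _ (IsFractionRing.injective D κ)).mpr hb0
        rw [mul_div_assoc', eq_div_iff this]
        ring
      choose c hc d hd using h1
      have hcu : ∀ x, algebraMap S F (c x) ≠ 0 := fun x ↦
        (map_ne_zero_iff _ (IsFractionRing.injective S F)).mpr (hc x)
      have h2 := hs.units_smul fun i ↦ Units.mk0 _ (hcu i)
      have h3 : LinearIndependent S fun i : s ↦ d i := by
        refine LinearIndependent.of_comp (IsScalarTower.toAlgHom S D κ).toLinearMap ?_
        refine LinearIndependent.restrict_scalars' (K := F) S ?_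
        have heq : ⇑(IsScalarTower.toAlgHom S D κ).toLinearMap ∘ (fun i : s ↦ d i) =
            (fun i : s ↦ Units.mk0 _ (hcu i)) • fun i : s ↦ (i : κ) := by
          funext i
          simp only [Function.comp_apply, AlgHom.toLinearMap_apply, IsScalarTower.coe_toAlgHom', hd,
            Pi.smul_apply', Units.smul_mk0, Algebra.smul_def]
          rw [← IsScalarTower.algebraMap_apply]
        rw [heq]
        exact h2
      let e := s.equivFin
      exact h s.card (fun i ↦ d (e.symm i)) (h3.comp _ e.symm.injective)
    exact Module.rank_lt_aleph0_iff.mp (hrank.trans_lt Cardinal.natCast_lt_aleph0)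
  have : Module.Finite S (integralClosure S κ) := hS F κ
  exact finite_of_injective_integralClosure (IsScalarTower.toAlgHom S D κ)
    (IsFractionRing.injective D κ)

end JapaneseBasic

/-! ### Finite field extensions: the purely inseparable part first. -/

section FixedField

open IntermediateField

/-- In a normal extension the conjugates of `x` are its images under automorphisms. A fixed `x` has
no other conjugate, so if it is separable its minimal polynomial is linear. -/
theorem IsPurelyInseparable.fixedField_top (K N : Type*) [Field K] [Field N] [Algebra K N]
    [FiniteDimensional K N] [Normal K N] :
    IsPurelyInseparable K (fixedField (⊤ : Subgroup (N ≃ₐ[K] N))) := by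
  refine ⟨inferInstance, fun x hx ↦ ?_⟩
  have hx' : (minpoly K (x : N)).Separable := by
    have : minpoly K (x : N) = minpoly K x := minpoly.algHom_eq
      (fixedField (⊤ : Subgroup (N ≃ₐ[K] N))).val (RingHom.injective _) x
    rw [this]; exact hx
  have hxi : IsIntegral K (x : N) := Algebra.IsIntegral.isIntegral _
  have hroot : ∀ y ∈ (minpoly K (x : N)).rootSet N, y = x := by
    intro y hy
    rw [Polynomial.mem_rootSet] at hy
    obtain ⟨σ, hσ⟩ := minpoly.exists_algEquiv_of_root' hxi.isAlgebraic hy.2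
    rw [← hσ]
    exact x.2 ⟨σ, trivial⟩
  have hc := Polynomial.card_rootSet_eq_natDegree (K := N) hx' (Normal.splits inferInstance _)
  have hle : Fintype.card ((minpoly K (x : N)).rootSet N) ≤ 1 := by
    rw [Fintype.card_le_one_iff_subsingleton]
    exact ⟨fun a b ↦ Subtype.ext ((hroot a a.2).trans (hroot b b.2).symm)⟩
  have hpos := minpoly.natDegree_pos hxi
  obtain ⟨c, hc⟩ := minpoly.mem_range_of_degree_eq_one K (x : N) (by
    rw [Polynomial.degree_eq_natDegree (minpoly.ne_zero hxi)]
    norm_cast; omega)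
  exact ⟨c, Subtype.ext hc⟩

/-- The sum of the exponents of the elements of a finite basis serves all elements, as `p`-power
maps are additive. -/
theorem IsPurelyInseparable.exists_forall_pow_mem (K E : Type*) [Field K] [Field E] [Algebra K E]
    [FiniteDimensional K E] [IsPurelyInseparable K E] (p : ℕ) [ExpChar K p] :
    ∃ n : ℕ, ∀ x : E, x ^ p ^ n ∈ (algebraMap K E).range := by
  have : ExpChar E p := expChar_of_injective_algebraMap (algebraMap K E).injective p
  choose n hn using IsPurelyInseparable.pow_mem K p (E := E)
  let b := Module.finBasis K E
  refine ⟨∑ i, n (b i), fun x ↦ ?_⟩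
  rw [← b.sum_repr x, sum_pow_char_pow]
  refine sum_mem fun i _ ↦ ?_
  rw [Algebra.smul_def, mul_pow]
  refine mul_mem (_root_.pow_mem (RingHom.mem_range_self _ _) _) ?_
  rw [← Finset.add_sum_erase _ _ (Finset.mem_univ i), pow_add, pow_mul]
  exact _root_.pow_mem (hn _) _

/-- `N` is the normal closure and `E` its fixed field under all automorphisms, so that `N/E` is
Galois. This order of the tower lets the inseparable part be treated over the original ring. -/
theorem exists_isPurelyInseparable_isSeparable (K L : Type u) [Field K] [Field L] [Algebra K L]
    [FiniteDimensional K L] : ∃ (E N : Type u) (_ : Field E) (_ : Field N) (_ : Algebra K E)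
      (_ : Algebra K N) (_ : Algebra E N) (_ : Algebra L N), IsScalarTower K E N ∧
      IsScalarTower K L N ∧ FiniteDimensional K E ∧ FiniteDimensional K N ∧
      IsPurelyInseparable K E ∧ Algebra.IsSeparable E N := by
  let N := IntermediateField.normalClosure K L (AlgebraicClosure L)
  have : Normal K (AlgebraicClosure L) := normal_iff.mpr fun x ↦
    ⟨(Algebra.IsAlgebraic.isAlgebraic x).isIntegral, IsAlgClosed.splits _⟩
  have : FiniteDimensional K N := normalClosure.is_finiteDimensional K L _
  have : Normal K N := normalClosure.normal K L _
  have : IsGalois (fixedField (⊤ : Subgroup (N ≃ₐ[K] N))) N :=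
    IsGalois.of_fixed_field N (⊤ : Subgroup (N ≃ₐ[K] N))
  exact ⟨fixedField (⊤ : Subgroup (N ≃ₐ[K] N)), N, inferInstance, inferInstance, inferInstance,
    inferInstance, inferInstance, inferInstance, inferInstance, inferInstance, inferInstance,
    inferInstance, IsPurelyInseparable.fixedField_top K N, inferInstance⟩

/-- Adjoining a `p ^ n`-th root keeps the exponent: the elements of the algebraic closure whose `p ^
n`-th power comes from `K` form a subfield `T`. Applied to the variable, this provides the root that
Tate's argument needs. -/
theorem exists_extension_pow_eq (K E : Type u) [Field K] [Field E] [Algebra K E]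
    [FiniteDimensional K E] (p n : ℕ) [ExpChar K p]
    (hn : ∀ x : E, x ^ p ^ n ∈ (algebraMap K E).range) (a : K) :
    ∃ (E' : Type u) (_ : Field E') (_ : Algebra K E') (_ : Algebra E E'), IsScalarTower K E E' ∧
      FiniteDimensional K E' ∧ (∀ x : E', x ^ p ^ n ∈ (algebraMap K E').range) ∧
      ∃ y : E', y ^ p ^ n = algebraMap K E' a := by
  have hq : p ^ n ≠ 0 := pow_ne_zero _ (expChar_pos K p).ne'
  let Ω := AlgebraicClosure E
  obtain ⟨y, hy⟩ := IsAlgClosed.exists_pow_nat_eq (algebraMap K Ω a) (Nat.pos_of_ne_zero hq)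
  have : ExpChar Ω p := expChar_of_injective_algebraMap (algebraMap K Ω).injective p
  let E' := IntermediateField.adjoin E {y}
  have hyi : IsIntegral E y := Algebra.IsIntegral.isIntegral y
  have : FiniteDimensional E E' := IntermediateField.adjoin.finiteDimensional hyi
  refine ⟨E', inferInstance, inferInstance, inferInstance, inferInstance,
    FiniteDimensional.trans K E E', fun x ↦ ?_,
    ⟨y, IntermediateField.mem_adjoin_simple_self E y⟩, Subtype.ext hy⟩
  let T : Subfield Ω := Subfield.comap (iterateFrobenius Ω p n) (algebraMap K Ω).fieldRange
  have hT : E'.toSubfield ≤ T := by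
    change Subfield.closure _ ≤ T
    rw [Subfield.closure_le, Set.union_subset_iff]
    constructor
    · rintro _ ⟨e, rfl⟩
      obtain ⟨k, hk⟩ := hn e
      refine ⟨k, ?_⟩
      rw [iterateFrobenius_def, ← map_pow, ← hk, ← IsScalarTower.algebraMap_apply]
    · rw [Set.singleton_subset_iff]
      refine ⟨a, ?_⟩
      rw [iterateFrobenius_def, hy]
  obtain ⟨k, hk⟩ := hT x.2
  exact ⟨k, Subtype.ext hk⟩

end FixedField

/-! ### Tate's theorem on power series over japanese domains. -/

namespace PowerSeries

variable {S : Type u} [CommRing S] [IsDomain S]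

section Core

/-- Modulo `Q` only constant terms of the coefficients survive, so these vanish in any relation. The
relation can then be divided by `X`, because `B` is torsion free, and the process repeats. -/
theorem linearIndependent_of_mod {B : Type*} [CommRing B] [IsDomain B] [Algebra S⟦X⟧ B]
    [FaithfulSMul S⟦X⟧ B] (Q : Ideal B) (hX : algebraMap S⟦X⟧ B X ∈ Q) {ι : Type*} [Finite ι]
    (b : ι → B)
    (hb : ∀ s : ι → S, ∑ᶠ i, algebraMap S⟦X⟧ B (C (s i)) * b i ∈ Q → s = 0) :
    LinearIndependent S⟦X⟧ b := by
  cases nonempty_fintype ι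
  simp_rw [finsum_eq_sum_of_fintype] at hb
  rw [Fintype.linearIndependent_iff]
  have key : ∀ (k : ℕ) (g : ι → S⟦X⟧), ∑ i, g i • b i = 0 → ∀ i, coeff k (g i) = 0 := by
    intro k
    have h0 : ∀ (g : ι → S⟦X⟧), ∑ i, g i • b i = 0 → ∀ i, coeff 0 (g i) = 0 := by
      intro g hg i
      refine congr_fun (hb (fun i ↦ coeff 0 (g i)) ?_) i
      have h2 : ∑ i, g i • b i - ∑ i, algebraMap S⟦X⟧ B (C (coeff 0 (g i))) * b i ∈ Q := by
        rw [← Finset.sum_sub_distrib]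
        refine sum_mem fun i _ ↦ ?_
        rw [Algebra.smul_def, ← sub_mul, ← map_sub]
        obtain ⟨h, hh⟩ : X ∣ g i - C (coeff 0 (g i)) := X_dvd_iff.mpr (by simp)
        rw [hh, map_mul]
        exact Q.mul_mem_right _ (Q.mul_mem_right _ hX)
      rw [hg, zero_sub] at h2
      simpa using h2
    induction k with
    | zero => exact h0
    | succ k ih =>
      intro g hg i
      have h1 : ∀ i, X ∣ g i := fun i ↦ X_dvd_iff.mpr (by simpa using h0 g hg i)
      choose g' hg' using h1
      have h2 : ∑ i, g' i • b i = 0 := by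
        have h3 : algebraMap S⟦X⟧ B X * ∑ i, g' i • b i = 0 := by
          rw [← hg, Finset.mul_sum]
          refine Finset.sum_congr rfl fun i _ ↦ ?_
          rw [hg' i, mul_smul, Algebra.smul_def X]
        refine (mul_eq_zero.mp h3).resolve_left ?_
        change _ ≠ 0
        rw [map_ne_zero_iff _ (FaithfulSMul.algebraMap_injective S⟦X⟧ B)]
        exact X_ne_zero
      rw [hg' i, coeff_succ_X_mul]
      exact ih g' h2 i
  intro g hg i
  ext k
  exact key k g hg i

/-- Tate's argument: the integral closure of a power series ring in a purely inseparable extension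
containing a root of the variable is finite. -/
theorem finite_integralClosure_of_pow_mem [IsNoetherianRing S] [IsIntegrallyClosed S]
    (hS : IsJapanese S) {K E : Type u} [Field K] [Field E] [Algebra S⟦X⟧ K]
    [IsFractionRing S⟦X⟧ K] [Algebra K E] [Algebra S⟦X⟧ E] [IsScalarTower S⟦X⟧ K E]
    [FiniteDimensional K E] {q : ℕ} (hq : q ≠ 0) (hE : ∀ x : E, x ^ q ∈ (algebraMap K E).range)
    (y : E) (hy : y ^ q = algebraMap S⟦X⟧ E X) :
    Module.Finite S⟦X⟧ (integralClosure S⟦X⟧ E) := by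
  have : IsIntegrallyClosed S⟦X⟧ := isIntegrallyClosed S
  have inj : Function.Injective (algebraMap S⟦X⟧ E) := by
    rw [IsScalarTower.algebraMap_eq S⟦X⟧ K E]
    exact (algebraMap K E).injective.comp (IsFractionRing.injective S⟦X⟧ K)
  have : FaithfulSMul S⟦X⟧ E := (faithfulSMul_iff_algebraMap_injective _ _).mpr inj
  let B := integralClosure S⟦X⟧ E
  have injB : Function.Injective (algebraMap S⟦X⟧ B) := fun a b h ↦ inj congr(($h).1)
  have : FaithfulSMul S⟦X⟧ B := (faithfulSMul_iff_algebraMap_injective _ _).mpr injB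
  -- The `q`-th power of `b` comes from `K` and is integral, so normality of `S⟦X⟧` applies.
  have hpow : ∀ b : E, IsIntegral S⟦X⟧ b → ∃ g : S⟦X⟧, algebraMap S⟦X⟧ E g = b ^ q := by
    intro b hb
    obtain ⟨c, hc⟩ := hE b
    have h1 : IsIntegral S⟦X⟧ c := by
      rw [← isIntegral_algebraMap_iff (algebraMap K E).injective, hc]
      exact hb.pow q
    obtain ⟨g, hg⟩ := IsIntegrallyClosed.isIntegral_iff.mp h1
    exact ⟨g, by rw [IsScalarTower.algebraMap_apply S⟦X⟧ K E, hg, hc]⟩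
  have hpowB : ∀ b : B, ∃ g : S⟦X⟧, algebraMap S⟦X⟧ B g = b ^ q := fun b ↦
    (hpow b b.2).imp fun g hg ↦ Subtype.ext hg
  have hyi : IsIntegral S⟦X⟧ y := IsIntegral.of_pow (Nat.pos_of_ne_zero hq)
    (hy ▸ isIntegral_algebraMap)
  let yB : B := ⟨y, hyi⟩
  have hyB : yB ^ q = algebraMap S⟦X⟧ B X := Subtype.ext hy
  have hy0 : y ≠ 0 := by
    rintro rfl
    rw [zero_pow hq] at hy
    exact X_ne_zero (inj (by rw [← hy, map_zero]))
  let Q : Ideal B := Ideal.span {yB}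
  have hXQ : algebraMap S⟦X⟧ B X ∈ Q := by
    rw [← hyB]
    exact Ideal.pow_mem_of_mem _ (Ideal.mem_span_singleton_self _) _ (Nat.pos_of_ne_zero hq)
  -- Divisibility by `y` can be tested on `q`-th powers: `b / y` is integral if and only if `b ^ q /
  -- X` lies in `S⟦X⟧`. Hence `Q` is prime because `X` is.
  have hQ : ∀ (b : B) (g : S⟦X⟧), algebraMap S⟦X⟧ B g = b ^ q → (b ∈ Q ↔ X ∣ g) := by
    intro b g hg
    constructor
    · intro hb
      obtain ⟨c, rfl⟩ := Ideal.mem_span_singleton'.mp hb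
      obtain ⟨h, hh⟩ := hpowB c
      refine ⟨h, injB ?_⟩
      rw [hg, mul_pow, hyB, map_mul, hh, mul_comm]
    · rintro ⟨h, rfl⟩
      have h1 : (b / y : E) ^ q = algebraMap S⟦X⟧ E h := by
        have h2 : (b : E) ^ q = algebraMap S⟦X⟧ E X * algebraMap S⟦X⟧ E h := by
          rw [← map_mul]; exact congr(($hg.symm).1)
        rw [div_pow, h2, hy, mul_div_cancel_left₀]
        rw [← hy]; exact pow_ne_zero _ hy0
      have h3 : IsIntegral S⟦X⟧ (b / y : E) := IsIntegral.of_pow (Nat.pos_of_ne_zero hq)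
        (h1 ▸ isIntegral_algebraMap)
      rw [Ideal.mem_span_singleton']
      exact ⟨⟨_, h3⟩, Subtype.ext (div_mul_cancel₀ _ hy0)⟩
  have hQprime : Q.IsPrime := by
    refine ⟨fun h ↦ ?_, fun {a b} hab ↦ ?_⟩
    · have h1 := (hQ 1 1 (by simp)).mp (h ▸ trivial)
      exact X_prime.not_isUnit (isUnit_of_dvd_one h1)
    · obtain ⟨g, hg⟩ := hpowB a
      obtain ⟨h, hh⟩ := hpowB b
      rw [hQ a g hg, hQ b h hh]
      exact X_prime.dvd_or_dvd ((hQ (a * b) (g * h) (by rw [map_mul, hg, hh, mul_pow])).mp hab)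
  -- the quotient by `y`
  let φ : S →+* B := (algebraMap S⟦X⟧ B).comp C
  have hφ : ∀ s, φ s = algebraMap S⟦X⟧ B (C s) := fun _ ↦ rfl
  have hφQ : ∀ s : S, φ s ∈ Q → s = 0 := by
    intro s hs
    have h1 := (hQ (φ s) ((C s) ^ q) (by rw [hφ, map_pow])).mp hs
    have h2 := X_dvd_iff.mp (X_prime.dvd_of_dvd_pow h1)
    simpa using h2
  obtain ⟨D, _, _, π, hπ, hπQ⟩ : ∃ (D : Type u) (_ : CommRing D) (_ : IsDomain D) (π : B →+* D),
      Function.Surjective π ∧ ∀ b, π b = 0 ↔ b ∈ Q :=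
    ⟨B ⧸ Q, inferInstance, inferInstance, Ideal.Quotient.mk Q, Ideal.Quotient.mk_surjective,
      fun b ↦ Ideal.Quotient.eq_zero_iff_mem⟩
  let : Algebra S D := (π.comp φ).toAlgebra
  have hSD : ∀ s, algebraMap S D s = π (φ s) := fun _ ↦ rfl
  have injD : Function.Injective (algebraMap S D) := by
    rw [injective_iff_map_eq_zero]
    intro s hs
    exact hφQ s ((hπQ _).mp hs)
  have : FaithfulSMul S D := (faithfulSMul_iff_algebraMap_injective _ _).mpr injD
  have : Algebra.IsIntegral S D := by
    refine ⟨fun d ↦ ?_⟩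
    obtain ⟨b, rfl⟩ := hπ d
    obtain ⟨g, hg⟩ := hpowB b
    refine IsIntegral.of_pow (Nat.pos_of_ne_zero hq) ?_
    -- Modulo `y` the variable vanishes, so only the constant term of the `q`-th power remains; it
    -- lies in `S`.
    have h1 : (π b) ^ q = algebraMap S D (constantCoeff g) := by
      rw [← map_pow, ← hg]
      rw [hSD, ← sub_eq_zero, ← map_sub, hπQ, hφ, ← map_sub]
      obtain ⟨h, hh⟩ : X ∣ g - C (constantCoeff g) := X_dvd_iff.mpr (by simp)
      rw [hh, map_mul]
      exact Q.mul_mem_right _ hXQ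
    rw [h1]
    exact isIntegral_algebraMap
  -- Independent families of `B / Q` over `S` lift to independent families over `S⟦X⟧`, and these
  -- have at most `[E : K]` members.
  have hDfin : Module.Finite S D := by
    refine hS.finite_of_linearIndependent_card_le (Module.finrank K E) fun m v hv ↦ ?_
    choose b hb using fun i ↦ hπ (v i)
    have h1 : LinearIndependent S⟦X⟧ b := by
      refine linearIndependent_of_mod Q hXQ b fun s hs ↦ ?_
      rw [finsum_eq_sum_of_fintype] at hs
      rw [Fintype.linearIndependent_iff] at hv
      refine funext (hv s ?_)
      rw [← hπQ, map_sum] at hs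
      rw [← hs]
      refine Finset.sum_congr rfl fun i _ ↦ ?_
      rw [map_mul, hb, Algebra.smul_def]
      rfl
    have h2 : LinearIndependent S⟦X⟧ fun i ↦ (b i : E) :=
      h1.map' B.val.toLinearMap (LinearMap.ker_eq_bot.mpr Subtype.val_injective)
    rw [LinearIndependent.iff_fractionRing S⟦X⟧ K] at h2
    simpa using h2.fintype_card_le_finrank
  obtain ⟨n, v, hv⟩ := Module.Finite.exists_fin (R := S) (M := D)
  choose b hb using fun i ↦ hπ (v i)
  let M₀ : Submodule S⟦X⟧ B := Submodule.span _ (Set.range b)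
  have hM₀ : ∀ z : B, ∃ m ∈ M₀, ∃ c : B, z = m + yB * c := by
    intro z
    have hz : π z ∈ Submodule.span S (Set.range v) := hv ▸ trivial
    rw [Submodule.mem_span_range_iff_exists_fun] at hz
    obtain ⟨c, hc⟩ := hz
    refine ⟨∑ i, C (c i) • b i, sum_mem fun i _ ↦ Submodule.smul_mem _ _
      (Submodule.subset_span ⟨i, rfl⟩), ?_⟩
    have h1 : z - ∑ i, C (c i) • b i ∈ Q := by
      rw [← hπQ, map_sub, sub_eq_zero, ← hc, map_sum]
      refine Finset.sum_congr rfl fun i _ ↦ ?_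
      rw [Algebra.smul_def, Algebra.smul_def, map_mul, hb]
      rfl
    obtain ⟨d, hd⟩ := Ideal.mem_span_singleton.mp h1
    exact ⟨d, by rw [← hd]; ring⟩
  -- The quotients of successive powers of `y` are images of the finite module `B / Q`. At `k = q`
  -- this gives finiteness modulo `X`.
  have hstep : ∀ k : ℕ, ∃ N : Submodule S⟦X⟧ B, N.FG ∧ ∀ z : B, ∃ m ∈ N, ∃ c : B,
      z = m + yB ^ k * c := by
    intro k
    induction k with
    | zero => exact ⟨⊥, Submodule.fg_bot, fun z ↦ ⟨0, zero_mem _, z, by simp⟩⟩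
    | succ k ih =>
      obtain ⟨N, hN, h⟩ := ih
      refine ⟨N ⊔ M₀.map (LinearMap.mulLeft S⟦X⟧ (yB ^ k)), hN.sup (Submodule.FG.map _
        (Submodule.fg_span (Set.finite_range b))), fun z ↦ ?_⟩
      obtain ⟨m, hm, c, rfl⟩ := h z
      obtain ⟨m', hm', c', rfl⟩ := hM₀ c
      refine ⟨m + yB ^ k * m', add_mem (Submodule.mem_sup_left hm) (Submodule.mem_sup_right
        ⟨m', hm', rfl⟩), c', ?_⟩
      ring
  obtain ⟨N, hN, h⟩ := hstep q
  -- If `z` is divisible by all powers of `X`, so is its `q`-th power, which lies in the separated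
  -- ring `S⟦X⟧`.
  have : IsHausdorff (Ideal.span {(X : S⟦X⟧)}) B := by
    refine ⟨fun z hz ↦ ?_⟩
    obtain ⟨g, hg⟩ := hpowB z
    have hg0 : g = 0 := by
      refine IsHausdorff.haus' (I := Ideal.span {(X : S⟦X⟧)}) g fun n ↦ ?_
      have h1 := hz n
      rw [SModEq.zero, Ideal.span_singleton_pow, Submodule.ideal_span_singleton_smul] at h1
      obtain ⟨c, -, hc⟩ := h1
      obtain ⟨e, he⟩ := hpowB c
      have h2 : g = X ^ n * (X ^ (n * (q - 1)) * e) := by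
        apply injB
        have hc' : algebraMap S⟦X⟧ B (X ^ n) * c = z := by
          rw [← hc]; exact (Algebra.smul_def _ _).symm
        rw [hg, ← hc', mul_pow, ← map_pow, ← he, ← map_mul, ← mul_assoc, ← pow_add, ← pow_mul]
        congr 3
        obtain ⟨k, rfl⟩ := Nat.exists_eq_succ_of_ne_zero hq
        simp; ring
      rw [SModEq.zero, Ideal.span_singleton_pow, smul_eq_mul, Ideal.mul_top, h2]
      exact Ideal.mul_mem_right _ _ (Ideal.mem_span_singleton_self _)
    rw [hg0, map_zero] at hg
    exact eq_zero_of_pow_eq_zero hg.symm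
  refine Module.Finite.of_isPrecomplete_of_isHausdorff (I := Ideal.span {(X : S⟦X⟧)}) N hN ?_
  rw [eq_top_iff]
  rintro z -
  obtain ⟨m, hm, c, rfl⟩ := h z
  refine add_mem (Submodule.mem_sup_left hm) (Submodule.mem_sup_right ?_)
  rw [hyB, ← Algebra.smul_def]
  exact Submodule.smul_mem_smul (Ideal.mem_span_singleton_self _) trivial

end Core

/-- A power series ring over a noetherian normal japanese domain is japanese. -/
theorem isJapanese [IsNoetherianRing S] [IsIntegrallyClosed S] (hS : IsJapanese S) :
    IsJapanese S⟦X⟧ := by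
  intro K L _ _ _ _ _ _ _ _
  have : IsIntegrallyClosed S⟦X⟧ := isIntegrallyClosed S
  obtain ⟨p, hp⟩ := ExpChar.exists K
  obtain ⟨E, N, _, _, _, _, _, _, _, _, _, _, _, _⟩ := exists_isPurelyInseparable_isSeparable K L
  obtain ⟨n, hn⟩ := IsPurelyInseparable.exists_forall_pow_mem K E p
  have hq : p ^ n ≠ 0 := pow_ne_zero _ (expChar_pos K p).ne'
  let : Algebra S⟦X⟧ E := ((algebraMap K E).comp (algebraMap S⟦X⟧ K)).toAlgebra
  have : IsScalarTower S⟦X⟧ K E := IsScalarTower.of_algebraMap_eq' rfl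
  let : Algebra S⟦X⟧ N := ((algebraMap K N).comp (algebraMap S⟦X⟧ K)).toAlgebra
  have : IsScalarTower S⟦X⟧ K N := IsScalarTower.of_algebraMap_eq' rfl
  have : IsScalarTower S⟦X⟧ E N := IsScalarTower.to₁₃₄ S⟦X⟧ K E N
  have : IsScalarTower S⟦X⟧ L N := IsScalarTower.to₁₃₄ S⟦X⟧ K L N
  -- Finiteness over the purely inseparable part is proved in a larger extension that contains a
  -- root of `X`.
  have hE : Module.Finite S⟦X⟧ (integralClosure S⟦X⟧ E) := by
    obtain ⟨E', _, _, _, _, _, hpow, y, hy⟩ := exists_extension_pow_eq K E p n hn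
      (algebraMap S⟦X⟧ K X)
    let : Algebra S⟦X⟧ E' := ((algebraMap K E').comp (algebraMap S⟦X⟧ K)).toAlgebra
    have : IsScalarTower S⟦X⟧ K E' := IsScalarTower.of_algebraMap_eq' rfl
    have : IsScalarTower S⟦X⟧ E E' := IsScalarTower.to₁₃₄ S⟦X⟧ K E E'
    have := finite_integralClosure_of_pow_mem hS hq hpow y hy
    exact finite_integralClosure_of_injective (IsScalarTower.toAlgHom S⟦X⟧ E E')
      (algebraMap E E').injective
  let C := integralClosure S⟦X⟧ E
  have : IsFractionRing C E := integralClosure.isFractionRing_of_finite_extension K E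
  have : IsIntegrallyClosed C := integralClosure.isIntegrallyClosedOfFiniteExtension K
  have : IsNoetherianRing C := IsNoetherianRing.of_finite S⟦X⟧ C
  have : FiniteDimensional E N := FiniteDimensional.right K E N
  -- `N` is separable over the field of fractions of the normal ring `C`, so the trace form applies.
  have : Module.Finite C (integralClosure C N) := IsIntegralClosure.finite C E N (integralClosure C N)
  have : Module.Finite S⟦X⟧ (integralClosure S⟦X⟧ N) := finite_integralClosure_trans _ C N
  exact finite_integralClosure_of_injective (IsScalarTower.toAlgHom S⟦X⟧ L N)
    (algebraMap L N).injective

end PowerSeries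

/-! ### Lifting of field homomorphisms along square-zero thickenings. -/

section FormallySmoothField

open Polynomial

/-- If `b ^ p` lies in a subfield `E` of a field of characteristic `p`, but `b` does not, then
`b` satisfies no nontrivial polynomial relation of degree less than `p` over `E`. -/
theorem Subfield.eq_zero_of_aeval_eq_zero_of_natDegree_lt {k : Type*} [Field k] {p : ℕ}
    [Fact p.Prime] [CharP k p] (E : Subfield k) {b : k} (hb : b ∉ E) (hbp : b ^ p ∈ E)
    {f : E[X]} (hf : aeval b f = 0) (hdeg : f.degree < p) : f = 0 := by
  have hirr : Irreducible (X ^ p - C (⟨b ^ p, hbp⟩ : E)) := by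
    refine X_pow_sub_C_irreducible_of_prime (Fact.out : p.Prime) fun c hc ↦ hb ?_
    have h1 : (c : k) ^ p = b ^ p := congrArg (Subtype.val) hc
    have h2 : (c : k) = b := frobenius_inj k p h1
    exact h2 ▸ c.2
  have hmin := minpoly.eq_of_irreducible_of_monic (x := b) hirr (by
      simp [Subfield.algebraMap_ofSubfield]) (monic_X_pow_sub_C _ (Fact.out : p.Prime).ne_zero)
  by_contra h0
  have h1 := minpoly.degree_le_of_ne_zero E b h0 hf
  rw [← hmin, degree_X_pow_sub_C (Fact.out : p.Prime).pos] at h1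
  exact absurd hdeg (not_lt.mpr h1)

/-- A homomorphism from a field of characteristic `p` lifts along square-zero thickenings of
rings of characteristic `p`. -/
theorem RingHom.exists_comp_eq_of_charP {k B C' : Type*} [Field k] [CommRing B] [CommRing C']
    (p : ℕ) [Fact p.Prime] [CharP k p] [CharP B p] (π : B →+* C') (hπ : Function.Surjective π)
    (hker : ∀ a b, π a = 0 → π b = 0 → a * b = 0) (g : k →+* C') :
    ∃ f : k →+* B, π.comp f = g := by
  have hp : p.Prime := Fact.out
  have hpow {a b : B} (h : π a = π b) : a ^ p = b ^ p := by
    have h0 : π (a - b) = 0 := by rw [map_sub, h, sub_self]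
    have h1 : (a - b) ^ p = 0 := by
      rw [← Nat.sub_add_cancel hp.two_le, pow_add, pow_two, hker _ _ h0 h0, mul_zero]
    rwa [sub_pow_char, sub_eq_zero] at h1
  choose s hs using fun c ↦ hπ (g c)
  -- Two lifts of an element have the same `p`-th power, as the kernel squares to zero. So `p`-th
  -- powers of lifts define a homomorphism, in effect a lift on the subfield of `p`-th powers.
  let ψ : k →+* B :=
    { toFun := fun c ↦ s c ^ p
      map_one' := by rw [hpow (b := 1) (by simp [hs]), one_pow]
      map_mul' := fun a b ↦ by rw [hpow (b := s a * s b) (by simp [hs]), mul_pow]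
      map_zero' := by rw [hpow (b := 0) (by simp [hs]), zero_pow hp.ne_zero]
      map_add' := fun a b ↦ by rw [hpow (b := s a + s b) (by simp [hs]), add_pow_char] }
  have hψ {c : k} {b : B} (h : π b = g c) : b ^ p = ψ c := hpow (by rw [h, hs])
  -- Partial lifts are encoded by their graphs: the first condition is compatibility with `g`, the
  -- second single-valuedness. Zorn's lemma then needs only unions of subrings.
  let P : Set (Subring (k × B)) := {G | (∀ x ∈ G, π x.2 = g x.1) ∧ (∀ b, (0, b) ∈ G → b = 0)}
  let G₀ : Subring (k × B) := ((frobenius k p).prod ψ).range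
  have hG₀ : G₀ ∈ P := by
    refine ⟨?_, ?_⟩
    · rintro _ ⟨c, rfl⟩
      simp [ψ, hs, frobenius_def]
    · rintro b ⟨c, hc⟩
      simp only [RingHom.prod_apply, Prod.mk.injEq] at hc
      have : c = 0 := frobenius_inj k p (by rw [hc.1, map_zero])
      rw [← hc.2, this, map_zero]
  obtain ⟨G, hG₀G, hG⟩ := zorn_le_nonempty₀ P (fun c hcP hc y hy ↦ by
    refine ⟨sSup c, ⟨fun x hx ↦ ?_, fun b hb ↦ ?_⟩, fun z hz ↦ le_sSup hz⟩
    · obtain ⟨S, hS, hx⟩ := (Subring.mem_sSup_of_directedOn ⟨y, hy⟩ hc.directedOn).1 hx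
      exact (hcP hS).1 x hx
    · obtain ⟨S, hS, hb⟩ := (Subring.mem_sSup_of_directedOn ⟨y, hy⟩ hc.directedOn).1 hb
      exact (hcP hS).2 b hb) G₀ hG₀
  have hpG (c : k) : (c ^ p, ψ c) ∈ G := hG₀G ⟨c, rfl⟩
  have hinj {c : k} {b b' : B} (h : (c, b) ∈ G) (h' : (c, b') ∈ G) : b = b' := by
    rw [← sub_eq_zero]
    refine hG.prop.2 _ ?_
    simpa using sub_mem h h'
  let E : Subfield k :=
    { (G.map (RingHom.fst k B)) with
      inv_mem' := by
        rintro _ ⟨x, hx, rfl⟩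
        by_cases h0 : x.1 = 0
        · exact ⟨0, G.zero_mem, by simp [h0]⟩
        -- The inverse of `x` is `x ^ (p - 1)` times the `p`-th power of `x⁻¹`, and all `p`-th
        -- powers are in the domain of the lift.
        · refine ⟨x ^ (p - 1) * (((x.1)⁻¹) ^ p, ψ (x.1)⁻¹),
            mul_mem (pow_mem hx _) (hpG _), ?_⟩
          simp only [RingHom.coe_fst, Prod.fst_mul, Prod.pow_fst]
          rw [inv_pow, ← mul_inv_cancel_right₀ h0 (x.1 ^ (p - 1)), ← pow_succ,
            Nat.sub_add_cancel hp.one_le]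
          field_simp }
  have hE {c : k} : c ∈ E ↔ ∃ b, (c, b) ∈ G := by
    constructor
    · rintro ⟨x, hx, rfl⟩
      exact ⟨x.2, hx⟩
    · rintro ⟨b, hb⟩
      exact ⟨(c, b), hb, rfl⟩
  -- A missing `b` could be sent to any of its lifts: the only relation to respect is that given by
  -- `X ^ p - b ^ p`, and it holds by the definition of `ψ`.
  have htop (b : k) : b ∈ E := by
    by_contra hb
    have hbp : b ^ p ∈ E := hE.2 ⟨_, hpG b⟩
    let φ : G →+* E := (RingHom.fst k B).comp G.subtype |>.codRestrict E fun x ↦ hE.2 ⟨x.1.2, x.2⟩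
    have hφ : Function.Injective φ := by
      rw [injective_iff_map_eq_zero]
      intro x hx
      have h1 : x.1.1 = 0 := congrArg Subtype.val hx
      have h2 : x.1.2 = 0 := hG.prop.2 _ (by rw [← h1]; exact x.2)
      exact Subtype.ext (Prod.ext h1 h2)
    let x : k × B := (b, s b)
    let ev : G[X] →+* k × B := eval₂RingHom G.subtype x
    have hGev : G ≤ ev.range := fun y hy ↦ ⟨C ⟨y, hy⟩, by simp [ev]⟩
    have hxev : x ∈ ev.range := ⟨X, by simp [ev]⟩
    have hevP : ev.range ∈ P := by
      refine ⟨?_, ?_⟩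
      · rintro _ ⟨f, rfl⟩
        have : (π.comp ((RingHom.snd k B).comp ev)) = g.comp ((RingHom.fst k B).comp ev) := by
          refine Polynomial.ringHom_ext (fun a ↦ ?_) ?_
          · simpa [ev] using hG.prop.1 a a.2
          · simpa [ev, x] using hs b
        exact DFunLike.congr_fun this f
      · rintro β ⟨f, hf⟩
        let t : G := ⟨(b ^ p, ψ b), hpG b⟩
        let q : G[X] := X ^ p - C t
        have hq : q.Monic := monic_X_pow_sub_C _ hp.ne_zero
        have hevq : ev q = 0 := by
          simp [ev, q, t, x, hψ (hs b)]
        have hnt : Nontrivial G := φ.domain_nontrivial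
        -- The remainder has degree less than `p` and `b` as a root, while `b` has degree `p` over
        -- `E`.
        have hr : f %ₘ q = 0 := by
          refine Polynomial.map_injective φ hφ ?_
          rw [Polynomial.map_zero]
          refine E.eq_zero_of_aeval_eq_zero_of_natDegree_lt hb hbp ?_ ?_
          · have h1 : aeval b ((f %ₘ q).map φ) = (ev (f %ₘ q)).1 := by
              have : (((aeval b : E[X] →ₐ[E] k) : E[X] →+* k).comp (mapRingHom φ)) =
                  (RingHom.fst k B).comp ev := by
                refine Polynomial.ringHom_ext (fun a ↦ ?_) ?_
                · simp [ev, φ, Subfield.algebraMap_ofSubfield]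
                · simp [ev, x]
              exact DFunLike.congr_fun this _
            have h2 := congrArg ev (modByMonic_add_div f q)
            rw [map_add, map_mul, hevq, zero_mul, add_zero, hf] at h2
            rw [h1, h2]
          · refine (degree_map_le.trans_lt (degree_modByMonic_lt f hq)).trans_le ?_
            rw [degree_X_pow_sub_C hp.pos]
        have h2 := congrArg ev (modByMonic_add_div f q)
        rw [map_add, map_mul, hevq, zero_mul, add_zero, hf, hr, map_zero] at h2
        exact (congrArg Prod.snd h2).symm
    have := hG.le_of_ge hevP hGev hxev
    exact hb (hE.2 ⟨_, this⟩)
  choose f hf using fun c ↦ hE.1 (htop c)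
  exact ⟨{ toFun := f
           map_one' := hinj (hf 1) (one_mem G)
           map_mul' := fun a b ↦ hinj (hf _) (mul_mem (hf a) (hf b))
           map_zero' := hinj (hf 0) (zero_mem G)
           map_add' := fun a b ↦ hinj (hf _) (add_mem (hf a) (hf b)) },
    RingHom.ext fun c ↦ hG.prop.1 _ (hf c)⟩

/-- A field of characteristic `p` is formally smooth over its prime field. -/
theorem Algebra.FormallySmooth.zmod_field (p : ℕ) [Fact p.Prime] (k : Type*) [Field k]
    [Algebra (ZMod p) k] : Algebra.FormallySmooth (ZMod p) k := by
  have : CharP k p := charP_of_injective_algebraMap (algebraMap (ZMod p) k).injective p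
  refine .of_comp_surjective fun B _ _ I hI f ↦ ?_
  rcases subsingleton_or_nontrivial B with hB | hB
  · let f₀ : k →+* B :=
      { toFun := 0, map_one' := Subsingleton.elim _ _, map_mul' := fun _ _ ↦ Subsingleton.elim _ _,
        map_zero' := rfl, map_add' := fun _ _ ↦ Subsingleton.elim _ _ }
    have : Subsingleton (B ⧸ I) := Ideal.Quotient.mk_surjective.subsingleton
    exact ⟨{ f₀ with commutes' := fun _ ↦ Subsingleton.elim _ _ },
      AlgHom.ext fun x ↦ Subsingleton.elim _ _⟩
  · have : CharP B p := charP_of_injective_algebraMap (algebraMap (ZMod p) B).injective p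
    obtain ⟨h, hh⟩ := RingHom.exists_comp_eq_of_charP p (Ideal.Quotient.mk I)
      Ideal.Quotient.mk_surjective (fun a b ha hb ↦ by
        rw [Ideal.Quotient.eq_zero_iff_mem] at ha hb
        have := Ideal.mul_mem_mul ha hb
        rwa [← pow_two, hI, Ideal.mem_bot] at this) f.toRingHom
    exact ⟨{ h with commutes' := fun r ↦
        RingHom.congr_fun (RingHom.ext_zmod (h.comp (algebraMap _ _)) (algebraMap _ _)) r },
      AlgHom.ext fun x ↦ RingHom.congr_fun hh x⟩

/-- A field of characteristic zero is formally smooth over every perfect subfield. -/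
theorem Algebra.FormallySmooth.of_charZero (K k : Type*) [Field K] [CharZero K] [Field k]
    [Algebra K k] : Algebra.FormallySmooth K k := by
  obtain ⟨ι, x, hx⟩ := exists_isTranscendenceBasis' K k
  have : Algebra.IsAlgebraic (IntermediateField.adjoin K (Set.range x)) k := hx.isAlgebraic_field
  have : CharZero (IntermediateField.adjoin K (Set.range x)) :=
    charZero_of_injective_algebraMap (algebraMap K _).injective
  have : Algebra.IsSeparable (IntermediateField.adjoin K (Set.range x)) k :=
    Algebra.IsAlgebraic.isSeparable_of_perfectField
  exact .of_algebraicIndependent_of_isSeparable hx.1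

end FormallySmoothField

/-! ### Lifting from rings whose reduction modulo `p` is a field. -/

section FormallySmoothZMod

variable {V : Type u} [CommRing V]

theorem ZMod.exists_one_tmul_eq (n : ℕ) (x : ZMod n ⊗[ℤ] V) : ∃ v : V, x = 1 ⊗ₜ v := by
  induction x with
  | zero => exact ⟨0, by simp⟩
  | tmul a v =>
    obtain ⟨m, rfl⟩ := ZMod.intCast_surjective a
    exact ⟨m • v, by rw [TensorProduct.tmul_smul, TensorProduct.smul_tmul', zsmul_one]⟩
  | add x y hx hy =>
    obtain ⟨v, rfl⟩ := hx
    obtain ⟨w, rfl⟩ := hy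
    exact ⟨v + w, by rw [TensorProduct.tmul_add]⟩

theorem RingHom.eq_zero_of_one_tmul_eq_zero {T : Type u} [CommRing T] (π : V →+* T) {n : ℕ}
    (hn : (n : T) = 0) {v : V} (h : (1 : ZMod n) ⊗ₜ[ℤ] v = 0) : π v = 0 := by
  let g : ZMod n →+* T := ZMod.castHom (ringChar.dvd hn) _
  let ev : ZMod n ⊗[ℤ] V →ₐ[ℤ] T :=
    Algebra.TensorProduct.productMap g.toIntAlgHom π.toIntAlgHom
  have h1 : ev (1 ⊗ₜ v) = π v := by simp [ev]
  rw [← h1, h, map_zero]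

theorem ZMod.one_tmul_eq_zero_iff (n : ℕ) (v : V) :
    (1 : ZMod n) ⊗ₜ[ℤ] v = 0 ↔ (n : V) ∣ v := by
  constructor
  · intro h
    rw [← Ideal.mem_span_singleton, ← Ideal.Quotient.eq_zero_iff_mem]
    refine RingHom.eq_zero_of_one_tmul_eq_zero _ ?_ h
    rw [← map_natCast (Ideal.Quotient.mk _), Ideal.Quotient.eq_zero_iff_mem]
    exact Ideal.mem_span_singleton_self _
  · rintro ⟨w, rfl⟩
    rw [← nsmul_eq_mul, TensorProduct.tmul_smul, TensorProduct.smul_tmul', nsmul_one,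
      ZMod.natCast_self, TensorProduct.zero_tmul]

/-- If `V` is a ring without `ℤ`-torsion such that `V / p` is a field, then `V / p ^ n` is formally
smooth over `ℤ / p ^ n`. -/
theorem Algebra.FormallySmooth.zmod_pow_tensorProduct [Module.Flat ℤ V] (p : ℕ) [Fact p.Prime]
    {k : Type u} [Field k] (κ : V →+* k) (hκ : Function.Surjective κ)
    (hker : RingHom.ker κ = Ideal.span {(p : V)}) (n : ℕ) :
    Algebra.FormallySmooth (ZMod (p ^ (n + 1))) (ZMod (p ^ (n + 1)) ⊗[ℤ] V) := by
  induction n with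
  | zero =>
    rw [zero_add, pow_one]
    have hp0 : (p : k) = 0 := by
      have : (p : V) ∈ RingHom.ker κ := hker ▸ Ideal.mem_span_singleton_self _
      simpa using this
    have hchar : CharP k p := (CharP.charP_iff_prime_eq_zero Fact.out).2 hp0
    let := ZMod.algebra k p
    have := Algebra.FormallySmooth.zmod_field p k
    let e : ZMod p ⊗[ℤ] V →ₐ[ZMod p] k :=
      Algebra.TensorProduct.lift (Algebra.ofId _ _) κ.toIntAlgHom (fun _ _ ↦ Commute.all _ _)
    have he (v : V) : e (1 ⊗ₜ v) = κ v := by simp [e]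
    refine .of_equiv (AlgEquiv.ofBijective e ⟨?_, ?_⟩).symm
    · rw [injective_iff_map_eq_zero]
      intro x hx
      obtain ⟨v, rfl⟩ := ZMod.exists_one_tmul_eq p x
      rw [he, ← RingHom.mem_ker, hker, Ideal.mem_span_singleton] at hx
      exact (ZMod.one_tmul_eq_zero_iff p v).2 hx
    · intro c
      obtain ⟨v, rfl⟩ := hκ c
      exact ⟨1 ⊗ₜ v, he v⟩
  | succ n ih =>
    have hdvd : p ^ (n + 1) ∣ p ^ (n + 1 + 1) := pow_dvd_pow _ (n + 1).le_succ
    let q : ZMod (p ^ (n + 1 + 1)) →+* ZMod (p ^ (n + 1)) := ZMod.castHom hdvd _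
    let qS : ZMod (p ^ (n + 1 + 1)) ⊗[ℤ] V →ₐ[ℤ] ZMod (p ^ (n + 1)) ⊗[ℤ] V :=
      Algebra.TensorProduct.map q.toIntAlgHom (AlgHom.id ℤ V)
    have hqS (v : V) : qS (1 ⊗ₜ v) = 1 ⊗ₜ v := by simp [qS]
    have hqker : RingHom.ker q = Ideal.span {((p ^ (n + 1) : ℕ) : ZMod (p ^ (n + 1 + 1)))} := by
      ext x
      obtain ⟨m, rfl⟩ := ZMod.intCast_surjective x
      rw [RingHom.mem_ker, map_intCast, ZMod.intCast_zmod_eq_zero_iff_dvd,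
        Ideal.mem_span_singleton]
      constructor
      · rintro ⟨c, rfl⟩
        exact ⟨c, by push_cast; rfl⟩
      · rintro ⟨c, hc⟩
        obtain ⟨c, rfl⟩ := ZMod.intCast_surjective c
        rw [← sub_eq_zero, ← Int.cast_natCast (p ^ (n + 1)), ← Int.cast_mul, ← Int.cast_sub,
          ZMod.intCast_zmod_eq_zero_iff_dvd] at hc
        have h2 : ((p ^ (n + 1) : ℕ) : ℤ) ∣ m - ((p ^ (n + 1) : ℕ) : ℤ) * c :=
          (Int.natCast_dvd_natCast.2 hdvd).trans hc
        exact (dvd_sub_left (dvd_mul_right _ _)).1 h2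
    have hflat := (RingHom.flat_algebraMap_iff (R := ZMod (p ^ (n + 1 + 1)))
      (S := ZMod (p ^ (n + 1 + 1)) ⊗[ℤ] V)).2 inferInstance
    -- A flat algebra is formally smooth if it becomes so modulo a square-zero ideal; here the ideal
    -- is generated by `p ^ (n + 1)`.
    refine (RingHom.formallySmooth_algebraMap).1 <|
      RingHom.FormallySmooth.of_flat_of_ker_eq_map_of_square_zero _ hflat q qS.toRingHom
      (algebraMap (ZMod (p ^ (n + 1))) _) (ZMod.ringHom_surjective q) ?_ (RingHom.ext_zmod _ _)
      ?_ ?_ ((RingHom.formallySmooth_algebraMap).2 ih)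
    · intro x
      obtain ⟨v, rfl⟩ := ZMod.exists_one_tmul_eq _ x
      exact ⟨1 ⊗ₜ v, hqS v⟩
    · rw [hqker, Ideal.span_singleton_pow, ← Nat.cast_pow, Ideal.span_singleton_eq_bot,
        ZMod.natCast_eq_zero_iff, ← pow_mul]
      exact pow_dvd_pow _ (by nlinarith)
    · rw [hqker, Ideal.map_span, Set.image_singleton, map_natCast]
      ext x
      obtain ⟨v, rfl⟩ := ZMod.exists_one_tmul_eq _ x
      rw [RingHom.mem_ker, Ideal.mem_span_singleton]
      change qS _ = 0 ↔ _
      rw [hqS, ZMod.one_tmul_eq_zero_iff]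
      constructor
      · rintro ⟨w, rfl⟩
        exact ⟨1 ⊗ₜ w, by
          rw [← nsmul_eq_mul, ← nsmul_eq_mul, TensorProduct.tmul_smul]⟩
      · rintro ⟨y, hy⟩
        obtain ⟨w, rfl⟩ := ZMod.exists_one_tmul_eq _ y
        have := congrArg qS hy
        rw [map_mul, map_natCast, hqS, hqS, ← nsmul_eq_mul, ← TensorProduct.tmul_smul,
          ← sub_eq_zero, ← TensorProduct.tmul_sub, ZMod.one_tmul_eq_zero_iff,
          nsmul_eq_mul] at this
        exact (dvd_sub_left (dvd_mul_right _ _)).1 this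

/-- Lifting along square-zero thickenings for rings without `ℤ`-torsion whose reduction
modulo `p` is a field. -/
theorem RingHom.exists_comp_eq_of_flat_int [Module.Flat ℤ V] (p : ℕ) [Fact p.Prime]
    {k : Type u} [Field k] (κ : V →+* k) (hκ : Function.Surjective κ)
    (hker : RingHom.ker κ = Ideal.span {(p : V)}) {B C : Type u} [CommRing B] [CommRing C]
    (π : B →+* C) (hπ : Function.Surjective π) (hπker : ∀ a b, π a = 0 → π b = 0 → a * b = 0)
    (n : ℕ) (hn : (p : B) ^ n = 0) (g : V →+* C) :
    ∃ f : V →+* B, π.comp f = g := by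
  have := Algebra.FormallySmooth.zmod_pow_tensorProduct p κ hκ hker n
  -- One power of `p` is given away, since smoothness is available over `ZMod (p ^ (n + 1))`.
  have hn' : ((p ^ (n + 1) : ℕ) : B) = 0 := by
    rw [Nat.cast_pow, pow_succ, hn, zero_mul]
  let : Algebra (ZMod (p ^ (n + 1))) B :=
    (ZMod.castHom (ringChar.dvd hn') B).toAlgebra
  let e := RingHom.quotientKerEquivOfSurjective hπ
  have hI : RingHom.ker π ^ 2 = ⊥ := by
    rw [pow_two, eq_bot_iff, Ideal.mul_le]
    exact fun a ha b hb ↦ hπker a b ha hb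
  let G : ZMod (p ^ (n + 1)) ⊗[ℤ] V →ₐ[ZMod (p ^ (n + 1))] B ⧸ RingHom.ker π :=
    Algebra.TensorProduct.lift (Algebra.ofId _ _) (e.symm.toRingHom.comp g).toIntAlgHom
      (fun _ _ ↦ Commute.all _ _)
  obtain ⟨F, hF⟩ := Algebra.FormallySmooth.comp_surjective _ _ _ hI G
  refine ⟨F.toRingHom.comp (Algebra.TensorProduct.includeRight (R := ℤ)).toRingHom,
    RingHom.ext fun v ↦ ?_⟩
  have h1 : G (1 ⊗ₜ v) = e.symm (g v) := by simp [G]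
  rw [← hF] at h1
  exact (RingEquiv.eq_symm_apply e).1 h1

/-- A homomorphism from a `ℤ`-torsion free ring `V` with `V / p` a field to the residue field of a
complete local ring of residue characteristic `p` lifts to the local ring. -/
theorem IsLocalRing.exists_residue_comp_eq_of_flat_int [Module.Flat ℤ V] (p : ℕ) [Fact p.Prime]
    {k : Type u} [Field k] (κ : V →+* k) (hκ : Function.Surjective κ)
    (hker : RingHom.ker κ = Ideal.span {(p : V)}) {A : Type u} [CommRing A] [IsLocalRing A]
    [IsAdicComplete (maximalIdeal A) A] (hp : (p : A) ∈ maximalIdeal A)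
    (g : V →+* ResidueField A) :
    ∃ f : V →+* A, (residue A).comp f = g := by
  -- The kernel of each transition map has square zero and `p` is nilpotent in each quotient, so the
  -- lift is built one power at a time and completeness assembles it.
  have hstep (n : ℕ) (h : V →+* A ⧸ maximalIdeal A ^ (n + 1)) :
      ∃ f : V →+* A ⧸ maximalIdeal A ^ (n + 2),
        (Ideal.Quotient.factorPow (maximalIdeal A) (n + 1).le_succ).comp f = h := by
    refine RingHom.exists_comp_eq_of_flat_int p κ hκ hker _
      (Ideal.Quotient.factor_surjective _) ?_ (n + 2) ?_ h
    · intro a b ha hb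
      obtain ⟨a, rfl⟩ := Ideal.Quotient.mk_surjective a
      obtain ⟨b, rfl⟩ := Ideal.Quotient.mk_surjective b
      simp only [Ideal.Quotient.factor_mk, Ideal.Quotient.eq_zero_iff_mem] at ha hb
      rw [← map_mul, Ideal.Quotient.eq_zero_iff_mem]
      have := Ideal.mul_mem_mul ha hb
      rw [← pow_add] at this
      exact Ideal.pow_le_pow_right (by lia) this
    · rw [← map_natCast (Ideal.Quotient.mk (maximalIdeal A ^ (n + 2))), ← map_pow,
        Ideal.Quotient.eq_zero_iff_mem]
      exact Ideal.pow_mem_pow hp _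
  let e : A ⧸ maximalIdeal A ^ (0 + 1) ≃+* ResidueField A :=
    Ideal.quotEquivOfEq (by rw [zero_add, pow_one])
  choose next hnext using hstep
  let F : ∀ n, V →+* A ⧸ maximalIdeal A ^ (n + 1) := fun n ↦
    Nat.rec (e.symm.toRingHom.comp g) (fun n h ↦ next n h) n
  have hF (n : ℕ) : (Ideal.Quotient.factorPow (maximalIdeal A) (n + 1).le_succ).comp (F (n + 1)) =
    F n := hnext n (F n)
  have hmono : StrictMono fun n : ℕ ↦ n + 1 := fun _ _ h ↦ Nat.succ_lt_succ h
  let f := IsAdicComplete.StrictMono.liftRingHom (maximalIdeal A) hmono F (hF _)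
  refine ⟨f, RingHom.ext fun v ↦ ?_⟩
  have h1 : Ideal.Quotient.mk (maximalIdeal A ^ (0 + 1)) (f v) = F 0 v :=
    IsAdicComplete.StrictMono.mk_liftRingHom (maximalIdeal A) hmono F (hF _) (n := 0) v
  exact (RingEquiv.eq_symm_apply e).1 h1

end FormallySmoothZMod

/-! ### Existence of Cohen rings. -/

section CohenRing

open Polynomial

/-- In a local domain over which nonconstant monic polynomials have roots, every root of a monic
polynomial in the residue field lifts to a root. -/
theorem IsLocalRing.exists_isRoot_residue_eq {O : Type*} [CommRing O] [IsLocalRing O]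
    (hO : ∀ f : O[X], f.Monic → f.natDegree ≠ 0 → ∃ c, f.IsRoot c) (f : O[X]) (hf : f.Monic)
    (b : ResidueField O) (hb : (f.map (residue O)).IsRoot b) :
    ∃ c, f.IsRoot c ∧ residue O c = b := by
  induction hn : f.natDegree generalizing f with
  | zero =>
    rw [hf.natDegree_eq_zero.1 hn] at hb
    simp at hb
  | succ n ih =>
    obtain ⟨c, hc⟩ := hO f hf (by lia)
    obtain ⟨g, rfl⟩ := dvd_iff_isRoot.2 hc
    have hg : g.Monic := (monic_X_sub_C c).of_mul_monic_left hf
    rw [Polynomial.map_mul, IsRoot, eval_mul, mul_eq_zero] at hb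
    rcases hb with hb | hb
    · refine ⟨c, hc, ?_⟩
      simp only [Polynomial.map_sub, map_X, map_C, eval_sub, eval_X, eval_C] at hb
      exact (sub_eq_zero.1 hb).symm
    · obtain ⟨d, hd, hdb⟩ := ih g hg hb (by
        rw [(monic_X_sub_C c).natDegree_mul hg, natDegree_X_sub_C] at hn
        lia)
      exact ⟨d, by rw [IsRoot, eval_mul, hd.eq_zero, mul_zero], hdb⟩

/-- The root found in the algebraically closed field is integral, and valuation rings are integrally
closed. -/
theorem ValuationSubring.exists_isRoot_of_isAlgClosed {Ω : Type*} [Field Ω] [IsAlgClosed Ω]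
    (O : ValuationSubring Ω) (f : O[X]) (hf : f.Monic) (hdeg : f.natDegree ≠ 0) :
    ∃ c, f.IsRoot c := by
  obtain ⟨x, hx⟩ := IsAlgClosed.exists_aeval_eq_zero Ω f (by
    rw [degree_eq_natDegree hf.ne_zero]
    exact_mod_cast hdeg)
  obtain ⟨c, rfl⟩ := IsIntegrallyClosed.isIntegral_iff.1 (⟨f, hf, hx⟩ : IsIntegral O x)
  refine ⟨c, ?_⟩
  rw [aeval_algebraMap_apply] at hx
  exact (map_eq_zero_iff _ (IsFractionRing.injective O Ω)).1 hx

/-- In a local ring `O` over which nonconstant monic polynomials have roots, any subfield of the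
residue field is the image of a subring `V` of `O` whose intersection with the maximal ideal is
generated by `p`. -/
theorem IsLocalRing.exists_subring_map_residue_eq {O : Type u} [CommRing O] [IsLocalRing O]
    (hO : ∀ f : O[X], f.Monic → f.natDegree ≠ 0 → ∃ c, f.IsRoot c) (p : ℕ) (hp : p.Prime)
    (hpO : (p : O) ∈ maximalIdeal O) (k : Subfield (ResidueField O)) :
    ∃ V : Subring O, (∀ x ∈ V, x ∈ maximalIdeal O → ∃ y ∈ V, x = p * y) ∧
      (∀ x ∈ V, residue O x ∈ k) ∧ ∀ b ∈ k, ∃ x ∈ V, residue O x = b := by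
  -- Subrings whose intersection with the maximal ideal is `p` times themselves and whose residues
  -- lie in `k`. A maximal one will have all of `k` as residues.
  let P : Set (Subring O) := {V | (∀ x ∈ V, x ∈ maximalIdeal O → ∃ y ∈ V, x = p * y) ∧
      (∀ x ∈ V, residue O x ∈ k)}
  have hP₀ : (Int.castRingHom O).range ∈ P := by
    refine ⟨?_, ?_⟩
    · rintro _ ⟨m, rfl⟩ hm
      by_cases hd : (p : ℤ) ∣ m
      · obtain ⟨c, rfl⟩ := hd
        exact ⟨c, ⟨c, rfl⟩, by simp⟩
      · have : IsCoprime (p : ℤ) m := (Nat.prime_iff_prime_int.1 hp).coprime_iff_not_dvd.2 hd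
        obtain ⟨a, b, hab⟩ := this
        refine absurd ?_ (Ideal.ne_top_iff_one _ |>.1 (maximalIdeal.isMaximal O).ne_top)
        have h1 := congrArg (Int.cast : ℤ → O) hab
        push_cast at h1
        rw [← h1]
        exact add_mem (Ideal.mul_mem_left _ _ hpO) (Ideal.mul_mem_left _ _ hm)
    · rintro _ ⟨m, rfl⟩
      simp
  obtain ⟨V, -, hV⟩ := zorn_le_nonempty₀ P (fun c hcP hc y hy ↦ by
    refine ⟨sSup c, ⟨fun x hx hxm ↦ ?_, fun x hx ↦ ?_⟩, fun z hz ↦ le_sSup hz⟩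
    · obtain ⟨S, hS, hx⟩ := (Subring.mem_sSup_of_directedOn ⟨y, hy⟩ hc.directedOn).1 hx
      obtain ⟨z, hz, rfl⟩ := (hcP hS).1 x hx hxm
      exact ⟨z, (le_sSup hS : S ≤ sSup c) hz, rfl⟩
    · obtain ⟨S, hS, hx⟩ := (Subring.mem_sSup_of_directedOn ⟨y, hy⟩ hc.directedOn).1 hx
      exact (hcP hS).2 x hx) _ hP₀
  refine ⟨V, hV.prop.1, hV.prop.2, ?_⟩
  -- Inverting the elements of `V` that are units of `O` stays within `P`, so maximality makes `V`
  -- closed under such inverses. The residues of `V` therefore form a field `E`.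
  have hinv {u v : O} (hu : u ∈ V) (huv : u * v = 1) : v ∈ V := by
    let V' : Subring O :=
      { carrier := {x | ∃ s ∈ V, IsUnit s ∧ s * x ∈ V}
        mul_mem' := by
          rintro a b ⟨s, hs, hsu, h⟩ ⟨t, ht, htu, h'⟩
          exact ⟨s * t, mul_mem hs ht, hsu.mul htu, by
            rw [mul_mul_mul_comm]; exact mul_mem h h'⟩
        one_mem' := ⟨1, one_mem V, isUnit_one, by simp [one_mem]⟩
        add_mem' := by
          rintro a b ⟨s, hs, hsu, h⟩ ⟨t, ht, htu, h'⟩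
          refine ⟨s * t, mul_mem hs ht, hsu.mul htu, ?_⟩
          rw [show s * t * (a + b) = t * (s * a) + s * (t * b) by ring]
          exact add_mem (mul_mem ht h) (mul_mem hs h')
        zero_mem' := ⟨1, one_mem V, isUnit_one, by simp [zero_mem]⟩
        neg_mem' := by
          rintro a ⟨s, hs, hsu, h⟩
          exact ⟨s, hs, hsu, by rw [mul_neg]; exact neg_mem h⟩ }
    have hVV' : V ≤ V' := fun x hx ↦ ⟨1, one_mem V, isUnit_one, by rwa [one_mul]⟩
    have hV'P : V' ∈ P := by
      refine ⟨?_, ?_⟩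
      · rintro x ⟨s, hs, ⟨s, rfl⟩, h⟩ hx
        obtain ⟨y, hy, hxy⟩ := hV.prop.1 _ h (Ideal.mul_mem_left _ _ hx)
        refine ⟨↑s⁻¹ * y, ⟨s, hs, s.isUnit, by simpa using hy⟩, ?_⟩
        rw [mul_left_comm, ← hxy, Units.inv_mul_cancel_left]
      · rintro x ⟨s, hs, hsu, h⟩
        have h0 : residue O s ≠ 0 := (hsu.map (residue O)).ne_zero
        have := mul_mem (inv_mem (hV.prop.2 s hs)) (hV.prop.2 _ h)
        rwa [map_mul, inv_mul_cancel_left₀ h0] at this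
    exact hV.le_of_ge hV'P hVV' ⟨u, hu, .of_mul_eq_one v huv, huv ▸ one_mem V⟩
  let E : Subfield (ResidueField O) :=
    { V.map (residue O) with
      inv_mem' := by
        rintro _ ⟨x, hx, rfl⟩
        by_cases hxm : x ∈ maximalIdeal O
        · rw [(residue_eq_zero_iff x).2 hxm, inv_zero]
          exact (V.map (residue O)).zero_mem
        · obtain ⟨v, hv⟩ := isUnit_iff_exists_inv.1 (not_not.1 fun h ↦ hxm
            ((mem_maximalIdeal x).2 h))
          refine ⟨v, hinv hx hv, ?_⟩
          exact eq_inv_of_mul_eq_one_right (by rw [← map_mul, hv, map_one]) }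
  let φ : V →+* E := ((residue O).comp V.subtype).codRestrict E fun x ↦ ⟨x, x.2, rfl⟩
  have hφ : Function.Surjective φ := by
    rintro ⟨_, x, hx, rfl⟩
    exact ⟨⟨x, hx⟩, rfl⟩
  intro b hb
  -- It is enough to lift `b` to some `c` for which `V[c]` still meets the maximal ideal in `p`
  -- times itself.
  suffices h : ∃ c : O, residue O c = b ∧ ∀ f : V[X], eval₂ V.subtype c f ∈ maximalIdeal O →
      ∃ g : V[X], eval₂ V.subtype c f = p * eval₂ V.subtype c g by
    obtain ⟨c, hcb, hc⟩ := h
    let V' := (eval₂RingHom V.subtype c).range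
    have hV'P : V' ∈ P := by
      refine ⟨?_, ?_⟩
      · rintro _ ⟨f, rfl⟩ hf
        obtain ⟨g, hg⟩ := hc f hf
        exact ⟨_, ⟨g, rfl⟩, hg⟩
      · rintro _ ⟨f, rfl⟩
        rw [coe_eval₂RingHom, hom_eval₂, hcb, eval₂_eq_sum, sum_def]
        exact sum_mem fun i _ ↦ mul_mem (hV.prop.2 _ (f.coeff i).2) (pow_mem hb _)
    refine ⟨c, hV.le_of_ge hV'P (fun y hy ↦ ⟨C ⟨y, hy⟩, by simp⟩) ⟨X, by simp⟩, hcb⟩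
  have hzero (f : V[X]) (hf : f.map φ = 0) : ∃ g : V[X], f = C (p : V) * g := by
    refine C_dvd_iff_dvd_coeff _ _ |>.2 fun i ↦ ?_
    have h1 : residue O (f.coeff i) = 0 := by
      have := congrArg (fun q ↦ (q.coeff i : ResidueField O)) hf
      simp only [coeff_map, coeff_zero] at this
      exact this
    obtain ⟨y, hy, hxy⟩ := hV.prop.1 _ (f.coeff i).2 ((residue_eq_zero_iff _).1 h1)
    exact ⟨⟨y, hy⟩, Subtype.ext (by simpa using hxy)⟩
  have hev (c : O) (hc : residue O c = b) (f : V[X]) :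
      residue O (eval₂ V.subtype c f) = aeval b (f.map φ) := by
    rw [hom_eval₂, hc, aeval_def, eval₂_map]
    rfl
  by_cases halg : IsAlgebraic E b
  · have hint : IsIntegral E b := halg.isIntegral
    -- For algebraic `b`, take `c` to be a root of a monic lift of the minimal polynomial.
    -- Remainders modulo `M` have too small a degree to vanish at `b` unless all their coefficients
    -- reduce to zero.
    obtain ⟨M, hM, -, hMmonic⟩ := lifts_and_natDegree_eq_and_monic
      ((mem_lifts (minpoly E b)).2 (Polynomial.map_surjective φ hφ _)) (minpoly.monic hint)
    obtain ⟨c, hc, hcb⟩ := IsLocalRing.exists_isRoot_residue_eq hO (M.map V.subtype)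
      (hMmonic.map _) b (by
        rw [IsRoot, Polynomial.map_map, eval_map]
        have := minpoly.aeval E b
        rw [← hM, aeval_def, eval₂_map] at this
        exact this)
    refine ⟨c, hcb, fun f hf ↦ ?_⟩
    have hMc : eval₂ V.subtype c M = 0 := by rwa [IsRoot, eval_map] at hc
    have heq : eval₂ V.subtype c f = eval₂ V.subtype c (f %ₘ M) := by
      conv_lhs => rw [← modByMonic_add_div f M]
      rw [eval₂_add, eval₂_mul, hMc, zero_mul, add_zero]
    have h0 : (f %ₘ M).map φ = 0 := by
      by_contra hne
      have h1 : aeval b ((f %ₘ M).map φ) = 0 := by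
        rw [← hev c hcb, ← heq]
        exact (residue_eq_zero_iff _).2 hf
      have h2 := minpoly.degree_le_of_ne_zero E b hne h1
      rw [← hM, hMmonic.degree_map] at h2
      exact absurd (degree_map_le.trans_lt (degree_modByMonic_lt f hMmonic)) (not_lt.2 h2)
    obtain ⟨g, hg⟩ := hzero _ h0
    exact ⟨g, by rw [heq, hg, eval₂_mul, eval₂_C]; simp⟩
  -- For transcendental `b` every lift works, as a polynomial that vanishes at `b` is zero.
  · obtain ⟨c, hcb⟩ := residue_surjective b
    refine ⟨c, hcb, fun f hf ↦ ?_⟩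
    have h0 : f.map φ = 0 := by
      by_contra hne
      refine halg ⟨f.map φ, hne, ?_⟩
      rw [← hev c hcb]
      exact (residue_eq_zero_iff _).2 hf
    obtain ⟨g, hg⟩ := hzero _ h0
    exact ⟨g, by rw [hg, eval₂_mul, eval₂_C]; simp⟩

/-- Every field `k` of characteristic `p` is of the form `V / p` for a domain `V` of characteristic
zero. -/
theorem exists_charZero_isDomain_ker_eq_span (p : ℕ) [Fact p.Prime] (k : Type u) [Field k]
    [CharP k p] :
    ∃ (V : Type u) (_ : CommRing V) (_ : IsDomain V) (_ : CharZero V) (κ : V →+* k),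
      Function.Surjective κ ∧ RingHom.ker κ = Ideal.span {(p : V)} := by
  -- The polynomial ring over `ℤ` with one variable for each element of `k` has characteristic zero
  -- and maps onto `k`.
  let A := MvPolynomial k ℤ
  let e : A →+* k := MvPolynomial.eval₂Hom (Int.castRingHom k) id
  have he : Function.Surjective e := fun x ↦ ⟨MvPolynomial.X x, MvPolynomial.eval₂_X _ _ _⟩
  let Ω := AlgebraicClosure (FractionRing A)
  have hAΩ : Function.Injective (algebraMap A Ω) := by
    rw [IsScalarTower.algebraMap_eq A (FractionRing A) Ω]
    exact (algebraMap (FractionRing A) Ω).injective.comp (IsFractionRing.injective A _)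
  let j : A →+* (algebraMap A Ω).range := (algebraMap A Ω).rangeRestrict
  have hj : Function.Bijective j :=
    ⟨fun x y h ↦ hAΩ (congrArg Subtype.val h), (algebraMap A Ω).rangeRestrict_surjective⟩
  let jj := RingEquiv.ofBijective j hj
  let q : Ideal (algebraMap A Ω).range := RingHom.ker (e.comp jj.symm.toRingHom)
  -- A valuation ring whose maximal ideal contains the kernel of `e` has `k` inside its residue
  -- field; the algebraically closed ambient field supplies roots of monic polynomials.
  obtain ⟨O, hAO, hqO⟩ := Ideal.image_subset_nonunits_valuationSubring q (RingHom.ker_ne_top _)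
  let i : A →+* O := (algebraMap A Ω).codRestrict O.toSubring fun x ↦ hAO ⟨x, rfl⟩
  have hi (x : A) (hx : e x = 0) : residue O (i x) = 0 := by
    rw [residue_eq_zero_iff, ← O.coe_mem_nonunits_iff]
    refine hqO ⟨j x, ?_, rfl⟩
    change e (jj.symm (jj x)) = 0
    rwa [jj.symm_apply_apply]
  obtain ⟨g, hg⟩ : ∃ g : k →+* ResidueField O, g.comp e = (residue O).comp i :=
    ⟨e.liftOfSurjective he ⟨(residue O).comp i, hi⟩, RingHom.liftOfRightInverse_comp _ _ _ _⟩
  have hpO : (p : O) ∈ maximalIdeal O := by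
    rw [← residue_eq_zero_iff, ← map_natCast i]
    exact hi _ (by simp)
  obtain ⟨V, hV1, hV2, hV3⟩ := IsLocalRing.exists_subring_map_residue_eq
    O.exists_isRoot_of_isAlgClosed p Fact.out hpO g.fieldRange
  let κ₀ : V →+* g.fieldRange := ((residue O).comp V.subtype).codRestrict _ fun x ↦ hV2 x x.2
  let eg : k ≃+* g.fieldRange := RingEquiv.ofBijective g.rangeRestrictField
    ⟨g.rangeRestrictField.injective, by rintro ⟨_, x, rfl⟩; exact ⟨x, rfl⟩⟩
  have hO : CharZero O :=
    charZero_of_injective_ringHom (f := i) (fun x y h ↦ hAΩ (congrArg Subtype.val h))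
  refine ⟨V, inferInstance, inferInstance, ⟨fun m n h ↦ ?_⟩,
    eg.symm.toRingHom.comp κ₀, ?_, ?_⟩
  · have := congrArg V.subtype h
    rw [map_natCast, map_natCast] at this
    exact_mod_cast this
  · refine eg.symm.surjective.comp ?_
    rintro ⟨b, hb⟩
    obtain ⟨x, hx, rfl⟩ := hV3 b hb
    exact ⟨⟨x, hx⟩, rfl⟩
  · ext x
    have : eg.symm.toRingHom.comp κ₀ x = 0 ↔ residue O x = 0 := by
      change eg.symm (κ₀ x) = 0 ↔ _
      rw [map_eq_zero_iff _ eg.symm.injective]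
      exact Subtype.ext_iff
    rw [RingHom.mem_ker, this, residue_eq_zero_iff, Ideal.mem_span_singleton]
    constructor
    · intro hx
      obtain ⟨y, hy, hxy⟩ := hV1 x x.2 hx
      exact ⟨⟨y, hy⟩, Subtype.ext (by simpa using hxy)⟩
    · rintro ⟨y, rfl⟩
      push_cast
      exact Ideal.mul_mem_right _ _ hpO

/-- A local ring with maximal ideal generated by a non-nilpotent element, and separated in the
adic topology, is a discrete valuation ring. -/
theorem IsLocalRing.isDiscreteValuationRing_of_maximalIdeal_eq_span {Λ : Type u} [CommRing Λ]
    [IsLocalRing Λ] [IsHausdorff (maximalIdeal Λ) Λ] (ϖ : Λ)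
    (hϖ : maximalIdeal Λ = Ideal.span {ϖ}) (hnil : ¬ IsNilpotent ϖ) :
    ∃ _ : IsDomain Λ, IsDiscreteValuationRing Λ := by
  have hfac (x : Λ) (hx : x ≠ 0) : ∃ (n : ℕ) (u : Λˣ), ϖ ^ n * u = x := by
    by_contra hcon
    push Not at hcon
    have hdvd (n : ℕ) : ϖ ^ n ∣ x := by
      induction n with
      | zero => simp
      | succ n ih =>
        obtain ⟨y, rfl⟩ := ih
        have hy : y ∈ maximalIdeal Λ := by
          rw [mem_maximalIdeal]
          rintro ⟨u, rfl⟩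
          exact hcon n u rfl
        rw [hϖ, Ideal.mem_span_singleton] at hy
        obtain ⟨z, rfl⟩ := hy
        exact ⟨z, by ring⟩
    refine hx (IsHausdorff.haus' (I := maximalIdeal Λ) x fun n ↦ ?_)
    rw [SModEq.zero, smul_eq_mul, Ideal.mul_top, hϖ, Ideal.span_singleton_pow,
      Ideal.mem_span_singleton]
    exact hdvd n
  have hdom : IsDomain Λ := by
    have : NoZeroDivisors Λ := ⟨fun {x y} hxy ↦ by
      by_contra hcon
      push Not at hcon
      obtain ⟨m, u, rfl⟩ := hfac x hcon.1
      obtain ⟨n, v, rfl⟩ := hfac y hcon.2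
      refine hnil ⟨m + n, ?_⟩
      have : ϖ ^ (m + n) * ↑(u * v) = 0 := by rw [← hxy]; push_cast; ring
      exact (Units.mul_left_eq_zero _).1 this⟩
    exact NoZeroDivisors.to_isDomain Λ
  refine ⟨hdom, IsDiscreteValuationRing.ofHasUnitMulPowIrreducibleFactorization ⟨ϖ, ?_, ?_⟩⟩
  · have h0 : ϖ ≠ 0 := fun h ↦ hnil (h ▸ IsNilpotent.zero)
    have : Prime ϖ := by
      rw [← Ideal.span_singleton_prime h0, ← hϖ]
      exact (maximalIdeal.isMaximal Λ).isPrime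
    exact this.irreducible
  · intro x hx
    obtain ⟨n, u, rfl⟩ := hfac x hx
    exact ⟨n, ⟨u, rfl⟩⟩

/-- A positive characteristic would be a prime other than `p`, and Bézout would make `p` a unit. -/
theorem IsLocalRing.charZero_of_maximalIdeal_eq_span {Λ : Type u} [CommRing Λ] [IsDomain Λ]
    [IsLocalRing Λ] (p : ℕ) [Fact p.Prime] (h : maximalIdeal Λ = Ideal.span {(p : Λ)})
    (hp0 : (p : Λ) ≠ 0) : CharZero Λ := by
  rw [← CharP.charP_zero_iff_charZero]
  obtain ⟨q, hq⟩ := CharP.exists Λ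
  rcases CharP.char_is_prime_or_zero Λ q with hqp | rfl
  · exfalso
    have hne : q ≠ p := by
      rintro rfl
      exact hp0 (CharP.cast_eq_zero Λ q)
    have h1 : IsCoprime (q : ℤ) p :=
      Nat.isCoprime_iff_coprime.2 ((Nat.coprime_primes hqp Fact.out).2 hne)
    obtain ⟨a, b, hab⟩ := h1
    have h2 := congrArg (Int.cast : ℤ → Λ) hab
    push_cast at h2
    rw [CharP.cast_eq_zero Λ q, mul_zero, zero_add] at h2
    refine (maximalIdeal.isMaximal Λ).ne_top ((Ideal.eq_top_iff_one _).2 ?_)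
    rw [← h2, h]
    exact Ideal.mul_mem_left _ _ (Ideal.mem_span_singleton_self _)
  · exact hq

/-- Existence of Cohen rings: every field `k` of characteristic `p` is the residue field of a
complete discrete valuation ring of characteristic zero with uniformizer `p`. -/
theorem exists_isDiscreteValuationRing_ker_eq_span (p : ℕ) [Fact p.Prime] (k : Type u) [Field k]
    [CharP k p] :
    ∃ (V : Type u) (_ : CommRing V) (_ : IsDomain V) (_ : IsDiscreteValuationRing V)
      (_ : CharZero V) (_ : IsAdicComplete (maximalIdeal V) V) (κ : V →+* k),
      Function.Surjective κ ∧ RingHom.ker κ = Ideal.span {(p : V)} ∧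
        maximalIdeal V = Ideal.span {(p : V)} := by
  have hp : p.Prime := Fact.out
  obtain ⟨V, _, _, _, κ, hκ, hker⟩ := exists_charZero_isDomain_ker_eq_span p k
  let I : Ideal V := Ideal.span {(p : V)}
  have hImax : I.IsMaximal := by
    rw [show I = RingHom.ker κ from hker.symm]
    exact RingHom.ker_isMaximal_of_surjective κ hκ
  have hfg : I.FG := ⟨{(p : V)}, by simp [I]⟩
  -- The `p`-adic completion of `V` has the same residue field; its maximal ideal is generated by
  -- `p`.
  let Λ := AdicCompletion I V
  have hmapI : I.map (algebraMap V Λ) = Ideal.span {(p : Λ)} := by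
    rw [Ideal.map_span, Set.image_singleton, map_natCast]
  have hmax : (I.map (algebraMap V Λ)).IsMaximal :=
    AdicCompletion.isMaximal_map_of_le I I le_rfl hfg
  have hcomp : IsAdicComplete (I.map (algebraMap V Λ)) Λ := AdicCompletion.isAdicComplete_self I hfg
  have hloc : IsLocalRing Λ := isLocalRing_of_isAdicComplete_maximal (I.map (algebraMap V Λ))
  have hmI : maximalIdeal Λ = I.map (algebraMap V Λ) := (eq_maximalIdeal hmax).symm
  have hcomp' : IsAdicComplete (maximalIdeal Λ) Λ := hmI ▸ hcomp
  have hpV : (p : V) ≠ 0 := Nat.cast_ne_zero.2 hp.ne_zero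
  -- If `p ^ n` vanished in `Λ`, then `p ^ (n + 1)` would divide it in the domain `V`, so `p` would
  -- be a unit of `V`.
  have hnil : ¬ IsNilpotent (p : Λ) := by
    rintro ⟨n, hn⟩
    rw [← map_natCast (algebraMap V Λ), ← map_pow] at hn
    have h1 := congrArg (AdicCompletion.evalₐ I (n + 1)) hn
    rw [AdicCompletion.algebraMap_apply, map_zero] at h1
    change AdicCompletion.evalₐ I (n + 1) (AdicCompletion.of I V _) = 0 at h1
    rw [AdicCompletion.evalₐ_of, Ideal.Quotient.eq_zero_iff_mem, Ideal.span_singleton_pow,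
      Ideal.mem_span_singleton] at h1
    obtain ⟨c, hc⟩ := h1
    have h2 : (p : V) * c = 1 := by
      refine mul_left_cancel₀ (pow_ne_zero n hpV) ?_
      rw [mul_one, ← mul_assoc, ← pow_succ]
      exact hc.symm
    exact hImax.ne_top ((Ideal.eq_top_iff_one _).2 (h2 ▸ Ideal.mul_mem_right _ _
      (Ideal.mem_span_singleton_self _)))
  obtain ⟨hdom, hdvr⟩ := isDiscreteValuationRing_of_maximalIdeal_eq_span (p : Λ)
    (hmI.trans hmapI) hnil
  have hp0 : (p : Λ) ≠ 0 := fun h ↦ hnil (h ▸ IsNilpotent.zero)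
  have hchar : CharZero Λ := charZero_of_maximalIdeal_eq_span p (hmI.trans hmapI) hp0
  let e : V ⧸ I ≃+* k :=
    (Ideal.quotEquivOfEq hker.symm).trans (RingHom.quotientKerEquivOfSurjective hκ)
  refine ⟨Λ, inferInstance, hdom, hdvr, hchar, hcomp',
    e.toRingHom.comp (AdicCompletion.evalOneₐ I).toRingHom, ?_, ?_, hmI.trans hmapI⟩
  · exact e.surjective.comp (AdicCompletion.evalOneₐ_surjective I)
  · rw [← hmapI, ← AdicCompletion.ker_evalOneₐ_eq_map I hfg]
    ext x
    exact map_eq_zero_iff e e.injective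

end CohenRing

/-! ### Evaluation of power series in complete local rings. -/

section Evaluation

open PowerSeries

/-- A homomorphism to a complete local ring extends to power series in one variable, with any
prescribed value of the variable in the maximal ideal. -/
theorem PowerSeries.exists_ringHom_of_mem_maximalIdeal {Λ A : Type*} [CommRing Λ] [CommRing A]
    [IsLocalRing A] [IsAdicComplete (maximalIdeal A) A] (f : Λ →+* A) {x : A}
    (hx : x ∈ maximalIdeal A) :
    ∃ g : Λ⟦X⟧ →+* A, (∀ a, g (C a) = f a) ∧ g X = x := by
  -- With the discrete topology on `Λ`, continuity of `f` is automatic.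
  let : UniformSpace Λ := ⊥
  have : DiscreteTopology Λ := ⟨rfl⟩
  let : WithIdeal A := ⟨maximalIdeal A⟩
  have hI : IsAdic (maximalIdeal A) := rfl
  obtain ⟨h1, h2⟩ := hI.isAdicComplete_iff.1 ‹_›
  have hf : Continuous f := continuous_of_discreteTopology
  have hx' : HasEval x := by
    rw [hasEval_def, IsTopologicallyNilpotent, hI.hasBasis_nhds_zero.tendsto_right_iff]
    intro n _
    filter_upwards [Filter.eventually_ge_atTop n] with m hm
    exact Ideal.pow_le_pow_right hm (Ideal.pow_mem_pow hx m)
  refine ⟨eval₂Hom hf hx', fun a ↦ ?_, ?_⟩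
  · rw [coe_eval₂Hom, eval₂_C]
  · rw [coe_eval₂Hom, eval₂_X]

end Evaluation

/-! ### Japanese domains and finite extensions. -/

section FiniteExtension

open nonZeroDivisors

/-- A domain finite over a noetherian japanese domain is japanese. -/
theorem IsJapanese.of_finite {P A : Type u} [CommRing P] [IsDomain P] [IsNoetherianRing P]
    [CommRing A] [IsDomain A] [Algebra P A] [FaithfulSMul P A] [Module.Finite P A]
    (hP : IsJapanese P) : IsJapanese A := by
  intro K L _ _ _ _ _ _ _ _
  obtain ⟨F, _, _, _⟩ : ∃ (F : Type u) (_ : Field F) (_ : Algebra P F), IsFractionRing P F :=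
    ⟨FractionRing P, inferInstance, inferInstance, inferInstance⟩
  let : Algebra P K := ((algebraMap A K).comp (algebraMap P A)).toAlgebra
  have : IsScalarTower P A K := .of_algebraMap_eq fun _ ↦ rfl
  have hinj : Function.Injective (algebraMap P K) :=
    (IsFractionRing.injective A K).comp (FaithfulSMul.algebraMap_injective P A)
  let : Algebra F K := (IsFractionRing.lift hinj).toAlgebra
  have : IsScalarTower P F K := .of_algebraMap_eq fun x ↦ (IsFractionRing.lift_algebraMap hinj x).symm
  have : Module.Finite F K := Module.Finite.of_isLocalization P A P⁰
  let : Algebra F L := ((algebraMap K L).comp (algebraMap F K)).toAlgebra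
  have : IsScalarTower F K L := .of_algebraMap_eq fun _ ↦ rfl
  have : Module.Finite F L := Module.Finite.trans K L
  let : Algebra P L := ((algebraMap F L).comp (algebraMap P F)).toAlgebra
  have : IsScalarTower P F L := .of_algebraMap_eq fun _ ↦ rfl
  have : IsScalarTower P A L := .of_algebraMap_eq fun x ↦ by
    rw [IsScalarTower.algebraMap_apply A K L, ← IsScalarTower.algebraMap_apply P A K,
      IsScalarTower.algebraMap_apply P F K]
    rfl
  have h1 := hP F L
  let g : integralClosure A L →ₗ[P] integralClosure P L :=
    { toFun x := ⟨x, isIntegral_trans (R := P) (A := A) _ x.2⟩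
      map_add' _ _ := rfl
      map_smul' _ _ := rfl }
  have h2 : Module.Finite P (integralClosure A L) :=
    Module.Finite.of_injective g fun x y h ↦ Subtype.ext congr(($h).1)
  exact Module.Finite.of_restrictScalars_finite P A _

end FiniteExtension

/-! ### Cohen's structure theorem, and Nagata's theorem on complete local domains. -/

section Structure

variable {A : Type u} [CommRing A] [IsLocalRing A]

/-- Adjoining finitely many variables to a complete local noetherian normal japanese domain mapping
to a complete local ring. -/
theorem IsLocalRing.exists_isJapanese_extension [IsAdicComplete (maximalIdeal A) A] (l : List A)
    (hl : ∀ x ∈ l, x ∈ maximalIdeal A) {Λ : Type u} [CommRing Λ] [IsDomain Λ] [IsLocalRing Λ]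
    [IsNoetherianRing Λ] [IsIntegrallyClosed Λ] [IsAdicComplete (maximalIdeal Λ) Λ]
    (hΛ : IsJapanese Λ) (f : Λ →+* A) (hf : (maximalIdeal Λ).map f ≤ maximalIdeal A)
    (hres : Function.Surjective ((residue A).comp f)) (t : Finset Λ)
    (ht : Ideal.span (t : Set Λ) = maximalIdeal Λ) :
    ∃ (P : Type u) (_ : CommRing P) (_ : IsDomain P) (_ : IsLocalRing P) (_ : IsNoetherianRing P)
      (_ : IsAdicComplete (maximalIdeal P) P) (_ : IsJapanese P) (g : P →+* A) (s : Finset P),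
      (maximalIdeal P).map g ≤ maximalIdeal A ∧ Function.Surjective ((residue A).comp g) ∧
      Ideal.span (s : Set P) = maximalIdeal P ∧ s.card ≤ t.card + l.length ∧
      (maximalIdeal Λ).map f ⊔ Ideal.span {x | x ∈ l} ≤ (maximalIdeal P).map g := by
  classical
  induction l generalizing Λ with
  | nil => exact ⟨Λ, _, ‹_›, ‹_›, ‹_›, ‹_›, hΛ, f, t, hf, hres, ht, by simp, by simp⟩
  | cons x l ih =>
    obtain ⟨g, hgC, hgX⟩ := PowerSeries.exists_ringHom_of_mem_maximalIdeal f (hl x (by simp))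
    have hgC' : g.comp (PowerSeries.C (R := Λ)) = f := RingHom.ext hgC
    have hmap : (maximalIdeal (PowerSeries Λ)).map g = (maximalIdeal Λ).map f ⊔ Ideal.span {x} := by
      rw [PowerSeries.maximalIdeal_eq_map_sup, Ideal.map_sup, Ideal.map_map, hgC', Ideal.map_span,
        Set.image_singleton, hgX]
    have := PowerSeries.isIntegrallyClosed Λ
    obtain ⟨P, i1, i2, i3, i4, i5, hP, h, s, h1, h2, h3, h4, h5⟩ :=
      ih (fun y hy ↦ hl y (by simp [hy])) (PowerSeries.isJapanese hΛ) g
        (by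
          rw [hmap]
          refine sup_le hf ?_
          rw [Ideal.span_le, Set.singleton_subset_iff]
          exact hl x (by simp))
        (fun y ↦ by
          obtain ⟨a, rfl⟩ := hres y
          exact ⟨PowerSeries.C a, by simp [hgC]⟩)
        (insert PowerSeries.X (t.image (PowerSeries.C (R := Λ))))
        (by
          rw [PowerSeries.maximalIdeal_eq_map_sup, Finset.coe_insert, Ideal.span_insert,
            Finset.coe_image, ← Ideal.map_span, ht, sup_comm])
    refine ⟨P, i1, i2, i3, i4, i5, hP, h, s, h1, h2, h3, h4.trans ?_, le_trans ?_ h5⟩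
    · rw [List.length_cons]
      have h6 := Finset.card_insert_le (PowerSeries.X (R := Λ))
        (t.image (PowerSeries.C (R := Λ)))
      have h7 := Finset.card_image_le (s := t) (f := PowerSeries.C (R := Λ))
      lia
    · rw [hmap, sup_assoc, ← Ideal.span_union]
      refine sup_le_sup_left (Ideal.span_mono fun y hy ↦ ?_) _
      simpa using hy

/-- A homomorphism from a complete local ring to a complete noetherian local ring that is
surjective on residue fields and has discrete closed fibre is finite. -/
theorem IsLocalRing.finite_of_pow_le_map [IsNoetherianRing A] {P : Type u} [CommRing P]
    [IsLocalRing P] [IsAdicComplete (maximalIdeal P) P] [Algebra P A]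
    (hle : (maximalIdeal P).map (algebraMap P A) ≤ maximalIdeal A)
    (hres : Function.Surjective ((residue A).comp (algebraMap P A))) (n : ℕ)
    (hn : maximalIdeal A ^ n ≤ (maximalIdeal P).map (algebraMap P A)) : Module.Finite P A := by
  have hsmul (k : ℕ) : (maximalIdeal P ^ k • ⊤ : Submodule P A) =
      (((maximalIdeal P).map (algebraMap P A)) ^ k).restrictScalars P := by
    rw [Ideal.smul_top_eq_map, Ideal.map_pow]
  have hhaus : IsHausdorff (maximalIdeal P) A := ⟨fun x hx ↦ by
    refine IsHausdorff.haus' (I := maximalIdeal A) x fun k ↦ ?_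
    have := hx k
    rw [SModEq.zero, hsmul] at this
    rw [SModEq.zero, smul_eq_mul, Ideal.mul_top]
    exact Ideal.pow_right_mono hle k this⟩
  -- Because residues come from `P`, coefficients in `A` may be replaced by coefficients in `P` up
  -- to the next power of the maximal ideal.
  have hstep (k : ℕ) : ∃ N : Submodule P A, N.FG ∧
      N ⊔ (maximalIdeal A ^ k).restrictScalars P = ⊤ := by
    induction k with
    | zero => exact ⟨⊥, Submodule.fg_bot, by rw [pow_zero, Ideal.one_eq_top]; simp⟩
    | succ k ih =>
      obtain ⟨N, hN, hNk⟩ := ih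
      obtain ⟨s, hs⟩ := (isNoetherianRing_iff_ideal_fg A).1 inferInstance (maximalIdeal A ^ k)
      refine ⟨N ⊔ Submodule.span P s, hN.sup ⟨s, rfl⟩, ?_⟩
      rw [eq_top_iff, ← hNk, sup_assoc]
      refine sup_le_sup_left (fun x hx ↦ ?_) _
      rw [Submodule.restrictScalars_mem, ← hs] at hx
      change x ∈ Submodule.span A (s : Set A) at hx
      induction hx using Submodule.span_induction with
      | mem x hx => exact Submodule.mem_sup_left (Submodule.subset_span hx)
      | zero => exact zero_mem _
      | add x y _ _ hx hy => exact add_mem hx hy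
      | smul a x hx' hx =>
        obtain ⟨c, hc⟩ := hres (residue A a)
        have hac : a - algebraMap P A c ∈ maximalIdeal A := by
          rw [← residue_eq_zero_iff, map_sub, ← hc]
          simp
        have hxk : x ∈ maximalIdeal A ^ k := hs ▸ hx'
        have : a • x = c • x + (a - algebraMap P A c) * x := by
          rw [smul_eq_mul, Algebra.smul_def]; ring
        rw [this]
        refine add_mem (Submodule.smul_mem _ _ hx) (Submodule.mem_sup_right ?_)
        rw [Submodule.restrictScalars_mem, pow_succ']
        exact Ideal.mul_mem_mul hac hxk
  obtain ⟨N, hN, hNn⟩ := hstep n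
  refine Module.Finite.of_isPrecomplete_of_isHausdorff (I := maximalIdeal P) N hN ?_
  rw [eq_top_iff]
  refine hNn.ge.trans (sup_le_sup_left ?_ _)
  rw [Ideal.smul_top_eq_map]
  exact hn

/-- If the maximal ideal of a noetherian local domain `P` has at most `dim A` generators and
generates an ideal primary to the maximal ideal of `A`, then `P → A` is injective. -/
theorem IsLocalRing.injective_of_pow_le_map [IsNoetherianRing A] {P : Type u} [CommRing P]
    [IsLocalRing P] [IsNoetherianRing P] [IsDomain P] (g : P →+* A)
    (hle : (maximalIdeal P).map g ≤ maximalIdeal A) (n : ℕ)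
    (hn : maximalIdeal A ^ n ≤ (maximalIdeal P).map g) (s : Finset P)
    (hs : Ideal.span (s : Set P) = maximalIdeal P) (hcard : (s.card : WithBot ℕ∞) ≤ ringKrullDim A) :
    Function.Injective g := by
  rw [injective_iff_map_eq_zero]
  intro r hr
  by_contra hr0
  -- Killing `r ≠ 0` lowers the dimension: `dim B < dim P ≤ dim A`. The factorization through `B`
  -- with discrete closed fibre gives `dim A ≤ dim B`, a contradiction.
  let B := P ⧸ Ideal.span {r}
  have hBdim := ringKrullDim_quotient_succ_le_of_nonZeroDivisor (mem_nonZeroDivisors_of_ne_zero hr0)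
  let gB : B →+* A := Ideal.Quotient.lift _ g (by
    intro a ha
    obtain ⟨b, rfl⟩ := Ideal.mem_span_singleton.1 ha
    rw [map_mul, hr, zero_mul])
  have hgB : gB.comp (Ideal.Quotient.mk _) = g := Ideal.Quotient.lift_comp_mk _ _ _
  have : Nontrivial B := gB.domain_nontrivial
  have : IsLocalRing B := IsLocalRing.of_surjective' _ Ideal.Quotient.mk_surjective
  have hmB : maximalIdeal B = (maximalIdeal P).map (Ideal.Quotient.mk _) := by
    have := Ideal.comap_isMaximal_of_surjective (Ideal.Quotient.mk (Ideal.span {r}))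
      Ideal.Quotient.mk_surjective (K := maximalIdeal B)
    rw [← eq_maximalIdeal this, Ideal.map_comap_of_surjective _ Ideal.Quotient.mk_surjective]
  let : Algebra B A := gB.toAlgebra
  have hmap : (maximalIdeal B).map (algebraMap B A) = (maximalIdeal P).map g := by
    rw [hmB, Ideal.map_map]
    congr 1
  have hlies : (maximalIdeal A).LiesOver (maximalIdeal B) := ⟨by
    refine le_antisymm ?_ (le_maximalIdeal (Ideal.comap_ne_top _ (maximalIdeal.isMaximal A).ne_top))
    rw [Ideal.under, ← Ideal.map_le_iff_le_comap, hmap]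
    exact hle⟩
  have h1 := Ideal.height_le_height_add_of_liesOver (maximalIdeal B) (maximalIdeal A)
  have h2 : ((maximalIdeal A).map (Ideal.Quotient.mk
      ((maximalIdeal B).map (algebraMap B A)))).height = 0 := by
    have hle' : (maximalIdeal B).map (algebraMap B A) ≤ maximalIdeal A := hmap.trans_le hle
    have := Ideal.isPrime_map_quotientMk_of_isPrime hle'
    rw [Ideal.height_eq_zero_iff]
    refine ⟨⟨this, bot_le⟩, fun q hq _ ↦ hq.1.le_of_pow_le (n := n) ?_⟩
    rw [← Ideal.map_pow]
    refine le_trans ?_ hq.2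
    rw [Ideal.map_le_iff_le_comap, ← RingHom.ker_eq_comap_bot, Ideal.mk_ker, hmap]
    exact hn
  rw [h2, add_zero] at h1
  have h3 : ringKrullDim A ≤ ringKrullDim B := by
    rw [← maximalIdeal_height_eq_ringKrullDim, ← maximalIdeal_height_eq_ringKrullDim]
    exact_mod_cast h1
  have h4 : ringKrullDim P ≤ s.card := by
    refine (ringKrullDim_le_spanFinrank_maximalIdeal P).trans ?_
    rw [← hs]
    have := Submodule.spanFinrank_span_le_ncard_of_finite (R := P) s.finite_toSet
    rw [Set.ncard_coe_finset] at this
    exact_mod_cast this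
  have h5 : ringKrullDim B + 1 ≤ ringKrullDim B := (hBdim.trans h4).trans (hcard.trans h3)
  obtain ⟨d, hd⟩ := WithBot.ne_bot_iff_exists.1 (ringKrullDim_ne_bot (R := B))
  have hd' : d ≠ ⊤ := by
    rintro rfl
    exact ringKrullDim_ne_top (R := B) hd.symm
  obtain ⟨d, rfl⟩ := ENat.ne_top_iff_exists.1 hd'
  rw [← hd] at h5
  exact absurd h5 (not_le.2 (by exact_mod_cast d.lt_succ_self))

/-- A system of parameters relative to a principal ideal. -/
theorem IsLocalRing.exists_list_pow_le_sup [IsNoetherianRing A] (a : A) (ha : a ∈ maximalIdeal A)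
    (d : ℕ) (hd : ringKrullDim (A ⧸ Ideal.span {a}) + d ≤ ringKrullDim A) :
    ∃ l : List A, (∀ x ∈ l, x ∈ maximalIdeal A) ∧ ((d + l.length : ℕ) : WithBot ℕ∞) ≤ ringKrullDim A ∧
      ∃ n, maximalIdeal A ^ n ≤ Ideal.span {a} ⊔ Ideal.span {x | x ∈ l} := by
  classical
  let B := A ⧸ Ideal.span {a}
  have : Nontrivial B := Ideal.Quotient.nontrivial_iff.2 fun h ↦
    (maximalIdeal.isMaximal A).ne_top (top_le_iff.1 (h ▸ (Ideal.span_singleton_le_iff_mem _).2 ha))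
  have : IsLocalRing B := IsLocalRing.of_surjective' _ Ideal.Quotient.mk_surjective
  have hmB : (maximalIdeal B).comap (Ideal.Quotient.mk _) = maximalIdeal A := by
    have := Ideal.comap_isMaximal_of_surjective (Ideal.Quotient.mk (Ideal.span {a}))
      Ideal.Quotient.mk_surjective (K := maximalIdeal B)
    exact eq_maximalIdeal this
  -- The list consists of lifts of `dim B` elements over whose span the maximal ideal of `B` is
  -- minimal.
  obtain ⟨s, hs, hcard⟩ := (maximalIdeal B).exists_finset_card_eq_height_of_isNoetherianRing
  have hle : maximalIdeal B ≤ (Ideal.span (s : Set B)).radical := by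
    rw [Ideal.radical_eq_sInf]
    refine le_sInf fun J hJ ↦ hs.2 ⟨hJ.2, hJ.1⟩ (le_maximalIdeal hJ.2.ne_top)
  obtain ⟨n, hn⟩ := Ideal.exists_pow_le_of_le_radical_of_fg hle
    (IsNoetherian.noetherian _)
  choose σ hσ using Ideal.Quotient.mk_surjective (I := Ideal.span {a})
  refine ⟨s.toList.map σ, ?_, ?_, n, ?_⟩
  · intro x hx
    obtain ⟨y, hy, rfl⟩ := List.mem_map.1 hx
    rw [← hmB, Ideal.mem_comap, hσ]
    exact hs.1.2 (Ideal.subset_span (by simpa using hy))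
  · rw [List.length_map, Finset.length_toList]
    refine le_trans (le_of_eq ?_) hd
    rw [← maximalIdeal_height_eq_ringKrullDim, ← hcard]
    push_cast
    rw [add_comm]
  · intro x hx
    have h1 : Ideal.Quotient.mk (Ideal.span {a}) x ∈ Ideal.span (s : Set B) := by
      refine hn ?_
      have := Ideal.mem_map_of_mem (Ideal.Quotient.mk (Ideal.span {a})) hx
      rw [Ideal.map_pow] at this
      refine Ideal.pow_right_mono ?_ n this
      rw [Ideal.map_le_iff_le_comap, hmB]
    have h2 : Ideal.span (s : Set B) =
        (Ideal.span {x | x ∈ s.toList.map σ}).map (Ideal.Quotient.mk (Ideal.span {a})) := by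
      rw [Ideal.map_span]
      congr 1
      ext y
      simp only [Set.mem_image, Set.mem_ofPred_eq, List.mem_map, Finset.mem_toList]
      constructor
      · intro hy
        exact ⟨σ y, ⟨y, hy, rfl⟩, hσ y⟩
      · rintro ⟨_, ⟨z, hz, rfl⟩, rfl⟩
        rwa [hσ]
    rw [h2, ← Ideal.mem_comap, Ideal.comap_map_of_surjective _ Ideal.Quotient.mk_surjective,
      ← RingHom.ker_eq_comap_bot, Ideal.mk_ker, sup_comm] at h1
    exact h1

/-- A complete local noetherian domain is japanese as soon as it receives a suitable homomorphism
from a complete local normal japanese domain with principal maximal ideal. -/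
theorem IsJapanese.of_coefficientRing [IsDomain A] [IsNoetherianRing A]
    [IsAdicComplete (maximalIdeal A) A] {Λ : Type u} [CommRing Λ] [IsDomain Λ]
    [IsLocalRing Λ] [IsNoetherianRing Λ] [IsIntegrallyClosed Λ]
    [IsAdicComplete (maximalIdeal Λ) Λ] (hΛ : IsJapanese Λ) (f : Λ →+* A)
    (hres : Function.Surjective ((residue A).comp f)) (t : Finset Λ)
    (ht : Ideal.span (t : Set Λ) = maximalIdeal Λ) (a : A) (ha : a ∈ maximalIdeal A)
    (hfa : (maximalIdeal Λ).map f = Ideal.span {a})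
    (hd : ringKrullDim (A ⧸ Ideal.span {a}) + t.card ≤ ringKrullDim A) : IsJapanese A := by
  -- The parameters of `A / (a)` become the values of the adjoined variables. With the generators of
  -- the maximal ideal of `Λ` they number at most `dim A`, so `P → A` is injective as well as
  -- finite.
  obtain ⟨l, hl, hcard, n, hn⟩ := exists_list_pow_le_sup a ha t.card hd
  obtain ⟨P, _, _, _, _, _, hP, g, s, h1, h2, h3, h4, h5⟩ := exists_isJapanese_extension l hl hΛ f
    (hfa.trans_le ((Ideal.span_singleton_le_iff_mem _).2 ha)) hres t ht
  have hn' : maximalIdeal A ^ n ≤ (maximalIdeal P).map g := hn.trans (hfa ▸ h5)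
  have hinj : Function.Injective g := injective_of_pow_le_map g h1 n hn' s h3
    (le_trans (by exact_mod_cast h4) hcard)
  let : Algebra P A := g.toAlgebra
  have : Module.Finite P A := finite_of_pow_le_map h1 h2 n hn'
  have : FaithfulSMul P A := (faithfulSMul_iff_algebraMap_injective P A).2 hinj
  exact hP.of_finite

/-- A complete local ring containing a field over which the residue field is formally smooth
has a coefficient field. -/
theorem IsLocalRing.exists_residue_comp_eq_id [IsAdicComplete (maximalIdeal A) A] (F : Type*)
    [Field F] [Algebra F A] [Algebra.FormallySmooth F (ResidueField A)] :
    ∃ f : ResidueField A →+* A, (residue A).comp f = RingHom.id _ := by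
  let e : ResidueField A →ₐ[F] A ⧸ maximalIdeal A := AlgHom.id F (ResidueField A)
  obtain ⟨g, hg⟩ := Algebra.FormallySmooth.exists_mkₐ_comp_eq_of_isAdicComplete e
  exact ⟨g.toRingHom, RingHom.ext fun x ↦ AlgHom.congr_fun hg x⟩

theorem IsLocalRing.exists_residue_comp_eq_id_of_charZero [IsAdicComplete (maximalIdeal A) A]
    (F : Type*) [Field F] [CharZero F] [Algebra F A] :
    ∃ f : ResidueField A →+* A, (residue A).comp f = RingHom.id _ :=
  have := Algebra.FormallySmooth.of_charZero F (ResidueField A)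
  exists_residue_comp_eq_id F

theorem IsJapanese.of_residue_comp_eq_id [IsDomain A] [IsNoetherianRing A]
    [IsAdicComplete (maximalIdeal A) A] (f : ResidueField A →+* A)
    (hf : (residue A).comp f = RingHom.id _) : IsJapanese A := by
  refine IsJapanese.of_coefficientRing (isJapanese_of_field _) f
    (hf ▸ Function.surjective_id) ∅ ?_ 0 (zero_mem _) ?_ ?_
  · simp [maximalIdeal_eq_bot]
  · simp [maximalIdeal_eq_bot]
  · rw [Finset.card_empty, Nat.cast_zero, add_zero]
    exact ringKrullDim_quotient_le _

/-- A complete local noetherian domain is japanese. -/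
theorem isJapanese_of_isAdicComplete (A : Type u) [CommRing A] [IsLocalRing A] [IsDomain A]
    [IsNoetherianRing A] [IsAdicComplete (maximalIdeal A) A] : IsJapanese A := by
  obtain ⟨p, hp⟩ := CharP.exists (ResidueField A)
  rcases CharP.char_is_prime_or_zero (ResidueField A) p with hpp | rfl
  · have : Fact p.Prime := ⟨hpp⟩
    have hpm : (p : A) ∈ maximalIdeal A := by
      rw [← residue_eq_zero_iff, map_natCast, CharP.cast_eq_zero]
    -- If `p = 0`, the prime field lies in `A` and a coefficient field exists. Otherwise a Cohen
    -- ring takes its place, and `p` is a nonzerodivisor that cuts down the dimension.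
    by_cases hp0 : (p : A) = 0
    · have : CharP A p := (CharP.charP_iff_prime_eq_zero hpp).2 hp0
      let := ZMod.algebra A p
      have := Algebra.FormallySmooth.zmod_field p (ResidueField A)
      obtain ⟨f, hf⟩ := exists_residue_comp_eq_id (A := A) (ZMod p)
      exact IsJapanese.of_residue_comp_eq_id f hf
    · obtain ⟨V, _, _, _, _, _, κ, hκ, hker, hmax⟩ :=
        exists_isDiscreteValuationRing_ker_eq_span p (ResidueField A)
      obtain ⟨f, hf⟩ := exists_residue_comp_eq_of_flat_int p κ hκ hker hpm κ
      refine IsJapanese.of_coefficientRing (IsJapanese.of_charZero (A := V)) f (hf ▸ hκ)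
        {(p : V)} ?_ p hpm ?_ ?_
      · rw [hmax, Finset.coe_singleton]
      · rw [hmax, Ideal.map_span, Set.image_singleton, map_natCast]
      · rw [Finset.card_singleton, Nat.cast_one]
        exact ringKrullDim_quotient_succ_le_of_nonZeroDivisor (mem_nonZeroDivisors_of_ne_zero hp0)
  · have : CharZero (ResidueField A) := CharP.charP_to_charZero _
    -- In residue characteristic zero, nonzero integers are units in `A`.
    let i : ℚ →+* A := IsLocalization.lift (M := nonZeroDivisors ℤ) (g := Int.castRingHom A)
      fun y ↦ by
        by_contra h
        have h1 : residue A ((y : ℤ) : A) = 0 := (residue_eq_zero_iff _).2 h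
        rw [map_intCast, Int.cast_eq_zero] at h1
        exact nonZeroDivisors.ne_zero y.2 h1
    let := i.toAlgebra
    obtain ⟨f, hf⟩ := exists_residue_comp_eq_id_of_charZero (A := A) ℚ
    exact IsJapanese.of_residue_comp_eq_id f hf

end Structure

/-! ### Completeness of quotients and of power series in several variables. -/

section CompleteQuotient

/-- A surjective image of a precomplete ring is precomplete. -/
theorem IsPrecomplete.of_ringHom_surjective {R S : Type*} [CommRing R] [CommRing S] (I : Ideal R)
    [IsPrecomplete I R] (f : R →+* S) (hf : Function.Surjective f) :
    IsPrecomplete (I.map f) S := by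
  refine ⟨fun s hs ↦ ?_⟩
  -- Lifting successive differences, rather than the terms, keeps the lifted sequence Cauchy.
  have hd (n : ℕ) : ∃ d ∈ I ^ n, f d = s (n + 1) - s n := by
    have h1 := (hs n.le_succ).symm
    rw [SModEq.sub_mem, smul_eq_mul, Ideal.mul_top, ← Ideal.map_pow] at h1
    obtain ⟨d, hd, h⟩ := (Ideal.mem_map_iff_of_surjective f hf).1 h1
    exact ⟨d, hd, h⟩
  choose d hd hfd using hd
  obtain ⟨x₀, hx₀⟩ := hf (s 0)
  let x : ℕ → R := fun n ↦ x₀ + ∑ i ∈ Finset.range n, d i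
  have hx (n : ℕ) : f (x n) = s n := by
    simp only [x, map_add, map_sum, hfd, hx₀]
    rw [Finset.sum_range_sub]
    ring
  obtain ⟨L, hL⟩ := IsPrecomplete.prec ‹IsPrecomplete I R› (f := x) (fun {m n} hmn ↦ by
    rw [SModEq.sub_mem, smul_eq_mul, Ideal.mul_top]
    have : x m - x n = - ∑ i ∈ Finset.Ico m n, d i := by
      simp only [x]
      rw [Finset.sum_Ico_eq_sub _ hmn]
      ring
    rw [this]
    exact neg_mem (sum_mem fun i hi ↦ Ideal.pow_le_pow_right (Finset.mem_Ico.1 hi).1 (hd i)))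
  refine ⟨f L, fun n ↦ ?_⟩
  have := hL n
  rw [SModEq.sub_mem, smul_eq_mul, Ideal.mul_top] at this
  rw [SModEq.sub_mem, smul_eq_mul, Ideal.mul_top, ← Ideal.map_pow, ← hx, ← map_sub]
  exact Ideal.mem_map_of_mem f this

/-- A surjective image of a complete local ring in a noetherian local ring is complete. -/
theorem IsLocalRing.isAdicComplete_of_surjective {R S : Type*} [CommRing R] [CommRing S]
    [IsLocalRing R] [IsLocalRing S] [IsNoetherianRing S] [IsAdicComplete (maximalIdeal R) R]
    (f : R →+* S) (hf : Function.Surjective f) : IsAdicComplete (maximalIdeal S) S := by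
  have h1 : (maximalIdeal R).map f = maximalIdeal S := by
    have := Ideal.comap_isMaximal_of_surjective f hf (K := maximalIdeal S)
    rw [← eq_maximalIdeal this, Ideal.map_comap_of_surjective _ hf]
  have h2 := IsPrecomplete.of_ringHom_surjective (maximalIdeal R) f hf
  rw [h1] at h2
  exact ⟨⟩

theorem IsLocalRing.isAdicComplete_of_ringEquiv {B C : Type*} [CommRing B] [CommRing C]
    [IsLocalRing B] [IsLocalRing C] (e : B ≃+* C) (h : IsAdicComplete (maximalIdeal B) B) :
    IsAdicComplete (maximalIdeal C) C := by
  have h1 : (maximalIdeal B).map e = maximalIdeal C := by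
    have := Ideal.comap_isMaximal_of_surjective e e.surjective (K := maximalIdeal C)
    rw [← eq_maximalIdeal this, Ideal.map_comap_of_surjective _ e.surjective]
  rw [← h1]
  exact (IsAdicComplete.congr_ringEquiv _ e).2 h

theorem MvPowerSeries.isAdicComplete_maximalIdeal_fin {A : Type*} [CommRing A] [IsLocalRing A]
    [h : IsAdicComplete (maximalIdeal A) A] (n : ℕ) :
    IsAdicComplete (maximalIdeal (MvPowerSeries (Fin n) A)) (MvPowerSeries (Fin n) A) := by
  induction n with
  | zero =>
    exact isAdicComplete_of_ringEquiv
      (MvPowerSeries.isEmptyEquiv (σ := Fin 0) (R := A)).symm.toRingEquiv h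
  | succ n ih =>
    exact isAdicComplete_of_ringEquiv (MvPowerSeries.finSuccEquiv A n).symm.toRingEquiv
      PowerSeries.isAdicComplete_maximalIdeal

end CompleteQuotient

/-! ### A complete form of the Rees algebra. -/

section ReesAlgebra

open PowerSeries

/-- The subring of power series whose `n`-th coefficient lies in the `n`-th power of an ideal. -/
def PowerSeries.reesSubalgebra {A : Type*} [CommRing A] (J : Ideal A) : Subalgebra A A⟦X⟧ where
  carrier := {f | ∀ n, coeff n f ∈ J ^ n}
  mul_mem' {f g} hf hg n := by
    rw [coeff_mul]
    refine sum_mem fun ij hij ↦ ?_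
    rw [← show ij.1 + ij.2 = n by simpa using hij, pow_add]
    exact Ideal.mul_mem_mul (hf _) (hg _)
  add_mem' {f g} hf hg n := by
    rw [map_add]
    exact add_mem (hf n) (hg n)
  algebraMap_mem' a n := by
    rcases n with _ | n
    · simp
    · rw [algebraMap_apply, coeff_C]
      simp

/-- The Rees algebra of an ideal in a complete noetherian local ring is contained in a complete
noetherian local ring of power series. -/
theorem PowerSeries.exists_complete_reesAlgebra {A : Type u} [CommRing A] [IsLocalRing A]
    [IsNoetherianRing A] [IsAdicComplete (maximalIdeal A) A] (J : Ideal A) :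
    ∃ D : Subalgebra A A⟦X⟧, D ≤ reesSubalgebra J ∧ (∀ j ∈ J, C j * X ∈ D) ∧
      IsNoetherianRing D ∧ ∃ _ : IsLocalRing D, IsAdicComplete (maximalIdeal D) D := by
  obtain ⟨r, a, ha⟩ := Submodule.fg_iff_exists_fin_generating_family.1 (IsNoetherian.noetherian J)
  let v : Fin r → MvPowerSeries Unit A := fun i ↦ (C (a i) * X : A⟦X⟧)
  have haJ (i : Fin r) : a i ∈ J := ha ▸ Submodule.subset_span ⟨i, rfl⟩
  have hvJ (i : Fin r) : v i ∈ reesSubalgebra J := by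
    intro n
    change coeff n (C (a i) * X) ∈ _
    rw [coeff_C_mul, coeff_X]
    split_ifs with h
    · subst h
      simpa using haJ i
    · simp
  have hv : MvPowerSeries.HasSubst v := MvPowerSeries.hasSubst_of_constantCoeff_zero fun i ↦ by
    change constantCoeff (C (a i) * X) = 0
    simp
  -- `D` is the image of the substitution that sends the variables to `aᵢX`, for generators `aᵢ` of
  -- `J`. As a quotient of a power series ring over `A` it inherits locality, noetherianity and
  -- completeness.
  let φ : MvPowerSeries (Fin r) A →ₐ[A] A⟦X⟧ := MvPowerSeries.substAlgHom hv
  have hφX (i : Fin r) : φ (MvPowerSeries.X i) = C (a i) * X := MvPowerSeries.substAlgHom_X hv i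
  have hsurj : Function.Surjective φ.rangeRestrict := φ.rangeRestrict_surjective
  have hcomp := MvPowerSeries.isAdicComplete_maximalIdeal_fin (A := A) r
  have hnoeth : IsNoetherianRing φ.range :=
    isNoetherianRing_of_surjective _ _ φ.rangeRestrict.toRingHom hsurj
  have hloc : IsLocalRing φ.range := IsLocalRing.of_surjective' φ.rangeRestrict.toRingHom hsurj
  refine ⟨φ.range, ?_, ?_, hnoeth, hloc,
    isAdicComplete_of_surjective φ.rangeRestrict.toRingHom hsurj⟩
  · rintro _ ⟨f, rfl⟩ n
    have h1 : coeff n (φ f) = ∑ᶠ d, MvPowerSeries.coeff d f •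
        (coeff n (d.prod fun s e ↦ v s ^ e : A⟦X⟧)) := by
      exact (congrArg (coeff n) (congrFun (MvPowerSeries.coe_substAlgHom hv) f)).trans
        (MvPowerSeries.coeff_subst hv f _)
    change coeff n (φ f) ∈ J ^ n
    rw [h1]
    refine finsum_induction (· ∈ J ^ n) (zero_mem _) (fun _ _ ↦ add_mem) fun d ↦ ?_
    refine Ideal.mul_mem_left _ _ ?_
    exact (prod_mem fun s _ ↦ pow_mem (hvJ s) _ :
      (d.prod fun s e ↦ v s ^ e : A⟦X⟧) ∈ reesSubalgebra J) n
  · intro j hj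
    rw [← ha] at hj
    induction hj using Submodule.span_induction with
    | mem x hx =>
      obtain ⟨i, rfl⟩ := hx
      exact ⟨_, hφX i⟩
    | zero => simp
    | add x y _ _ hx hy =>
      rw [map_add, add_mul]
      exact add_mem hx hy
    | smul b x _ hx =>
      rw [smul_eq_mul, map_mul, mul_assoc]
      exact mul_mem (φ.range.algebraMap_mem b) hx

end ReesAlgebra

/-! ### Clearing denominators with high powers. -/

section Growth

open Polynomial

/-- A polynomial expression of degree `d` in `t` needs `d` factors of `r`; further factors do no
harm, since `r` is in `S`. -/
theorem Algebra.exists_forall_mul_pow_mem_of_mem_adjoin {A K U : Type*} [CommRing A] [CommRing K]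
    [Algebra A K] [CommRing U] (φ : K →+* U) (S : Subring U) {r : U} (hr : r ∈ S)
    (hA : ∀ a, φ (algebraMap A K a) ∈ S) {t : Set K} (ht : ∀ y ∈ t, φ y * r ∈ S) {c : K}
    (hc : c ∈ Algebra.adjoin A t) : ∃ n₀, ∀ n ≥ n₀, φ c * r ^ n ∈ S := by
  induction hc using Algebra.adjoin_induction with
  | mem x hx =>
    refine ⟨1, fun n hn ↦ ?_⟩
    obtain ⟨m, rfl⟩ := Nat.exists_eq_add_of_le hn
    rw [pow_add, pow_one, ← mul_assoc]
    exact mul_mem (ht x hx) (pow_mem hr m)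
  | algebraMap a => exact ⟨0, fun n _ ↦ mul_mem (hA a) (pow_mem hr n)⟩
  | add x y _ _ hx hy =>
    obtain ⟨m, hm⟩ := hx
    obtain ⟨n, hn⟩ := hy
    refine ⟨max m n, fun k hk ↦ ?_⟩
    rw [map_add, add_mul]
    exact add_mem (hm k (le_of_max_le_left hk)) (hn k (le_of_max_le_right hk))
  | mul x y _ _ hx hy =>
    obtain ⟨m, hm⟩ := hx
    obtain ⟨n, hn⟩ := hy
    refine ⟨m + n, fun k hk ↦ ?_⟩
    obtain ⟨l, rfl⟩ := Nat.exists_eq_add_of_le hk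
    rw [map_mul, show φ x * φ y * r ^ (m + n + l) = φ x * r ^ m * (φ y * r ^ (n + l)) by ring]
    exact mul_mem (hm m le_rfl) (hn _ (by lia))

/-- If the elements of `T` are brought into `S` by high powers of `r`, then elements integral over
`T` become integral over `S` after multiplication by high powers of `r`. -/
theorem IsIntegral.exists_forall_isIntegralElem_mul_pow {T W S U : Type*} [CommRing T] [CommRing W]
    [Algebra T W] [CommRing S] [CommRing U] (φ : W →+* U) (g : S →+* U) (r : U)
    (h : ∀ c : T, ∃ n₀, ∀ n ≥ n₀, φ (algebraMap T W c) * r ^ n ∈ g.range) {w : W}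
    (hw : IsIntegral T w) : ∃ n₀, ∀ n ≥ n₀, g.IsIntegralElem (φ w * r ^ n) := by
  rcases subsingleton_or_nontrivial U with hU | hU
  · exact ⟨0, fun n _ ↦ ⟨1, monic_one, Subsingleton.elim _ _⟩⟩
  obtain ⟨p, hp, hpw⟩ := hw
  choose n₀ hn₀ using h
  refine ⟨∑ i ∈ Finset.range p.natDegree, n₀ (p.coeff i), fun n hn ↦ ?_⟩
  -- Scaling the roots by `r ^ n` multiplies every coefficient below the leading one by at least `r
  -- ^ n`, which moves it into the image of `g`.
  let P : U[X] := (p.map (φ.comp (algebraMap T W))).scaleRoots (r ^ n)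
  have hPm : P.Monic := monic_scaleRoots_iff _ |>.2 (hp.map _)
  have hPl : P ∈ lifts g := by
    rw [lifts_iff_coeff_lifts]
    intro i
    rw [coeff_scaleRoots, hp.natDegree_map, coeff_map]
    rcases lt_trichotomy i p.natDegree with hi | rfl | hi
    · obtain ⟨k, hk⟩ := Nat.exists_eq_add_of_lt hi
      rw [← pow_mul]
      refine hn₀ (p.coeff i) _ ?_
      refine le_trans ?_ (Nat.le_mul_of_pos_right n (by lia))
      exact (Finset.single_le_sum (f := fun i ↦ n₀ (p.coeff i)) (fun _ _ ↦ Nat.zero_le _)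
        (Finset.mem_range.2 hi)).trans hn
    · rw [hp.coeff_natDegree]
      exact ⟨1, by simp⟩
    · rw [coeff_eq_zero_of_natDegree_lt hi]
      exact ⟨0, by simp⟩
  obtain ⟨q, hq, -, hqm⟩ := lifts_and_natDegree_eq_and_monic hPl hPm
  refine ⟨q, hqm, ?_⟩
  rw [← eval_map, hq, mul_comm]
  have h1 := scaleRoots_eval₂_mul (p := p.map (φ.comp (algebraMap T W))) (RingHom.id U) (φ w) (r ^ n)
  rw [RingHom.id_apply] at h1
  change eval₂ (RingHom.id U) (r ^ n * φ w) P = 0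
  rw [h1, eval₂_map, RingHom.id_comp, ← hom_eval₂, hpw, map_zero, mul_zero]

end Growth

/-! ### Conductors over japanese domains. -/

section Conductor

open nonZeroDivisors

/-- A nonzero conductor for the elements integral over a japanese domain. -/
theorem IsJapanese.exists_mul_mem_of_isIntegral {D E : Type u} [CommRing D] [IsDomain D]
    [IsNoetherianRing D] (hD : IsJapanese D) [CommRing E] [IsDomain E] [Algebra D E]
    [FaithfulSMul D E] (D' : Subalgebra D E) [Module.Finite D D'] :
    ∃ d ∈ D', d ≠ 0 ∧ ∀ (y : E) (r : D), IsIntegral D y → r ≠ 0 → r • y ∈ D' → d * y ∈ D' := by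
  have hD' : IsJapanese D' := hD.of_finite
  obtain ⟨Q, _, _, _⟩ : ∃ (Q : Type u) (_ : Field Q) (_ : Algebra D' Q), IsFractionRing D' Q :=
    ⟨FractionRing D', inferInstance, inferInstance, inferInstance⟩
  -- The trivial extension suffices: the conductor is a common denominator of generators of the
  -- normalization of `D'`.
  have hfin := hD' Q Q
  obtain ⟨s, hs⟩ := hfin.fg_top
  obtain ⟨b, hb⟩ := IsLocalization.exist_integer_multiples_of_finset D'⁰
    (s.map ⟨Subtype.val, Subtype.val_injective⟩ : Finset Q)
  have hb' (q : Q) (hq : IsIntegral D' q) : ∃ z : D', algebraMap D' Q z = algebraMap D' Q b * q := by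
    have h1 : (⟨q, hq⟩ : integralClosure D' Q) ∈ Submodule.span D' (s : Set (integralClosure D' Q)) :=
      hs ▸ Submodule.mem_top
    suffices h : ∀ x ∈ Submodule.span D' (s : Set (integralClosure D' Q)),
        ∃ z : D', algebraMap D' Q z = algebraMap D' Q b * (x : Q) from h _ h1
    intro x hx
    induction hx using Submodule.span_induction with
    | mem x hx =>
      obtain ⟨z, hz⟩ := hb x (by simpa using hx)
      exact ⟨z, by rw [hz]; exact Algebra.smul_def _ _⟩
    | zero => exact ⟨0, by simp⟩
    | add x y _ _ hx hy =>
      obtain ⟨z, hz⟩ := hx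
      obtain ⟨z', hz'⟩ := hy
      exact ⟨z + z', by rw [map_add, hz, hz']; push_cast; ring⟩
    | smul c x _ hx =>
      obtain ⟨z, hz⟩ := hx
      refine ⟨c * z, ?_⟩
      rw [map_mul, hz, Algebra.smul_def]
      change _ = _ * (algebraMap D' Q c * (x : Q))
      ring
  have hDE : Function.Injective (algebraMap D E) := FaithfulSMul.algebraMap_injective D E
  refine ⟨b, b.1.2, fun h ↦ nonZeroDivisors.ne_zero b.2 (Subtype.ext h), fun y r hy hr hry ↦ ?_⟩
  obtain ⟨L, _, _, _⟩ : ∃ (L : Type u) (_ : Field L) (_ : Algebra E L), IsFractionRing E L :=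
    ⟨FractionRing E, inferInstance, inferInstance, inferInstance⟩
  have hEL := IsFractionRing.injective E L
  have hDQ : algebraMap D' Q (algebraMap D D' r) ≠ 0 := by
    rw [Ne, map_eq_zero_iff _ (IsFractionRing.injective D' Q)]
    intro h
    exact hr (hDE (by rw [map_zero]; exact congrArg Subtype.val h))
  let ψ : D' →+* L := (algebraMap E L).comp D'.val.toRingHom
  have hψ : Function.Injective ψ := hEL.comp Subtype.val_injective
  let : Algebra D' L := ψ.toAlgebra
  let i : Q →ₐ[D'] L :=
    { IsFractionRing.lift hψ with commutes' := fun x ↦ IsFractionRing.lift_algebraMap hψ x }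
  -- The hypothesis on `r` says that `y` is a fraction over `D'`, namely `(r • y) / r`.
  let q : Q := algebraMap D' Q ⟨r • y, hry⟩ / algebraMap D' Q (algebraMap D D' r)
  have hiq : i q = algebraMap E L y := by
    rw [map_div₀, i.commutes, i.commutes, div_eq_iff (by
      rw [← i.commutes]; exact (map_ne_zero i).2 hDQ)]
    change algebraMap E L (r • y) = algebraMap E L y * algebraMap E L (algebraMap D E r)
    rw [← map_mul, Algebra.smul_def, mul_comm]
  have hq : IsIntegral D' q := by
    rw [← isIntegral_algHom_iff i i.injective, hiq]
    have h1 : IsIntegral D' y := hy.tower_top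
    obtain ⟨p, hp, hpy⟩ := h1
    refine ⟨p, hp, ?_⟩
    have := congrArg (algebraMap E L) hpy
    rw [Polynomial.hom_eval₂, map_zero] at this
    exact this
  obtain ⟨z, hz⟩ := hb' q hq
  have h2 : algebraMap D' Q (z * algebraMap D D' r) = algebraMap D' Q (b * ⟨r • y, hry⟩) := by
    rw [map_mul, map_mul, hz, mul_assoc, div_mul_cancel₀ _ hDQ]
  have h3 : (z : E) * algebraMap D E r = b * (r • y) :=
    congrArg Subtype.val (IsFractionRing.injective D' Q h2)
  have h4 : (b : E) * y = z := by
    refine mul_right_cancel₀ (b := algebraMap D E r) ?_ ?_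
    · rwa [Ne, map_eq_zero_iff _ hDE]
    · rw [h3, Algebra.smul_def]
      ring
  rw [h4]
  exact z.2

end Conductor

/-! ### Integral closures of finitely generated algebras over complete domains. -/

section FiniteIntegralClosure

open PowerSeries

theorem Algebra.div_pow_mem_of_mem_pow {A K : Type*} [CommRing A] [Field K] [Algebra A K]
    (T : Subalgebra A K) {a : K} (J : Ideal A) (hJ : ∀ j ∈ J, algebraMap A K j / a ∈ T) (m : ℕ)
    {j : A} (hj : j ∈ J ^ m) : algebraMap A K j / a ^ m ∈ T := by
  induction m generalizing j with
  | zero => simp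
  | succ m ih =>
    rw [pow_succ] at hj
    induction hj using Submodule.mul_induction_on' with
    | mem_mul_mem x hx y hy =>
      rw [map_mul, pow_succ, mul_div_mul_comm]
      exact mul_mem (ih hx) (hJ y hy)
    | add x _ y _ hx hy =>
      rw [map_add, add_div]
      exact add_mem hx hy

/-- Finiteness of integral closures over `T = A[y₁, …, yₙ] ⊆ Frac A`, given a japanese domain `D`
of power series containing the Rees algebra of a suitable ideal `J` of `A`. -/
theorem Module.Finite.integralClosure_of_reesAlgebra {A K K' A' D : Type u} [CommRing A]
    [IsDomain A] [IsNoetherianRing A] [Field K] [Algebra A K] [IsFractionRing A K] [Field K']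
    [Algebra K K'] [Algebra A K'] [IsScalarTower A K K'] [CommRing A'] [IsDomain A'] [Algebra A A']
    [Algebra A' K'] [IsScalarTower A A' K'] [IsIntegralClosure A' A K'] [Module.Finite A A']
    [CommRing D] [IsDomain D] [IsNoetherianRing D] (hD : IsJapanese D) (ι : D →+* A⟦X⟧)
    (hι : Function.Injective ι) (J : Ideal A) (hιJ : ∀ d n, coeff n (ι d) ∈ J ^ n)
    (hιX : ∀ j ∈ J, C j * X ∈ ι.range) (hιC : ∀ b, C b ∈ ι.range) (t : Set K) (ht : t.Finite)
    (a : A) (ha : a ≠ 0) (haJ : a ∈ J)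
    (hJT : ∀ j ∈ J, algebraMap A K j / algebraMap A K a ∈ Algebra.adjoin A t)
    (htJ : ∀ y ∈ t, ∃ b ∈ J, algebraMap A K b = y * algebraMap A K a) :
    Module.Finite (Algebra.adjoin A t) (integralClosure (Algebra.adjoin A t) K') := by
  classical
  set T := Algebra.adjoin A t with hT
  have hTnoeth : IsNoetherianRing T := by
    have : Algebra.FiniteType A T := (Subalgebra.fg_iff_finiteType _).1
      ⟨ht.toFinset, by rw [ht.coe_toFinset]⟩
    exact Algebra.FiniteType.isNoetherianRing A T
  have hA'K' : Function.Injective (algebraMap A' K') := IsIntegralClosure.algebraMap_injective A' A K'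
  have hAK : Function.Injective (algebraMap A K) := IsFractionRing.injective A K
  have hAK' : Function.Injective (algebraMap A K') := by
    rw [IsScalarTower.algebraMap_eq A K K']
    exact (algebraMap K K').injective.comp hAK
  have hAA' : Function.Injective (algebraMap A A') := by
    have := hAK'
    rw [IsScalarTower.algebraMap_eq A A' K'] at this
    rw [RingHom.coe_comp] at this
    exact this.of_comp
  obtain ⟨G, hG⟩ := Module.Finite.fg_top (R := A) (M := A')
  -- the ring of power series over the integral closure
  let E := A'⟦X⟧
  let γ : D →+* E := (PowerSeries.map (algebraMap A A')).comp ι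
  have hγ : Function.Injective γ := (PowerSeries.map_injective _ hAA').comp hι
  let : Algebra D E := γ.toAlgebra
  have : FaithfulSMul D E := (faithfulSMul_iff_algebraMap_injective D E).2 hγ
  have hγC (b : A) : (C (algebraMap A A' b) : E) ∈ γ.range := by
    obtain ⟨d, hd⟩ := hιC b
    exact ⟨d, by simp [γ, hd]⟩
  -- `D'` is generated over `D` by the constants of `A'`. It is finite over `D`, and its `n`-th
  -- coefficients still lie in `J ^ n A'`.
  let D' : Subalgebra D E := Algebra.adjoin D ((C (R := A')) '' G)
  have hCint (v : A') : IsIntegral D (C v : E) := by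
    obtain ⟨n₀, h₀⟩ := (Algebra.IsIntegral.isIntegral (R := A)
      v).exists_forall_isIntegralElem_mul_pow (C (R := A')) γ 1 fun b ↦ ⟨0, fun n _ ↦ by
        rw [one_pow, mul_one]
        exact hγC b⟩
    have h1 := h₀ n₀ le_rfl
    rw [one_pow, mul_one] at h1
    exact h1
  have hD'fin : Module.Finite D D' := by
    refine Algebra.finite_adjoin_of_finite_of_isIntegral (G.finite_toSet.image _) ?_
    rintro _ ⟨v, -, rfl⟩
    exact hCint v
  have hD'C (v : A') : (C v : E) ∈ D' := by
    have h1 : v ∈ Submodule.span A (G : Set A') := hG ▸ Submodule.mem_top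
    induction h1 using Submodule.span_induction with
    | mem x hx => exact Algebra.subset_adjoin ⟨x, hx, rfl⟩
    | zero => simp
    | add x y _ _ hx hy => rw [map_add]; exact add_mem hx hy
    | smul b x _ hx =>
      rw [Algebra.smul_def, map_mul]
      obtain ⟨d, hd⟩ := hγC b
      rw [← hd]
      exact mul_mem (D'.algebraMap_mem d) hx
  have hD'J {f : E} (hf : f ∈ D') : f ∈ reesSubalgebra (J.map (algebraMap A A')) := by
    induction hf using Algebra.adjoin_induction with
    | mem x hx =>
      obtain ⟨v, -, rfl⟩ := hx
      exact (reesSubalgebra _).algebraMap_mem v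
    | algebraMap d =>
      intro n
      rw [← Ideal.map_pow]
      change coeff n (PowerSeries.map _ (ι d)) ∈ _
      rw [coeff_map]
      exact Ideal.mem_map_of_mem _ (hιJ d n)
    | add x y _ _ hx hy => exact add_mem hx hy
    | mul x y _ _ hx hy => exact mul_mem hx hy
  -- A single nonzero coefficient of the conductor `d` will multiply all of the integral closure
  -- into the finite module `M`.
  obtain ⟨d, hd, hd0, hdD⟩ := hD.exists_mul_mem_of_isIntegral D'
  obtain ⟨n, hn⟩ : ∃ n, coeff n d ≠ 0 := by
    by_contra! h
    exact hd0 (PowerSeries.ext h)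
  -- the finite `T`-module spanned by `A'`
  let M : Submodule T K' := Submodule.span T ((algebraMap A' K') '' G)
  have hMfg : M.FG := ⟨G.image (algebraMap A' K'), by rw [Finset.coe_image]⟩
  have hMA (v : A') : algebraMap A' K' v ∈ M := by
    have h1 : v ∈ Submodule.span A (G : Set A') := hG ▸ Submodule.mem_top
    induction h1 using Submodule.span_induction with
    | mem x hx => exact Submodule.subset_span ⟨x, hx, rfl⟩
    | zero => simp
    | add x y _ _ hx hy => rw [map_add]; exact add_mem hx hy
    | smul b x _ hx =>
      have : algebraMap A' K' (b • x) = algebraMap A T b • algebraMap A' K' x := by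
        rw [Algebra.smul_def, map_mul, ← IsScalarTower.algebraMap_apply, Algebra.smul_def,
          IsScalarTower.algebraMap_apply A K K']
        rfl
      rw [this]
      exact Submodule.smul_mem _ _ hx
  have hsmulT (c : T) (x : K') : c • x = algebraMap K K' c * x := by
    rw [Algebra.smul_def]; rfl
  have hMJ (m : ℕ) {x : A'} (hx : x ∈ J.map (algebraMap A A') ^ m) :
      algebraMap A' K' x / (algebraMap A K' a) ^ m ∈ M := by
    rw [← Ideal.map_pow] at hx
    suffices h : ∀ v : A', algebraMap A' K' (v * x) / (algebraMap A K' a) ^ m ∈ M by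
      simpa using h 1
    change x ∈ Submodule.span A' _ at hx
    induction hx using Submodule.span_induction with
    | mem x hx =>
      obtain ⟨j, hj, rfl⟩ := hx
      intro v
      have h1 := Algebra.div_pow_mem_of_mem_pow T J hJT m hj
      have : algebraMap A' K' (v * algebraMap A A' j) / (algebraMap A K' a) ^ m =
          (⟨_, h1⟩ : T) • algebraMap A' K' v := by
        rw [hsmulT, map_mul, ← IsScalarTower.algebraMap_apply, map_div₀, map_pow,
          ← IsScalarTower.algebraMap_apply, ← IsScalarTower.algebraMap_apply]
        ring
      rw [this]
      exact Submodule.smul_mem _ _ (hMA v)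
    | zero => simp
    | add x y _ _ hx hy =>
      intro v
      rw [mul_add, map_add, add_div]
      exact add_mem (hx v) (hy v)
    | smul c x _ hx =>
      intro v
      rw [smul_eq_mul, ← mul_assoc]
      exact hx (v * c)
  have ha' : algebraMap A K' a ≠ 0 := by rwa [Ne, map_eq_zero_iff _ hAK']
  -- For large `s`, `v = a ^ s w` lies in `A'` and `v X ^ s` is integral over `D`. Hence `d v X ^ s`
  -- lies in `D'`, and its coefficient of degree `n + s` is in `J ^ (n + s) A'`.
  have hkey (w : integralClosure T K') : algebraMap A' K' (coeff n d) * w ∈ M := by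
    have hw : IsIntegral T (w : K') := w.2
    have hgrow {U : Type u} [CommRing U] (φ : K' →+* U) {S : Type u} [CommRing S] (g : S →+* U)
        (r : U) (hr : r ∈ g.range) (hA : ∀ b, φ (algebraMap A K' b) ∈ g.range)
        (hyt : ∀ y ∈ t, φ (algebraMap K K' y) * r ∈ g.range) :
        ∃ n₀, ∀ n ≥ n₀, g.IsIntegralElem (φ w * r ^ n) := by
      refine hw.exists_forall_isIntegralElem_mul_pow φ g r fun c ↦ ?_
      exact Algebra.exists_forall_mul_pow_mem_of_mem_adjoin (φ.comp (algebraMap K K')) g.range hr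
        (fun b ↦ by
          rw [RingHom.comp_apply, ← IsScalarTower.algebraMap_apply]
          exact hA b) hyt c.2
    obtain ⟨n₁, h₁⟩ := hgrow (RingHom.id K') (algebraMap A K') (algebraMap A K' a) ⟨a, rfl⟩
      (fun b ↦ ⟨b, rfl⟩) (fun y hy ↦ by
        obtain ⟨b, -, hb⟩ := htJ y hy
        refine ⟨b, ?_⟩
        rw [IsScalarTower.algebraMap_apply A K K', hb, map_mul,
          ← IsScalarTower.algebraMap_apply A K K']
        rfl)
    let δ : E →+* K'⟦X⟧ := PowerSeries.map (algebraMap A' K')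
    have hδ : Function.Injective δ := PowerSeries.map_injective _ hA'K'
    have hδι (x : D) : δ (γ x) = PowerSeries.map (algebraMap A K') (ι x) := by
      ext n
      change coeff n (PowerSeries.map _ (PowerSeries.map _ (ι x))) = _
      rw [coeff_map, coeff_map, coeff_map, ← IsScalarTower.algebraMap_apply]
    have hδJ (j : A) (hj : j ∈ J) : C (algebraMap A K' j) * X ∈ (δ.comp γ).range := by
      obtain ⟨x, hx⟩ := hιX j hj
      exact ⟨x, by rw [RingHom.comp_apply, hδι, hx]; simp⟩
    obtain ⟨n₂, h₂⟩ := hgrow (C (R := K')) (δ.comp γ) (C (algebraMap A K' a) * X) (hδJ a haJ)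
      (fun b ↦ by
        obtain ⟨x, hx⟩ := hιC b
        exact ⟨x, by rw [RingHom.comp_apply, hδι, hx]; simp⟩) (fun y hy ↦ by
        obtain ⟨b, hbJ, hb⟩ := htJ y hy
        have := hδJ b hbJ
        rw [IsScalarTower.algebraMap_apply A K K', hb, map_mul,
          ← IsScalarTower.algebraMap_apply A K K', map_mul, mul_assoc] at this
        exact this)
    let s := max n₁ n₂
    obtain ⟨v, hv⟩ := IsIntegralClosure.isIntegral_iff (A := A').1
      (h₁ s (le_max_left _ _) : IsIntegral A _)
    rw [RingHom.id_apply] at hv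
    have hy : IsIntegral D (C v * X ^ s : E) := by
      obtain ⟨p, hp, hpy⟩ := h₂ s (le_max_right _ _)
      refine ⟨p, hp, hδ ?_⟩
      have h3 : δ (C v * X ^ s : E) =
          C (w : K') * (C (algebraMap A K' a) * X) ^ s := by
        rw [map_mul, map_pow, map_X, map_C, hv, map_mul, mul_pow, map_pow, mul_assoc]
      rw [map_zero, Polynomial.hom_eval₂, h3]
      exact hpy
    have hdv : d * (C v * X ^ s : E) ∈ D' := by
      obtain ⟨r, hr⟩ := hιC (a ^ s)
      obtain ⟨x, hx⟩ := hιX a haJ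
      refine hdD _ r hy ?_ ?_
      · rintro rfl
        rw [map_zero] at hr
        have := congrArg (coeff 0) hr
        simp only [map_zero, coeff_zero_C] at this
        exact pow_ne_zero s ha this.symm
      · have : r • (C v * X ^ s : E) = C v * algebraMap D E x ^ s := by
          rw [Algebra.smul_def]
          change PowerSeries.map _ (ι r) * _ = _ * (PowerSeries.map _ (ι x)) ^ s
          rw [hr, hx, map_C, map_mul, map_C, map_X, mul_pow, map_pow, map_pow]
          ring
        rw [this]
        exact mul_mem (hD'C v) (pow_mem (D'.algebraMap_mem x) s)
    -- That coefficient is `coeff n d * a ^ s * w`. Division by `a ^ (n + s)` lands in `M`, and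
    -- multiplication by `a ^ n` removes the excess, which does not depend on `w`.
    have h4 := hMJ _ (hD'J hdv (n + s))
    rw [← mul_assoc, coeff_mul_X_pow, coeff_mul_C, map_mul, hv] at h4
    have h5 := Submodule.smul_mem M (algebraMap A T (a ^ n)) h4
    rw [hsmulT] at h5
    convert! h5 using 1
    have : algebraMap K K' (algebraMap A T (a ^ n) : K) = (algebraMap A K' a) ^ n := by
      rw [← map_pow, IsScalarTower.algebraMap_apply A K K']
      rfl
    rw [this, pow_add]
    field_simp
  have : IsNoetherian T M := isNoetherian_of_fg_of_noetherian M hMfg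
  let g : integralClosure T K' →ₗ[T] M :=
    { toFun w := ⟨_, hkey w⟩
      map_add' x y := Subtype.ext (by simp [mul_add])
      map_smul' c x := Subtype.ext (by simp) }
  refine Module.Finite.of_injective g fun x y hxy ↦ Subtype.ext ?_
  have := congrArg Subtype.val hxy
  refine mul_left_cancel₀ ?_ this
  rwa [Ne, map_eq_zero_iff _ hA'K']

/-- Being itself a complete local noetherian domain, the ring of power series from the Rees
construction falls under Nagata's theorem. -/
theorem PowerSeries.exists_isJapanese_reesAlgebra {A : Type u} [CommRing A]
    [IsDomain A] [IsNoetherianRing A] [IsLocalRing A] [IsAdicComplete (maximalIdeal A) A]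
    (J : Ideal A) : ∃ (D : Type u) (_ : CommRing D) (_ : IsDomain D) (_ : IsNoetherianRing D)
      (ι : D →+* A⟦X⟧), IsJapanese D ∧ Function.Injective ι ∧ (∀ d n, coeff n (ι d) ∈ J ^ n) ∧
      (∀ j ∈ J, C j * X ∈ ι.range) ∧ ∀ b, C b ∈ ι.range := by
  obtain ⟨D, hDJ, hDX, hDn, hDl, hDc⟩ := PowerSeries.exists_complete_reesAlgebra J
  exact ⟨D, inferInstance, inferInstance, hDn, D.val, isJapanese_of_isAdicComplete D,
    Subtype.val_injective, fun d n ↦ hDJ d.2 n, fun j hj ↦ ⟨⟨_, hDX j hj⟩, rfl⟩,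
    fun b ↦ ⟨⟨_, D.algebraMap_mem b⟩, rfl⟩⟩

/-- With a common denominator `a` of the generators, and `J` the ideal of all `j` with `j / a` in
`T`, one has `T = A[J/a]`. Finiteness then comes from the Rees algebra of `J`. -/
theorem Module.Finite.integralClosure_of_isAdicComplete {A K K' : Type u} [CommRing A]
    [IsDomain A] [IsNoetherianRing A] [IsLocalRing A] [IsAdicComplete (maximalIdeal A) A]
    [Field K] [Algebra A K] [IsFractionRing A K] [Field K'] [Algebra K K'] [Algebra A K']
    [IsScalarTower A K K'] [FiniteDimensional K K'] (T : Subalgebra A K) (hT : T.FG) :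
    Module.Finite T (integralClosure T K') := by
  obtain ⟨t, rfl⟩ := hT
  obtain ⟨⟨a, ha⟩, hat⟩ := IsLocalization.exist_integer_multiples_of_finset (nonZeroDivisors A) t
  have ha0 : a ≠ 0 := nonZeroDivisors.ne_zero ha
  have haK : algebraMap A K a ≠ 0 := by
    rwa [Ne, map_eq_zero_iff _ (IsFractionRing.injective A K)]
  obtain ⟨J, hJ⟩ : ∃ J : Ideal A, ∀ j, j ∈ J ↔
      algebraMap A K j / algebraMap A K a ∈ Algebra.adjoin A (t : Set K) :=
    ⟨(Subalgebra.toSubmodule (Algebra.adjoin A (t : Set K))).comap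
      ((LinearMap.mulRight A (algebraMap A K a)⁻¹).comp (Algebra.linearMap A K)), fun j ↦ by
      rw [div_eq_mul_inv]; rfl⟩
  have haJ : a ∈ J := by
    rw [hJ, div_self haK]
    exact one_mem _
  obtain ⟨D, _, _, _, ι, hD, hι, hιJ, hιX, hιC⟩ := PowerSeries.exists_isJapanese_reesAlgebra J
  have hA' : Module.Finite A (integralClosure A K') := isJapanese_of_isAdicComplete A K K'
  obtain ⟨A', _, _, _, _, _, _, _⟩ : ∃ (A' : Type u) (_ : CommRing A') (_ : IsDomain A')
      (_ : Algebra A A') (_ : Algebra A' K') (_ : IsScalarTower A A' K')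
      (_ : IsIntegralClosure A' A K'), Module.Finite A A' :=
    ⟨integralClosure A K', inferInstance, inferInstance, inferInstance, inferInstance,
      inferInstance, inferInstance, hA'⟩
  have htJ (y : K) (hy : y ∈ (t : Set K)) : ∃ b ∈ J, algebraMap A K b = y * algebraMap A K a := by
    obtain ⟨b, hb⟩ := hat y hy
    have hb' : algebraMap A K b = y * algebraMap A K a := by
      rw [hb, mul_comm]
      exact Algebra.smul_def a y
    refine ⟨b, ?_, hb'⟩
    rw [hJ, hb', mul_div_cancel_right₀ _ haK]
    exact Algebra.subset_adjoin hy
  have key := Module.Finite.integralClosure_of_reesAlgebra (K := K) (K' := K') (A' := A')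
    hD ι hι J hιJ hιX hιC t t.finite_toSet a ha0 haJ (fun j hj ↦ (hJ j).1 hj) htJ
  exact key

end FiniteIntegralClosure

/-! ### Noetherianity of complete local rings. -/

section Completion

open MvPowerSeries WithIdeal in
/-- A complete local ring with finitely generated maximal ideal, whose residue field is a quotient
of a noetherian ring mapping to it, is noetherian. -/
theorem IsNoetherianRing.of_isAdicComplete {R S : Type*} [CommRing R] [IsNoetherianRing R]
    [CommRing S] [IsLocalRing S] [IsAdicComplete (maximalIdeal S) S] (f : R →+* S)
    (hres : Function.Surjective ((residue S).comp f)) (hfg : (maximalIdeal S).FG) :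
    IsNoetherianRing S := by
  obtain ⟨r, a, ha⟩ := Submodule.fg_iff_exists_fin_generating_family.1 hfg
  have ham (i : Fin r) : a i ∈ maximalIdeal S := ha ▸ Submodule.subset_span ⟨i, rfl⟩
  let : UniformSpace R := ⊥
  have : DiscreteTopology R := ⟨rfl⟩
  let : WithIdeal S := ⟨maximalIdeal S⟩
  have hI : IsAdic (maximalIdeal S) := rfl
  obtain ⟨h1, h2⟩ := hI.isAdicComplete_iff.1 ‹_›
  have hf : Continuous f := continuous_of_discreteTopology
  have hev : HasEval a := by
    refine ⟨fun i ↦ ?_, ?_⟩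
    · rw [IsTopologicallyNilpotent, hI.hasBasis_nhds_zero.tendsto_right_iff]
      intro n _
      filter_upwards [Filter.eventually_ge_atTop n] with m hm
      exact Ideal.pow_le_pow_right hm (Ideal.pow_mem_pow (ham i) m)
    · rw [Filter.cofinite_eq_bot]
      exact Filter.tendsto_bot
  -- Evaluating the variables at generators of the maximal ideal gives a map from a noetherian power
  -- series ring. It is onto modulo that ideal, hence onto.
  let g := eval₂Hom hf hev
  have hgC (b : R) : g (C b) = f b := by
    rw [coe_eval₂Hom, eval₂_C]
  have hgX (i : Fin r) : g (X i) = a i := by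
    rw [coe_eval₂Hom, eval₂_X]
  have hmap : (Ideal.span (Set.range X)).map g = maximalIdeal S := by
    rw [Ideal.map_span, ← Set.range_comp, ← ha]
    congr 2
    exact funext hgX
  have hH : IsHausdorff ((Ideal.span (Set.range X)).map g) S := by
    rw [hmap]
    infer_instance
  refine isNoetherianRing_of_surjective _ _ g
    (surjective_of_mk_map_comp_surjective (I := Ideal.span (Set.range X)) g ?_)
  intro y
  obtain ⟨y, rfl⟩ := Ideal.Quotient.mk_surjective y
  obtain ⟨b, hb⟩ := hres (residue S y)
  refine ⟨C b, ?_⟩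
  rw [RingHom.comp_apply, hgC, Ideal.Quotient.eq, hmap]
  exact Ideal.Quotient.eq.1 hb

end Completion

/-! ### Finite integral closures in reduced algebras. -/

section GenericFiber

theorem Module.Finite.integralClosure_of_finiteType {A K K' T : Type u} [CommRing A]
    [IsDomain A] [IsNoetherianRing A] [IsLocalRing A] [IsAdicComplete (maximalIdeal A) A]
    [Field K] [Algebra A K] [IsFractionRing A K] [Field K'] [Algebra K K'] [Algebra A K']
    [IsScalarTower A K K'] [FiniteDimensional K K'] [CommRing T] [Algebra A T]
    [Algebra.FiniteType A T] [Algebra T K] [IsScalarTower A T K] [Algebra T K']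
    [IsScalarTower T K K'] (hT : Function.Injective (algebraMap T K)) :
    Module.Finite T (integralClosure T K') := by
  let θ : T →ₐ[A] K := IsScalarTower.toAlgHom A T K
  have hfg : θ.range.FG := by
    rw [← Algebra.map_top]
    exact (Algebra.FiniteType.out).map θ
  have := Module.Finite.integralClosure_of_isAdicComplete (K' := K') θ.range hfg
  let e : T ≃+* θ.range := (AlgEquiv.ofInjective θ hT).toRingEquiv
  have he (x : T) : algebraMap θ.range K' (e x) = algebraMap T K' x := by
    rw [IsScalarTower.algebraMap_apply T K K']
    rfl
  have he' (x : θ.range) : algebraMap θ.range K' x = algebraMap T K' (e.symm x) := by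
    rw [← he, e.apply_symm_apply]
  have hint (w : K') : IsIntegral θ.range w → IsIntegral T w := by
    rintro ⟨p, hp, hpw⟩
    refine ⟨p.map (e.symm : θ.range →+* T), hp.map _, ?_⟩
    rw [Polynomial.eval₂_map, ← hpw]
    congr 1
    ext x
    exact (he' x).symm
  have hint' (w : K') : IsIntegral T w → IsIntegral θ.range w := by
    rintro ⟨p, hp, hpw⟩
    refine ⟨p.map (e : T →+* θ.range), hp.map _, ?_⟩
    rw [Polynomial.eval₂_map, ← hpw]
    congr 1
    ext x
    exact he x
  have : RingHomSurjective (e.symm : θ.range →+* T) := ⟨e.symm.surjective⟩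
  let φ : integralClosure θ.range K' →ₛₗ[(e.symm : θ.range →+* T)] integralClosure T K' :=
    { toFun w := ⟨w, hint _ w.2⟩
      map_add' _ _ := rfl
      map_smul' c w := Subtype.ext <| by
        have : c • (w : K') = e.symm c • (w : K') := by
          rw [Algebra.smul_def, Algebra.smul_def, he']
        exact this }
  exact Module.Finite.of_surjective φ fun w ↦ ⟨⟨w, hint' _ w.2⟩, rfl⟩

/-- A reduced finite `K`-algebra is a finite product of fields, so the integral closure embeds in
the product of the integral closures in the factors. -/
theorem Module.Finite.integralClosure_of_isReduced {A K Q T : Type u} [CommRing A]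
    [IsDomain A] [IsNoetherianRing A] [IsLocalRing A] [IsAdicComplete (maximalIdeal A) A]
    [Field K] [Algebra A K] [IsFractionRing A K] [CommRing Q] [Algebra K Q] [Algebra A Q]
    [IsScalarTower A K Q] [Module.Finite K Q] [IsReduced Q] [CommRing T] [Algebra A T]
    [Algebra.FiniteType A T] [Algebra T K] [IsScalarTower A T K] [Algebra T Q]
    [IsScalarTower T K Q] (hT : Function.Injective (algebraMap T K)) :
    Module.Finite T (integralClosure T Q) := by
  have : IsNoetherianRing T := Algebra.FiniteType.isNoetherianRing A T
  have : IsArtinianRing Q := IsArtinianRing.of_finite K Q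
  have hfin (m : MaximalSpectrum Q) : Module.Finite T (integralClosure T (Q ⧸ m.asIdeal)) := by
    let : Field (Q ⧸ m.asIdeal) := Ideal.Quotient.field _
    exact Module.Finite.integralClosure_of_finiteType (A := A) (K := K) hT
  let φ (m : MaximalSpectrum Q) : integralClosure T Q →ₗ[T] integralClosure T (Q ⧸ m.asIdeal) :=
    { toFun w := ⟨Ideal.Quotient.mk _ w, w.2.map (Ideal.Quotient.mkₐ T m.asIdeal)⟩
      map_add' _ _ := rfl
      map_smul' _ _ := rfl }
  have : Finite (MaximalSpectrum Q) := inferInstance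
  refine Module.Finite.of_injective (LinearMap.pi φ) fun x y hxy ↦ Subtype.ext ?_
  refine (IsArtinianRing.equivPi Q).injective (funext fun m ↦ ?_)
  exact congrArg Subtype.val (congrFun hxy m)

end GenericFiber

/-! ### Descent of finiteness from the completion. -/

section GenericFiber

open nonZeroDivisors

theorem IsJapanese.of_isFractionRing {A : Type u} (F : Type u) [CommRing A] [IsDomain A] [Field F]
    [Algebra A F] [IsFractionRing A F]
    (h : ∀ (L : Type u) [Field L] [Algebra F L] [Algebra A L] [IsScalarTower A F L]
      [FiniteDimensional F L], Module.Finite A (integralClosure A L)) : IsJapanese A := by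
  intro K L _ _ _ _ _ _ _ _
  let e : F ≃ₐ[A] K := IsLocalization.algEquiv A⁰ F K
  let : Algebra F K := (e : F →+* K).toAlgebra
  let : Algebra F L := ((algebraMap K L).comp (e : F →+* K)).toAlgebra
  have : IsScalarTower F K L := .of_algebraMap_eq fun _ ↦ rfl
  have : IsScalarTower A F L := .of_algebraMap_eq fun x ↦ by
    change _ = algebraMap K L (e (algebraMap A F x))
    rw [e.commutes, ← IsScalarTower.algebraMap_apply]
  have : Module.Finite F K := Module.Finite.of_surjective (Algebra.linearMap F K) e.surjective
  have : FiniteDimensional F L := Module.Finite.trans K L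
  exact h L

theorem Subalgebra.isFractionRing {R F : Type*} [CommRing R] [Field F] [Algebra R F]
    [IsFractionRing R F] (S : Subalgebra R F) : IsFractionRing S F := by
  have : FaithfulSMul S F := (faithfulSMul_iff_algebraMap_injective S F).2 Subtype.val_injective
  refine IsFractionRing.of_field S F fun z ↦ ?_
  obtain ⟨x, y, -, h⟩ := IsFractionRing.div_surjective R z
  exact ⟨algebraMap R S x, algebraMap R S y, h.symm⟩

/-- `F` is flat over `R`, so the tensor product embeds in `F ⊗ K`, and this is `K` because `K`
already contains `F`. -/
theorem exists_injective_algHom_tensorProduct (R F A K : Type*) [CommRing R] [IsDomain R] [Field F]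
    [Algebra R F] [IsFractionRing R F] [CommRing A] [Algebra R A] [Field K] [Algebra A K]
    [IsFractionRing A K] [Algebra R K] [IsScalarTower R A K] [Algebra F K] [IsScalarTower R F K] :
    ∃ ψ : F ⊗[R] A →ₐ[F] K, Function.Injective ψ ∧
      ∀ f a, ψ (f ⊗ₜ a) = algebraMap F K f * algebraMap A K a := by
  have : Module.Flat R F := IsLocalization.flat F R⁰
  let e : F ⊗[R] K ≃ₐ[F] K := IsLocalization.algebraLid R⁰ F K
  let φ : F ⊗[R] A →ₐ[F] F ⊗[R] K :=
    Algebra.TensorProduct.map (AlgHom.id F F) (IsScalarTower.toAlgHom R A K)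
  have hφ : Function.Injective φ := Module.Flat.lTensor_preserves_injective_linearMap (M := F)
    (IsScalarTower.toAlgHom R A K).toLinearMap (IsFractionRing.injective A K)
  refine ⟨e.toAlgHom.comp φ, e.injective.comp hφ, fun f a ↦ ?_⟩
  have : φ (f ⊗ₜ a) = f • (1 ⊗ₜ algebraMap A K a) := by
    rw [TensorProduct.smul_tmul', smul_eq_mul, mul_one]
    rfl
  rw [AlgHom.comp_apply, this, map_smul, Algebra.smul_def]
  congr 1
  exact one_smul F (algebraMap A K a)

/-- If the generic formal fibre stays reduced after a finite extension, integral closures in this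
extension are finite. -/
theorem Module.Finite.integralClosure_of_isReduced_tensorProduct {R F A K L : Type u} [CommRing R]
    [IsDomain R] [Field F] [Algebra R F] [IsFractionRing R F] [CommRing A] [IsDomain A]
    [IsNoetherianRing A] [IsLocalRing A] [IsAdicComplete (maximalIdeal A) A] [Algebra R A]
    [Module.FaithfullyFlat R A] [Field K] [Algebra A K] [IsFractionRing A K] [Algebra R K]
    [IsScalarTower R A K] [Algebra F K] [IsScalarTower R F K] [Field L] [Algebra F L]
    [FiniteDimensional F L] [IsReduced (K ⊗[F] L)] {R' : Type u} [CommRing R'] [IsDomain R']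
    [Algebra R R'] [Algebra.FiniteType R R'] [Algebra R' F] [IsScalarTower R R' F]
    [IsFractionRing R' F] [Algebra R' L] [IsScalarTower R' F L] : Module.Finite R' (integralClosure R' L) := by
  let : Algebra R' K := ((algebraMap F K).comp (algebraMap R' F)).toAlgebra
  have : IsScalarTower R' F K := .of_algebraMap_eq fun _ ↦ rfl
  have : IsScalarTower R R' K := .of_algebraMap_eq fun x ↦ by
    rw [IsScalarTower.algebraMap_apply R F K, IsScalarTower.algebraMap_apply R R' F,
      ← IsScalarTower.algebraMap_apply R' F K]
  -- the base change of `R'`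
  let T := R' ⊗[R] A
  let : Algebra A T := Algebra.TensorProduct.rightAlgebra
  let θ : T →ₐ[R'] K := Algebra.TensorProduct.lift (Algebra.ofId R' K)
    (IsScalarTower.toAlgHom R A K) fun _ _ ↦ mul_comm _ _
  have hθt (x : R') (y : A) : θ (x ⊗ₜ y) = algebraMap R' K x * algebraMap A K y := rfl
  -- `A` is flat over `R`, so `R' ⊗ A` sits inside `F ⊗ A`, and that inside `K`.
  have hθ : Function.Injective θ := by
    obtain ⟨ψ, hψ, hψt⟩ := exists_injective_algHom_tensorProduct R F A K
    have h1 : Function.Injective (LinearMap.rTensor A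
        (IsScalarTower.toAlgHom R R' F).toLinearMap) :=
      Module.Flat.rTensor_preserves_injective_linearMap _ (IsFractionRing.injective R' F)
    have h2 (x : T) : θ x = ψ (LinearMap.rTensor A
        (IsScalarTower.toAlgHom R R' F).toLinearMap x) := by
      induction x using TensorProduct.induction_on with
      | zero => simp
      | add x y hx hy => rw [map_add, map_add, map_add, hx, hy]
      | tmul x y =>
        rw [hθt, LinearMap.rTensor_tmul, hψt]
        exact congrArg (· * _) (IsScalarTower.algebraMap_apply R' F K x)
    intro x y hxy
    rw [h2, h2] at hxy
    exact h1 (hψ hxy)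
  let : Algebra T K := θ.toAlgebra
  have : IsScalarTower R' T K := .of_algebraMap_eq fun x ↦ (θ.commutes x).symm
  have : IsScalarTower A T K := .of_algebraMap_eq fun x ↦ by
    change _ = θ (1 ⊗ₜ x)
    rw [hθt, map_one, one_mul]
  have : Algebra.FiniteType A T := by
    let g : A ⊗[R] R' →ₐ[A] T :=
      { (Algebra.TensorProduct.comm R A R' : A ⊗[R] R' →+* T) with
        commutes' _ := rfl }
    exact Algebra.FiniteType.of_surjective g (Algebra.TensorProduct.comm R A R').surjective
  have hTnoeth : IsNoetherianRing T := Algebra.FiniteType.isNoetherianRing A T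
  -- the generic fibre
  let Q := K ⊗[R'] L
  let e : K ⊗[F] L ≃ₐ[F] Q := IsLocalization.algebraTensorEquiv R'⁰ F K L
  have : IsReduced Q := isReduced_of_injective e.symm e.symm.injective
  have : Module.Finite K Q := by
    let e' : K ⊗[F] L →ₗ[K] Q :=
      { toFun := e
        map_add' := map_add e
        map_smul' c x := by
          induction x with
          | zero => simp
          | add x y hx hy => rw [smul_add, map_add, hx, hy, map_add, smul_add]
          | tmul x y => rfl }
    exact Module.Finite.of_surjective e' e.surjective
  have hfin : Module.Finite T (integralClosure T Q) :=
    Module.Finite.integralClosure_of_isReduced (A := A) (K := K) hθ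
  have : Module.Flat R' F := IsLocalization.flat F R'⁰
  have : Module.Flat R' L := Module.Flat.trans R' F L
  let N := integralClosure R' L
  let Φ : T ⊗[R'] N →ₐ[T] Q := Algebra.TensorProduct.map (Algebra.ofId T K) N.val
  -- `T ⊗ N → T ⊗ L → K ⊗ L`: the first map is injective by flatness of `T` over `R'`, the second by
  -- flatness of `L`.
  have hΦ : Function.Injective Φ := by
    have h1 : Function.Injective (LinearMap.lTensor T N.val.toLinearMap) :=
      Module.Flat.lTensor_preserves_injective_linearMap _ Subtype.val_injective
    have h2 : Function.Injective (LinearMap.rTensor L θ.toLinearMap) :=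
      Module.Flat.rTensor_preserves_injective_linearMap _ hθ
    have h3 (x : T ⊗[R'] N) : Φ x = LinearMap.rTensor L θ.toLinearMap
        (LinearMap.lTensor T N.val.toLinearMap x) := by
      induction x with
      | zero => simp
      | add x y hx hy => rw [map_add, map_add, map_add, hx, hy]
      | tmul x y => rfl
    intro x y hxy
    rw [h3, h3] at hxy
    exact h1 (h2 hxy)
  have : Module.Finite T (T ⊗[R'] N) := by
    let g : T ⊗[R'] N →ₗ[T] integralClosure T Q :=
      { toFun x := ⟨Φ x, (Algebra.IsIntegral.isIntegral x).map Φ⟩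
        map_add' x y := Subtype.ext (map_add Φ x y)
        map_smul' c x := Subtype.ext (map_smul Φ c x) }
    exact Module.Finite.of_injective g fun x y hxy ↦ hΦ (congrArg Subtype.val hxy)
  -- `T` is a base change of `R → A`, hence faithfully flat over `R'`.
  exact Module.Finite.of_finite_tensorProduct_of_faithfullyFlat T

end GenericFiber

/-! ### Charts of blow-ups. -/

section BlowUp

/-- Homogenization: elements of the chart `H[M/a]` are fractions `h / a ^ k` with `h` in `M ^ k`. -/
theorem Algebra.exists_mul_pow_eq_of_mem_adjoin {H B : Type*} [CommRing H] [CommRing B]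
    [Algebra H B] {M : Ideal H} {a : H} {t : Set B}
    (ht : ∀ y ∈ t, ∃ x ∈ M, y * algebraMap H B a = algebraMap H B x) (ha : a ∈ M) {u : B}
    (hu : u ∈ Algebra.adjoin H t) :
    ∃ k, ∃ h ∈ M ^ k, u * algebraMap H B a ^ k = algebraMap H B h := by
  induction hu using Algebra.adjoin_induction with
  | mem y hy =>
    obtain ⟨x, hx, h⟩ := ht y hy
    exact ⟨1, x, by rwa [pow_one], by rwa [pow_one]⟩
  | algebraMap h => exact ⟨0, h, by simp, by simp⟩
  | add x y _ _ hx hy =>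
    obtain ⟨k, h, hh, e⟩ := hx
    obtain ⟨k', h', hh', e'⟩ := hy
    refine ⟨k + k', h * a ^ k' + h' * a ^ k, add_mem ?_ ?_, ?_⟩
    · rw [pow_add]
      exact Ideal.mul_mem_mul hh (Ideal.pow_mem_pow ha _)
    · rw [add_comm k, pow_add]
      exact Ideal.mul_mem_mul hh' (Ideal.pow_mem_pow ha _)
    · rw [map_add, map_mul, map_mul, map_pow, map_pow, ← e, ← e']
      ring
  | mul x y _ _ hx hy =>
    obtain ⟨k, h, hh, e⟩ := hx
    obtain ⟨k', h', hh', e'⟩ := hy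
    refine ⟨k + k', h * h', ?_, ?_⟩
    · rw [pow_add]
      exact Ideal.mul_mem_mul hh hh'
    · rw [map_mul, ← e, ← e']
      ring

/-- Krull's intersection theorem in a chart of the blow-up of `M`. -/
theorem Ideal.exists_pow_mul_mem_of_forall_mem {H : Type*} [CommRing H] [IsNoetherianRing H]
    {M : Ideal H} {a : H} (haM : a ∈ M) (ha : a ∈ nonZeroDivisors H) {X : H}
    (h : ∀ n, ∃ j, a ^ j * X ∈ span {a ^ n} * M ^ j) :
    ∃ j, a ^ j * X ∈ M ^ (j + 1) * span {X} := by
  classical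
  let B := Localization.Away a
  have hB : Function.Injective (algebraMap H B) :=
    IsLocalization.injective B (Submonoid.powers_le.2 ha)
  obtain ⟨i, hi⟩ := (IsLocalization.Away.algebraMap_isUnit (S := B) a).exists_right_inv
  obtain ⟨g, hg⟩ := IsNoetherian.noetherian M
  let t : Set B := (fun x ↦ algebraMap H B x * i) '' g
  let U := Algebra.adjoin H t
  have hU : IsNoetherianRing U := by
    have : Algebra.FiniteType H U := (Subalgebra.fg_iff_finiteType _).1
      ⟨g.image (fun x ↦ algebraMap H B x * i), by rw [Finset.coe_image]⟩
    exact Algebra.FiniteType.isNoetherianRing H U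
  have hM1 {x : H} (hx : x ∈ M) : algebraMap H B x * i ∈ U := by
    rw [← hg] at hx
    induction hx using Submodule.span_induction with
    | mem x hx => exact Algebra.subset_adjoin ⟨x, hx, rfl⟩
    | zero => simp
    | add x y _ _ hx hy =>
      rw [map_add, add_mul]
      exact add_mem hx hy
    | smul c x _ hx =>
      rw [smul_eq_mul, map_mul, mul_assoc]
      exact mul_mem (U.algebraMap_mem c) hx
  have hM (m : ℕ) {x : H} (hx : x ∈ M ^ m) : algebraMap H B x * i ^ m ∈ U := by
    induction m generalizing x with
    | zero => simp
    | succ m ih =>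
      rw [pow_succ] at hx
      induction hx using Submodule.mul_induction_on' with
      | mem_mul_mem x hx y hy =>
        rw [map_mul, pow_succ, mul_mul_mul_comm]
        exact mul_mem (ih hx) (hM1 hy)
      | add x _ y _ hx hy =>
        rw [map_add, add_mul]
        exact add_mem hx hy
  -- The hypothesis says that `X` is divisible by every power of `a` in the noetherian chart `U =
  -- H[M/a]`.
  have hX : algebraMap H U X ∈ (⨅ n : ℕ, span {algebraMap H U a} ^ n • ⊤ : Submodule U U) := by
    rw [Submodule.mem_iInf]
    intro n
    obtain ⟨j, hj⟩ := h n
    obtain ⟨x, hx, e⟩ := Ideal.mem_span_singleton_mul.1 hj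
    rw [smul_eq_mul, Ideal.mul_top, Ideal.span_singleton_pow, Ideal.mem_span_singleton]
    refine ⟨⟨_, hM j hx⟩, Subtype.ext ?_⟩
    change algebraMap H B X = algebraMap H B a ^ n * (algebraMap H B x * i ^ j)
    rw [← mul_assoc, ← map_pow, ← map_mul, e, map_mul, map_pow, mul_right_comm, ← mul_pow, hi,
      one_pow, one_mul]
  -- Krull's theorem gives `X = a u X` with `u` in the chart. Writing `u = x / a ^ k` with `x` in `M
  -- ^ k` yields `a ^ k X = x a X`.
  obtain ⟨⟨r, hr⟩, hrX⟩ := (Ideal.mem_iInf_smul_pow_eq_bot_iff _ _).1 hX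
  obtain ⟨u, rfl⟩ := Ideal.mem_span_singleton.1 hr
  obtain ⟨k, x, hx, e⟩ := Algebra.exists_mul_pow_eq_of_mem_adjoin (M := M) (a := a) (t := t) (by
    rintro _ ⟨x, hx, rfl⟩
    exact ⟨x, hg ▸ Submodule.subset_span hx, by rw [mul_assoc, mul_comm i, hi, mul_one]⟩) haM u.2
  have h1 : algebraMap H B a * u * algebraMap H B X = algebraMap H B X := congrArg Subtype.val hrX
  have h2 : a ^ k * X = (x * a) * X := by
    apply hB
    rw [map_mul, map_mul, map_mul, ← e, map_pow]
    nth_rewrite 1 [← h1]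
    ring
  refine ⟨k, ?_⟩
  rw [h2, pow_succ]
  exact Ideal.mul_mem_mul (Ideal.mul_mem_mul hx haM) (Ideal.mem_span_singleton_self X)

/-- Apart from `y ^ (k + 1)`, every product of generators has a factor in `I`. If that power is
zero, `y` is thus integral over `I`. -/
theorem Ideal.sup_span_singleton_pow_le {H : Type*} [CommRing H] (I : Ideal H) (y : H) (k : ℕ) :
    (I ⊔ span {y}) ^ (k + 1) ≤ I * (I ⊔ span {y}) ^ k ⊔ span {y ^ (k + 1)} := by
  induction k with
  | zero => simp
  | succ k ih =>
    rw [pow_succ' _ (k + 1)]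
    nth_rewrite 1 [Ideal.sup_mul]
    refine sup_le le_sup_left ((Ideal.mul_mono_right ih).trans ?_)
    rw [Ideal.mul_sup]
    refine sup_le_sup ?_ ?_
    · rw [mul_left_comm, pow_succ' _ k]
      exact Ideal.mul_mono_right (Ideal.mul_mono_left le_sup_right)
    · rw [Ideal.span_singleton_mul_span_singleton, ← pow_succ']

/-- Integrality over an ideal gives integral elements over the blow-up. -/
theorem isIntegral_div_of_span_singleton_mul_le {R R' S L : Type*} [CommRing R] [IsNoetherianRing R]
    [CommRing R'] [CommRing S] [Field L] [Algebra R S] [Module.Finite R S] [Algebra S L]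
    [Algebra R L] [IsScalarTower R S L] [Algebra R R'] [Algebra R' L] [IsScalarTower R R' L]
    (hSL : Function.Injective (algebraMap S L)) {I : Ideal R} {d : L}
    (hI : ∀ r ∈ I, algebraMap R L r / d ∈ (algebraMap R' L).range) {J : Ideal S} (hJ : J ≠ ⊥)
    {x : S} (hx : Ideal.span {x} * J ≤ I.map (algebraMap R S) * J) :
    IsIntegral R' (algebraMap S L x / d) := by
  let P : Submodule R' L := Submodule.span R' (algebraMap S L '' J)
  have : IsNoetherian R S := isNoetherian_of_isNoetherianRing_of_finite R S
  obtain ⟨g, hg⟩ := IsNoetherian.noetherian (J.restrictScalars R)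
  have hmem {y : S} (hy : y ∈ J) : algebraMap S L y ∈ P := Submodule.subset_span ⟨y, hy, rfl⟩
  have hfg : P.FG := by
    classical
    refine ⟨g.image (algebraMap S L), le_antisymm (Submodule.span_mono ?_)
      (Submodule.span_le.2 ?_)⟩
    · rw [Finset.coe_image]
      refine Set.image_mono fun y hy ↦ ?_
      have : y ∈ J.restrictScalars R := hg ▸ Submodule.subset_span hy
      exact this
    · rintro _ ⟨y, hy, rfl⟩
      have hy' : y ∈ Submodule.span R (g : Set S) := by
        rw [hg]
        exact hy
      rw [SetLike.mem_coe, Finset.coe_image]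
      clear hy
      induction hy' using Submodule.span_induction with
      | mem y hy => exact Submodule.subset_span ⟨y, hy, rfl⟩
      | zero => simp
      | add y z _ _ hy hz =>
        rw [map_add]
        exact add_mem hy hz
      | smul c y _ hy =>
        have : algebraMap S L (c • y) = algebraMap R R' c • algebraMap S L y := by
          rw [Algebra.smul_def, map_mul, ← IsScalarTower.algebraMap_apply, Algebra.smul_def,
            ← IsScalarTower.algebraMap_apply]
        rw [this]
        exact Submodule.smul_mem _ _ hy
  have hP : P ≠ ⊥ := by
    obtain ⟨y, hy, hy0⟩ := Submodule.exists_mem_ne_zero_of_ne_bot hJ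
    refine (Submodule.ne_bot_iff _).2 ⟨_, hmem hy, ?_⟩
    rwa [Ne, map_eq_zero_iff _ hSL]
  have hIJ {y : S} (hy : y ∈ I.map (algebraMap R S) * J) : algebraMap S L y / d ∈ P := by
    induction hy using Submodule.mul_induction_on' with
    | mem_mul_mem x hx y hy =>
      change x ∈ Submodule.span S _ at hx
      induction hx using Submodule.span_induction generalizing y with
      | mem x hx =>
        obtain ⟨r, hr, rfl⟩ := hx
        obtain ⟨r', h'⟩ := hI r hr
        have : algebraMap S L (algebraMap R S r * y) / d = r' • algebraMap S L y := by
          rw [Algebra.smul_def, h', map_mul, ← IsScalarTower.algebraMap_apply]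
          ring
        rw [this]
        exact Submodule.smul_mem _ _ (hmem hy)
      | zero => simp
      | add x x' _ _ hx hx' =>
        rw [add_mul, map_add, add_div]
        exact add_mem (hx y hy) (hx' y hy)
      | smul c x _ hx =>
        rw [smul_eq_mul, mul_comm c, mul_assoc]
        exact hx _ (Ideal.mul_mem_left _ _ hy)
    | add x _ y _ hx hy =>
      rw [map_add, add_div]
      exact add_mem hx hy
  -- The determinant trick: `x / d` maps the nonzero finitely generated `R'`-module spanned by `J`
  -- into itself.
  refine isIntegral_of_smul_mem_submodule P hP hfg _ fun y hy ↦ ?_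
  induction hy using Submodule.span_induction with
  | mem y hy =>
    obtain ⟨y, hy, rfl⟩ := hy
    rw [smul_eq_mul, div_mul_eq_mul_div, ← map_mul]
    exact hIJ (hx (Ideal.mul_mem_mul (Ideal.mem_span_singleton_self x) hy))
  | zero => simp
  | add y z _ _ hy hz =>
    rw [smul_add]
    exact add_mem hy hz
  | smul c y _ hy =>
    rw [smul_comm]
    exact Submodule.smul_mem _ _ hy

end BlowUp

/-! ### Reducedness of completions from the japanese property. -/

section Reduced

theorem Ideal.pow_mul_pow_mul_le {H : Type*} [CommRing H] {M Z A B : Ideal H} (hA : A ≤ M)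
    (hB : B ≤ M) {j : ℕ} (h : A ^ j * Z ≤ M ^ (j + 1) * Z) {i : ℕ} (hi : j ≤ i) (l : ℕ) :
    A ^ i * B ^ l * Z ≤ M ^ (i + l + 1) * Z := by
  obtain ⟨i, rfl⟩ := Nat.exists_eq_add_of_le hi
  calc A ^ (j + i) * B ^ l * Z = A ^ i * B ^ l * (A ^ j * Z) := by ring
    _ ≤ M ^ i * M ^ l * (M ^ (j + 1) * Z) :=
      Ideal.mul_mono (Ideal.mul_mono (Ideal.pow_right_mono hA i) (Ideal.pow_right_mono hB l)) h
    _ = M ^ (j + i + l + 1) * Z := by ring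

/-- Gluing of the charts: a product of `j + k` factors from `insert a s` contains `a` at least `j`
times or elements of `s` at least `k` times, and either suffices. -/
theorem Ideal.exists_pow_mul_le_of_forall_mem {H : Type*} [CommRing H] {M Z : Ideal H}
    {s : Set H} (hs : s ⊆ M) (hfin : s.Finite)
    (h : ∀ a ∈ s, ∃ j, span {a} ^ j * Z ≤ M ^ (j + 1) * Z) :
    ∃ j, span s ^ j * Z ≤ M ^ (j + 1) * Z := by
  induction s, hfin using Set.Finite.induction_on with
  | empty => exact ⟨1, by simp⟩
  | @insert a s _ _ ih =>
    obtain ⟨j, hj⟩ := h a (by simp)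
    obtain ⟨k, hk⟩ := ih ((Set.subset_insert a s).trans hs) fun b hb ↦ h b (by simp [hb])
    have ha : span {a} ≤ M := by
      rw [span_le, Set.singleton_subset_iff]
      exact hs (by simp)
    have hs' : span s ≤ M := span_le.2 ((Set.subset_insert a s).trans hs)
    refine ⟨j + k, ?_⟩
    rw [span_insert, ← Submodule.add_eq_sup, add_pow, Finset.sum_mul]
    refine Finset.sum_induction _ (· ≤ M ^ (j + k + 1) * Z) (fun _ _ ↦ sup_le) bot_le
      fun i hi ↦ (Ideal.mul_mono_left Ideal.mul_le_left).trans ?_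
    have hi' := Finset.mem_range_succ_iff.1 hi
    rcases le_total j i with hij | hij
    · have := Ideal.pow_mul_pow_mul_le ha hs' hj hij (j + k - i)
      rwa [Nat.add_sub_cancel' hi'] at this
    · have := Ideal.pow_mul_pow_mul_le hs' ha hk (show k ≤ j + k - i by lia) i
      rwa [Nat.sub_add_cancel hi', mul_comm (span s ^ _)] at this

/-- If all finitely generated subalgebras of the field of fractions are japanese, the completion
of a finite domain extension is reduced. -/
theorem isReduced_of_forall_isJapanese {R F S L H : Type u} [CommRing R] [IsDomain R]
    [IsLocalRing R] [IsNoetherianRing R] [Field F] [Algebra R F] [IsFractionRing R F] [CommRing S]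
    [IsDomain S] [Algebra R S] [Module.Finite R S] [FaithfulSMul R S] [Field L] [Algebra S L]
    [IsFractionRing S L] [Algebra F L] [FiniteDimensional F L] [Algebra R L] [IsScalarTower R S L]
    [IsScalarTower R F L] [CommRing H] [IsNoetherianRing H] [Algebra S H]
    [Module.FaithfullyFlat S H] [Algebra R H] [IsScalarTower R S H]
    (hdense : ∀ (n : ℕ) (x : H), ∃ s : S,
      x - algebraMap S H s ∈ ((maximalIdeal R).map (algebraMap R H)) ^ n)
    (hHaus : ∀ x : H, (∀ n : ℕ, x ∈ ((maximalIdeal R).map (algebraMap R H)) ^ n) → x = 0)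
    (hJ : ∀ R' : Subalgebra R F, R'.FG → IsJapanese R') : IsReduced H := by
  classical
  set M := (maximalIdeal R).map (algebraMap R H) with hM
  have hRS : Function.Injective (algebraMap R S) := FaithfulSMul.algebraMap_injective R S
  have hSL : Function.Injective (algebraMap S L) := IsFractionRing.injective S L
  have hRF : Function.Injective (algebraMap R F) := IsFractionRing.injective R F
  have hSH : Function.Injective (algebraMap S H) := FaithfulSMul.algebraMap_injective S H
  have hreg {s : S} (hs : s ≠ 0) {x : H} (hx : algebraMap S H s * x = 0) : x = 0 := by
    have h1 : IsSMulRegular S s := fun _ _ h ↦ mul_left_cancel₀ hs h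
    have h2 : IsSMulRegular H (algebraMap S H s) := h1.of_flat
    exact h2 (by simpa using hx)
  have hreg' {a : R} (ha : a ≠ 0) {x : H} (hx : algebraMap R H a * x = 0) : x = 0 := by
    rw [IsScalarTower.algebraMap_apply R S H] at hx
    exact hreg (by rwa [Ne, map_eq_zero_iff _ hRS]) hx
  obtain ⟨g, hg⟩ := IsNoetherian.noetherian (maximalIdeal R)
  constructor
  intro z hz
  obtain ⟨k, hk⟩ : ∃ k, z ^ (k + 1) = 0 := by
    obtain ⟨k, hk⟩ := hz
    exact ⟨k, by rw [pow_succ, hk, zero_mul]⟩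
  -- integrality over the ideals `𝔪ⁿS`
  have hint (n : ℕ) (s : S) (hs : z - algebraMap S H s ∈ M ^ n) :
      Ideal.span {s} * ((maximalIdeal R ^ n).map (algebraMap R S) ⊔ Ideal.span {s}) ^ k ≤
        (maximalIdeal R ^ n).map (algebraMap R S) *
          ((maximalIdeal R ^ n).map (algebraMap R S) ⊔ Ideal.span {s}) ^ k := by
    set I := (maximalIdeal R ^ n).map (algebraMap R S)
    have hI : I.map (algebraMap S H) = M ^ n := by
      rw [hM, ← Ideal.map_pow, Ideal.map_map, ← IsScalarTower.algebraMap_eq]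
    have h1 : M ^ n ⊔ Ideal.span {algebraMap S H s} = M ^ n ⊔ Ideal.span {z} := by
      refine le_antisymm (sup_le le_sup_left ?_) (sup_le le_sup_left ?_) <;>
        rw [Ideal.span_le, Set.singleton_subset_iff, SetLike.mem_coe]
      · rw [← sub_sub_cancel z (algebraMap S H s)]
        exact sub_mem (Ideal.mem_sup_right (Ideal.mem_span_singleton_self z))
          (Ideal.mem_sup_left hs)
      · rw [← sub_add_cancel z (algebraMap S H s)]
        exact add_mem (Ideal.mem_sup_left hs)
          (Ideal.mem_sup_right (Ideal.mem_span_singleton_self _))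
    -- As `z ^ (k + 1) = 0`, the ideal `M ^ n + (z)` has reduction `M ^ n`; and modulo `M ^ n`, `z`
    -- may be exchanged for `s`.
    have h2 := Ideal.sup_span_singleton_pow_le (M ^ n) z k
    rw [hk, Ideal.span_singleton_zero, sup_bot_eq, ← h1] at h2
    have h3 : (Ideal.span {s} * (I ⊔ Ideal.span {s}) ^ k).map (algebraMap S H) ≤
        (I * (I ⊔ Ideal.span {s}) ^ k).map (algebraMap S H) := by
      simp only [Ideal.map_mul, Ideal.map_pow, Ideal.map_sup, hI, Ideal.map_span,
        Set.image_singleton]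
      refine le_trans ?_ h2
      rw [pow_succ']
      exact Ideal.mul_mono_left le_sup_right
    -- Faithful flatness brings the inclusion of ideals back from `H` to `S`.
    have h4 := Ideal.comap_mono (f := algebraMap S H) h3
    rwa [Ideal.comap_map_eq_self_of_faithfullyFlat, Ideal.comap_map_eq_self_of_faithfullyFlat] at h4
  have hkey (a : R) (ha : a ∈ maximalIdeal R) (ha0 : a ≠ 0) :
      ∃ j, algebraMap R H a ^ j * z ∈ M ^ (j + 1) * Ideal.span {z} := by
    have haF : algebraMap R F a ≠ 0 := by rwa [Ne, map_eq_zero_iff _ hRF]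
    have haL : algebraMap R L a ≠ 0 := by
      rw [IsScalarTower.algebraMap_apply R S L]
      rwa [Ne, map_eq_zero_iff _ hSL, map_eq_zero_iff _ hRS]
    have haM : algebraMap R H a ∈ M := Ideal.mem_map_of_mem _ ha
    let t : Set F := (fun x ↦ algebraMap R F x / algebraMap R F a) '' g
    let R' := Algebra.adjoin R t
    have hfg : R'.FG := ⟨g.image fun x ↦ algebraMap R F x / algebraMap R F a, by
      rw [Finset.coe_image]⟩
    have hmR' (r : R) (hr : r ∈ maximalIdeal R) : algebraMap R F r / algebraMap R F a ∈ R' := by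
      rw [← hg] at hr
      induction hr using Submodule.span_induction with
      | mem x hx => exact Algebra.subset_adjoin ⟨x, hx, rfl⟩
      | zero => simp
      | add x y _ _ hx hy =>
        rw [map_add, add_div]
        exact add_mem hx hy
      | smul c x _ hx =>
        rw [smul_eq_mul, map_mul, mul_div_assoc]
        exact mul_mem (R'.algebraMap_mem c) hx
    have hR'L (r : R') : algebraMap R' L r = algebraMap F L r := rfl
    have := R'.isFractionRing
    have hfin : Module.Finite R' (integralClosure R' L) := hJ R' hfg F L
    -- a common denominator
    let P : Submodule R' L := Submodule.span R' (Set.range (algebraMap S L))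
    obtain ⟨c, hc0, hc⟩ : ∃ c : S, c ≠ 0 ∧
        ∀ w : L, IsIntegral R' w → algebraMap S L c * w ∈ P := by
      obtain ⟨G, hG⟩ := hfin.fg_top
      obtain ⟨⟨c, hc⟩, hcG⟩ := IsLocalization.exist_integer_multiples_of_finset
        (nonZeroDivisors S) (G.image Subtype.val)
      refine ⟨c, nonZeroDivisors.ne_zero hc, fun w hw ↦ ?_⟩
      have hw' : (⟨w, hw⟩ : integralClosure R' L) ∈ Submodule.span R' (G : Set _) :=
        hG ▸ Submodule.mem_top
      have hgen (w : integralClosure R' L) (hw : w ∈ Submodule.span R' (G : Set _)) :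
          algebraMap S L c * w ∈ P := by
        induction hw using Submodule.span_induction with
        | mem w hw =>
          obtain ⟨s, hs⟩ := hcG w (Finset.mem_image_of_mem _ hw)
          refine Submodule.subset_span ⟨s, hs.trans ?_⟩
          exact Algebra.smul_def c (w : L)
        | zero => simp
        | add x y _ _ hx hy =>
          rw [Subalgebra.coe_add, mul_add]
          exact add_mem hx hy
        | smul r x _ hx =>
          rw [Subalgebra.coe_smul, mul_smul_comm]
          exact Submodule.smul_mem _ _ hx
      exact hgen _ hw'
    -- Elements of `P = R'S` are fractions with denominator `a ^ j` and numerator in `𝔪 ^ j S`.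
    have hP {w : L} (hw : w ∈ P) : ∃ j, ∃ s ∈ (maximalIdeal R ^ j).map (algebraMap R S),
        w * algebraMap R L a ^ j = algebraMap S L s := by
      induction hw using Submodule.span_induction with
      | mem w hw =>
        obtain ⟨s, rfl⟩ := hw
        exact ⟨0, s, by simp [Ideal.one_eq_top, Ideal.map_top], by simp⟩
      | zero => exact ⟨0, 0, by simp, by simp⟩
      | add x y _ _ hx hy =>
        obtain ⟨i, s, hs, e⟩ := hx
        obtain ⟨j, s', hs', e'⟩ := hy
        have haI (i : ℕ) : algebraMap R S a ^ i ∈ (maximalIdeal R ^ i).map (algebraMap R S) := by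
          rw [← map_pow]
          exact Ideal.mem_map_of_mem _ (Ideal.pow_mem_pow ha i)
        refine ⟨i + j, s * algebraMap R S a ^ j + s' * algebraMap R S a ^ i, ?_, ?_⟩
        · rw [pow_add, Ideal.map_mul]
          refine add_mem (Ideal.mul_mem_mul hs (haI j)) ?_
          rw [mul_comm (Ideal.map _ _)]
          exact Ideal.mul_mem_mul hs' (haI i)
        · rw [map_add, map_mul, map_mul, map_pow, map_pow, ← e, ← e',
            ← IsScalarTower.algebraMap_apply]
          ring
      | smul r x _ hx =>
        obtain ⟨i, s, hs, e⟩ := hx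
        obtain ⟨j, y, hy, e'⟩ := Algebra.exists_mul_pow_eq_of_mem_adjoin (M := maximalIdeal R)
          (a := a) (t := t) (by
            rintro _ ⟨x, hx, rfl⟩
            exact ⟨x, hg ▸ Submodule.subset_span hx, div_mul_cancel₀ _ haF⟩) ha r.2
        refine ⟨i + j, s * algebraMap R S y, ?_, ?_⟩
        · rw [pow_add, Ideal.map_mul]
          exact Ideal.mul_mem_mul hs (Ideal.mem_map_of_mem _ hy)
        · have e'' := congrArg (algebraMap F L) e'
          rw [map_mul, map_pow, ← IsScalarTower.algebraMap_apply R F L,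
            ← IsScalarTower.algebraMap_apply R F L] at e''
          rw [map_mul, ← e, ← IsScalarTower.algebraMap_apply R S L, ← e'', Algebra.smul_def, hR'L]
          ring
    -- apply Krull's intersection theorem
    obtain ⟨j, hj⟩ := Ideal.exists_pow_mul_mem_of_forall_mem (M := M) (a := algebraMap R H a)
      (X := algebraMap S H c * z) haM
      (mem_nonZeroDivisors_iff_right.2 fun x hx ↦ hreg' ha0 (by rwa [mul_comm])) fun n ↦ by
      obtain ⟨s, hs⟩ := hdense n z
      have hw : IsIntegral R' (algebraMap S L s / algebraMap R L a ^ n) := by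
        refine isIntegral_div_of_span_singleton_mul_le hSL (I := maximalIdeal R ^ n)
          (fun r hr ↦ ?_) ?_ (hint n s hs)
        · exact ⟨⟨_, Algebra.div_pow_mem_of_mem_pow R' _ hmR' n hr⟩, by
            rw [hR'L, map_div₀, map_pow, ← IsScalarTower.algebraMap_apply R F L,
              ← IsScalarTower.algebraMap_apply R F L]⟩
        · refine (Submodule.ne_bot_iff _).2 ⟨(algebraMap R S (a ^ n)) ^ k, ?_, ?_⟩
          · exact Ideal.pow_mem_pow (Ideal.mem_sup_left
              (Ideal.mem_map_of_mem _ (Ideal.pow_mem_pow ha n))) k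
          · refine pow_ne_zero _ ?_
            rw [Ne, map_eq_zero_iff _ hRS]
            exact pow_ne_zero _ ha0
      obtain ⟨j, y, hy, h⟩ := hP (hc _ hw)
      have h1 : c * s * algebraMap R S a ^ j = y * algebraMap R S a ^ n := by
        apply hSL
        rw [map_mul, map_mul, map_mul, map_pow, map_pow, ← h, ← IsScalarTower.algebraMap_apply]
        field_simp
      have h2 : algebraMap S H c * algebraMap S H s * algebraMap R H a ^ j =
          algebraMap S H y * algebraMap R H a ^ n := by
        have := congrArg (algebraMap S H) h1
        rwa [map_mul, map_mul, map_mul, map_pow, map_pow,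
          ← IsScalarTower.algebraMap_apply R S H] at this
      have hyM : algebraMap S H y ∈ M ^ j := by
        rw [hM, ← Ideal.map_pow, IsScalarTower.algebraMap_eq R S H, ← Ideal.map_map]
        exact Ideal.mem_map_of_mem _ hy
      -- Split `c z = c s + c (z - s)`. In the chart, `aⁿ` divides the first term because `c s / aⁿ`
      -- lies in `P`, and the second because `z - s` is in `M ^ n`.
      refine ⟨j + n, Ideal.mem_span_singleton_mul.2 ⟨algebraMap R H a ^ n * algebraMap S H y +
        algebraMap R H a ^ j * (z - algebraMap S H s) * algebraMap S H c, ?_, ?_⟩⟩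
      · refine add_mem ?_ (Ideal.mul_mem_right _ _ ?_)
        · rw [add_comm, pow_add]
          exact Ideal.mul_mem_mul (Ideal.pow_mem_pow haM n) hyM
        · rw [pow_add]
          exact Ideal.mul_mem_mul (Ideal.pow_mem_pow haM j) hs
      · rw [pow_add]
        linear_combination (-algebraMap R H a ^ n) * h2
    refine ⟨j, ?_⟩
    obtain ⟨u, hu, e⟩ := Ideal.mem_mul_span_singleton.1 hj
    refine Ideal.mem_mul_span_singleton.2 ⟨u, hu, ?_⟩
    -- The denominator `c` is a nonzerodivisor on `H`, so it cancels from both sides.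
    refine sub_eq_zero.1 (hreg hc0 ?_)
    linear_combination e
  obtain ⟨j, hj⟩ : ∃ j, M ^ j * Ideal.span {z} ≤ M ^ (j + 1) * Ideal.span {z} := by
    have hM' : M = Ideal.span (algebraMap R H '' g) := by
      rw [← Ideal.map_span, hM]
      exact congrArg _ hg.symm
    have := Ideal.exists_pow_mul_le_of_forall_mem (M := M) (Z := Ideal.span {z})
      (s := algebraMap R H '' g) (by
        rw [hM']
        exact Ideal.subset_span) (g.finite_toSet.image _) (by
        rintro _ ⟨a, ha, rfl⟩
        rcases eq_or_ne a 0 with rfl | ha0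
        · exact ⟨1, by simp⟩
        · obtain ⟨j, hj⟩ := hkey a (hg ▸ Submodule.subset_span ha) ha0
          refine ⟨j, ?_⟩
          rwa [Ideal.span_singleton_pow, Ideal.span_singleton_mul_span_singleton, Ideal.span_le,
            Set.singleton_subset_iff])
    rwa [← hM'] at this
  -- Iterating the inclusion puts `M ^ j z` into every power of `M`.
  have hj' (n : ℕ) : M ^ j * Ideal.span {z} ≤ M ^ n := by
    suffices h : M ^ j * Ideal.span {z} ≤ M ^ n * (M ^ j * Ideal.span {z}) from
      h.trans Ideal.mul_le_left
    induction n with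
    | zero => simp
    | succ n ih =>
      refine ih.trans ?_
      calc M ^ n * (M ^ j * Ideal.span {z}) ≤ M ^ n * (M ^ (j + 1) * Ideal.span {z}) :=
          Ideal.mul_mono_right hj
        _ = M ^ (n + 1) * (M ^ j * Ideal.span {z}) := by ring
  -- If `R` is a field there is no nonzero `a` to cancel, but then density makes `S → H` surjective.
  by_cases hm : maximalIdeal R = ⊥
  · obtain ⟨s, hs⟩ := hdense 1 z
    rw [hM, hm, Ideal.map_bot, pow_one, Ideal.mem_bot, sub_eq_zero] at hs
    rw [hs, ← map_pow, map_eq_zero_iff _ hSH] at hk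
    rw [hs, eq_zero_of_pow_eq_zero hk, map_zero]
  · obtain ⟨a, ha, ha0⟩ := Submodule.exists_mem_ne_zero_of_ne_bot hm
    refine hreg' (pow_ne_zero j ha0) (hHaus _ fun n ↦ hj' n ?_)
    rw [map_pow]
    exact Ideal.mul_mem_mul (Ideal.pow_mem_pow (Ideal.mem_map_of_mem _ ha) j)
      (Ideal.mem_span_singleton_self z)

end Reduced

/-! ### From finite extensions to the algebraic closure. -/

section GeometricallyReduced

open nonZeroDivisors

/-- `S ⊗ A` is finite over the noetherian local ring `A`, hence noetherian and separated, and `S` is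
dense in it because `R` is dense in `A`. -/
theorem isReduced_tensorProduct_of_forall_isJapanese_of_finite {R F A S : Type u} [CommRing R]
    [IsDomain R] [IsLocalRing R] [IsNoetherianRing R] [Field F] [Algebra R F] [IsFractionRing R F]
    [CommRing A] [IsLocalRing A] [IsNoetherianRing A] [Algebra R A] [Module.FaithfullyFlat R A]
    (hmax : (maximalIdeal R).map (algebraMap R A) = maximalIdeal A)
    (hdense : ∀ (n : ℕ) (x : A), ∃ r : R, x - algebraMap R A r ∈ maximalIdeal A ^ n)
    (hJ : ∀ R' : Subalgebra R F, R'.FG → IsJapanese R')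
    [CommRing S] [IsDomain S] [Algebra R S] [Module.Finite R S] [FaithfulSMul R S] :
    IsReduced (S ⊗[R] A) := by
  obtain ⟨L, _, _, _⟩ : ∃ (L : Type u) (_ : Field L) (_ : Algebra S L), IsFractionRing S L :=
    ⟨FractionRing S, inferInstance, inferInstance, inferInstance⟩
  have hinj : Function.Injective ((algebraMap S L).comp (algebraMap R S)) :=
    (IsFractionRing.injective S L).comp (FaithfulSMul.algebraMap_injective R S)
  let : Algebra R L := ((algebraMap S L).comp (algebraMap R S)).toAlgebra
  have : IsScalarTower R S L := .of_algebraMap_eq fun _ ↦ rfl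
  let : Algebra F L := (IsFractionRing.lift hinj).toAlgebra
  have : IsScalarTower R F L :=
    .of_algebraMap_eq fun x ↦ (IsFractionRing.lift_algebraMap hinj x).symm
  have : Module.Finite F L := Module.Finite.of_isLocalization R S R⁰
  let H := S ⊗[R] A
  let : Algebra A H := Algebra.TensorProduct.rightAlgebra
  have : Module.Finite A H := by
    let g : A ⊗[R] S →ₐ[A] H :=
      { (Algebra.TensorProduct.comm R A S : A ⊗[R] S →+* H) with
        commutes' _ := rfl }
    exact Module.Finite.of_surjective g.toLinearMap (Algebra.TensorProduct.comm R A S).surjective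
  have : IsNoetherianRing H := isNoetherian_of_tower A inferInstance
  have hmap (n : ℕ) : ((maximalIdeal R).map (algebraMap R H)) ^ n =
      (maximalIdeal A ^ n).map (algebraMap A H) := by
    rw [← hmax, ← Ideal.map_pow, ← Ideal.map_pow, Ideal.map_map,
      ← IsScalarTower.algebraMap_eq R A H]
  refine isReduced_of_forall_isJapanese (F := F) (S := S) (L := L) (fun n x ↦ ?_) (fun x hx ↦ ?_)
    hJ
  · rw [hmap]
    induction x using TensorProduct.induction_on with
    | zero => exact ⟨0, by simp⟩
    | add x y hx hy =>
      obtain ⟨s, hs⟩ := hx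
      obtain ⟨t, ht⟩ := hy
      refine ⟨s + t, ?_⟩
      rw [map_add, add_sub_add_comm]
      exact add_mem hs ht
    | tmul s y =>
      obtain ⟨r, hr⟩ := hdense n y
      refine ⟨r • s, ?_⟩
      have : (s ⊗ₜ[R] y : H) - algebraMap S H (r • s) =
          algebraMap S H s * algebraMap A H (y - algebraMap R A r) := by
        have h1 : algebraMap S H (r • s) = s ⊗ₜ[R] algebraMap R A r := by
          rw [Algebra.algebraMap_eq_smul_one (A := A), ← TensorProduct.smul_tmul]
          rfl
        have h2 (u : A) : algebraMap S H s * algebraMap A H u = s ⊗ₜ[R] u := by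
          change (s ⊗ₜ[R] (1 : A)) * ((1 : S) ⊗ₜ[R] u) = _
          rw [Algebra.TensorProduct.tmul_mul_tmul, mul_one, one_mul]
        rw [h1, h2, TensorProduct.tmul_sub]
      rw [this]
      exact Ideal.mul_mem_left _ _ (Ideal.mem_map_of_mem _ hr)
  · refine IsHausdorff.haus (inferInstance : IsHausdorff (maximalIdeal A) H) x fun n ↦ ?_
    rw [SModEq.zero]
    have := hx n
    rw [hmap] at this
    rwa [Ideal.smul_top_eq_map, Submodule.restrictScalars_mem]

/-- Every element of `Ω` has a nonzero multiple by an element of `R` that is integral. So a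
nilpotent can be scaled into the subring, and the scalar is invertible in `Ω`. -/
theorem isReduced_tensorProduct_of_integralClosure {R A Ω : Type*} [CommRing R] [IsDomain R]
    [CommRing A] [Algebra R A] [Module.Flat R A] [Field Ω] [Algebra R Ω] [FaithfulSMul R Ω]
    [Algebra.IsAlgebraic R Ω] [IsReduced (A ⊗[R] integralClosure R Ω)] : IsReduced (A ⊗[R] Ω) := by
  let φ : A ⊗[R] integralClosure R Ω →ₐ[A] A ⊗[R] Ω :=
    Algebra.TensorProduct.map (AlgHom.id A A) (integralClosure R Ω).val
  have hφ : Function.Injective φ := Module.Flat.lTensor_preserves_injective_linearMap (M := A)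
    (integralClosure R Ω).val.toLinearMap Subtype.val_injective
  constructor
  intro z hz
  obtain ⟨r, hr, w, hw⟩ : ∃ r : R, r ≠ 0 ∧ r • z ∈ φ.range := by
    clear hz
    induction z with
    | zero => exact ⟨1, one_ne_zero, by simp⟩
    | add x y hx hy =>
      obtain ⟨r, hr, hx⟩ := hx
      obtain ⟨s, hs, hy⟩ := hy
      refine ⟨r * s, mul_ne_zero hr hs, ?_⟩
      rw [smul_add]
      refine add_mem ?_ ?_
      · rw [mul_comm, mul_smul, ← algebraMap_smul A s]
        exact Subalgebra.smul_mem _ hx _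
      · rw [mul_smul, ← algebraMap_smul A r]
        exact Subalgebra.smul_mem _ hy _
    | tmul a x =>
      obtain ⟨r, hr, hx⟩ := (Algebra.IsAlgebraic.isAlgebraic (R := R) x).exists_integral_multiple
      refine ⟨r, hr, a ⊗ₜ ⟨r • x, hx⟩, ?_⟩
      rw [TensorProduct.smul_tmul', TensorProduct.smul_tmul]
      rfl
  have hw0 : w = 0 := by
    refine IsReduced.eq_zero w ?_
    rw [← IsNilpotent.map_iff hφ]
    have : φ w = r • z := hw
    rw [this]
    exact hz.smul r
  have h0 : r • z = 0 := by
    rw [← hw, hw0]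
    exact map_zero φ
  have hrΩ : algebraMap R Ω r ≠ 0 := by
    rwa [Ne, map_eq_zero_iff _ (FaithfulSMul.algebraMap_injective R Ω)]
  have h1 : (1 ⊗ₜ (algebraMap R Ω r)⁻¹ : A ⊗[R] Ω) * r • (1 : A ⊗[R] Ω) = 1 := by
    rw [Algebra.TensorProduct.one_def, TensorProduct.smul_tmul', TensorProduct.smul_tmul,
      Algebra.TensorProduct.tmul_mul_tmul, Algebra.smul_def, mul_one, mul_one,
      inv_mul_cancel₀ hrΩ]
  calc z = (1 ⊗ₜ (algebraMap R Ω r)⁻¹ : A ⊗[R] Ω) * r • (1 : A ⊗[R] Ω) * z := by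
        rw [h1, one_mul]
    _ = (1 ⊗ₜ (algebraMap R Ω r)⁻¹ : A ⊗[R] Ω) * r • z := by
        rw [mul_assoc, smul_mul_assoc, one_mul]
    _ = 0 := by rw [h0, mul_zero]

/-- The integral closure of `R` in `Ω` is the union of its finitely generated subalgebras, which are
domains finite over `R`; flatness of `A` passes reducedness to the union. -/
theorem isReduced_tensorProduct_of_forall_isJapanese {R F A Ω : Type u} [CommRing R]
    [IsDomain R] [IsLocalRing R] [IsNoetherianRing R] [Field F] [Algebra R F] [IsFractionRing R F]
    [CommRing A] [IsLocalRing A] [IsNoetherianRing A] [Algebra R A] [Module.FaithfullyFlat R A]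
    (hmax : (maximalIdeal R).map (algebraMap R A) = maximalIdeal A)
    (hdense : ∀ (n : ℕ) (x : A), ∃ r : R, x - algebraMap R A r ∈ maximalIdeal A ^ n)
    (hJ : ∀ R' : Subalgebra R F, R'.FG → IsJapanese R') [Field Ω] [Algebra F Ω]
    [Algebra.IsAlgebraic F Ω] [Algebra R Ω] [IsScalarTower R F Ω] : IsReduced (A ⊗[R] Ω) := by
  have hRΩ : FaithfulSMul R Ω := by
    rw [faithfulSMul_iff_algebraMap_injective, IsScalarTower.algebraMap_eq R F Ω]
    exact (algebraMap F Ω).injective.comp (IsFractionRing.injective R F)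
  have : Algebra.IsAlgebraic R Ω := (IsFractionRing.comap_isAlgebraic_iff (K := F)).2 inferInstance
  have : IsReduced (A ⊗[R] integralClosure R Ω) := by
    refine IsReduced.tensorProduct_of_flat_of_forall_fg fun S hS ↦ ?_
    have : Algebra.FiniteType R S := (Subalgebra.fg_iff_finiteType _).1 hS
    have : Algebra.IsIntegral R S := ⟨fun x ↦ by
      rw [← isIntegral_algHom_iff S.val Subtype.val_injective]
      exact Algebra.IsIntegral.isIntegral _⟩
    have : Module.Finite R S := Algebra.finite_iff_isIntegral_and_finiteType.2 ⟨‹_›, ‹_›⟩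
    have : FaithfulSMul R S := by
      rw [faithfulSMul_iff_algebraMap_injective]
      intro x y hxy
      exact FaithfulSMul.algebraMap_injective R Ω
        (congrArg (fun w : S ↦ ((w : integralClosure R Ω) : Ω)) hxy)
    have := isReduced_tensorProduct_of_forall_isJapanese_of_finite (S := S) hmax hdense hJ
    exact isReduced_of_injective (Algebra.TensorProduct.comm R A S)
      (Algebra.TensorProduct.comm R A S).injective
  exact isReduced_tensorProduct_of_integralClosure

/-- Reducedness passes from the formal fibre to the field of fractions. -/
theorem isReduced_tensorProduct_of_isFractionRing {R F A K Ω : Type*} [CommRing R] [IsDomain R]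
    [Field F] [Algebra R F] [IsFractionRing R F] [CommRing A] [IsDomain A] [Algebra R A]
    [Field K] [Algebra A K] [IsFractionRing A K] [Algebra R K] [IsScalarTower R A K] [Algebra F K]
    [IsScalarTower R F K] [Field Ω] [Algebra F Ω] [Algebra R Ω] [IsScalarTower R F Ω]
    [IsReduced (A ⊗[R] Ω)] : IsReduced (K ⊗[F] Ω) := by
  have : Module.Flat R F := IsLocalization.flat F R⁰
  have : Module.Flat R Ω := Module.Flat.trans R F Ω
  let e : K ⊗[F] Ω ≃ₐ[F] K ⊗[R] Ω := IsLocalization.algebraTensorEquiv R⁰ F K Ω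
  suffices h : IsReduced (K ⊗[R] Ω) from isReduced_of_injective e e.injective
  let φ : A ⊗[R] Ω →ₐ[A] K ⊗[R] Ω :=
    Algebra.TensorProduct.map (Algebra.ofId A K) (AlgHom.id R Ω)
  have hφ : Function.Injective φ := Module.Flat.rTensor_preserves_injective_linearMap (M := Ω)
    (IsScalarTower.toAlgHom R A K).toLinearMap (IsFractionRing.injective A K)
  constructor
  intro z hz
  obtain ⟨r, hr, w, hw⟩ : ∃ r : A, r ≠ 0 ∧ r • z ∈ φ.range := by
    clear hz
    induction z with
    | zero => exact ⟨1, one_ne_zero, by simp⟩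
    | add x y hx hy =>
      obtain ⟨r, hr, hx⟩ := hx
      obtain ⟨s, hs, hy⟩ := hy
      refine ⟨r * s, mul_ne_zero hr hs, ?_⟩
      rw [smul_add]
      refine add_mem ?_ ?_
      · rw [mul_comm, mul_smul]
        exact Subalgebra.smul_mem _ hx _
      · rw [mul_smul]
        exact Subalgebra.smul_mem _ hy _
    | tmul a x =>
      obtain ⟨b, c, hc, rfl⟩ := IsFractionRing.div_surjective A a
      refine ⟨c, nonZeroDivisors.ne_zero hc, b ⊗ₜ x, ?_⟩
      have hc' : algebraMap A K c ≠ 0 := IsFractionRing.to_map_ne_zero_of_mem_nonZeroDivisors hc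
      rw [TensorProduct.smul_tmul', Algebra.smul_def, mul_div_cancel₀ _ hc']
      rfl
  have hw0 : w = 0 := by
    refine IsReduced.eq_zero w ?_
    rw [← IsNilpotent.map_iff hφ]
    have : φ w = r • z := hw
    rw [this]
    exact hz.smul r
  have h0 : r • z = 0 := by
    rw [← hw, hw0]
    exact map_zero φ
  have hrK : algebraMap A K r ≠ 0 := by
    rwa [Ne, map_eq_zero_iff _ (IsFractionRing.injective A K)]
  rw [← algebraMap_smul K r] at h0
  exact (smul_eq_zero_iff_right hrK).1 h0

theorem isGeometricallyReduced_genericFiber_iff {R F A : Type*} [CommRing R] [Field F] [Algebra R F]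
    [CommRing A] [Algebra R A] : Algebra.IsGeometricallyReduced F (F ⊗[R] A) ↔
      IsReduced (A ⊗[R] AlgebraicClosure F) := by
  rw [Algebra.isGeometricallyReduced_field_iff]
  let e : AlgebraicClosure F ⊗[F] (F ⊗[R] A) ≃+* A ⊗[R] AlgebraicClosure F :=
    (Algebra.TensorProduct.cancelBaseChange R F F (AlgebraicClosure F) A).toRingEquiv.trans
      (Algebra.TensorProduct.comm R _ A).toRingEquiv
  exact ⟨fun _ ↦ isReduced_of_injective e.symm e.symm.injective,
    fun _ ↦ isReduced_of_injective e e.injective⟩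

end GeometricallyReduced

/-! ### The formal completion: noetherian, faithfully flat, with `R` dense. -/

section FormalCompletion

variable (R : Type u) [CommRing R] [IsLocalRing R] [IsNoetherianRing R]

instance FormalCompletion.isNoetherianRing : IsNoetherianRing (FormalCompletion R) := by
  refine IsNoetherianRing.of_isAdicComplete (algebraMap R _) (fun y ↦ ?_) ?_
  · obtain ⟨x, hx⟩ := (AdicCompletion.residueField_map_bijective R).2 y
    obtain ⟨r, rfl⟩ := residue_surjective x
    exact ⟨r, hx⟩
  · rw [AdicCompletion.maximalIdeal_eq_map]
    exact (maximalIdeal R).fg_of_isNoetherianRing.map _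

instance FormalCompletion.faithfullyFlat : Module.FaithfullyFlat R (FormalCompletion R) :=
  Module.FaithfullyFlat.of_flat_of_isLocalHom

theorem FormalCompletion.exists_sub_algebraMap_mem (n : ℕ) (x : FormalCompletion R) :
    ∃ r : R, x - algebraMap R _ r ∈ maximalIdeal (FormalCompletion R) ^ n := by
  obtain ⟨r, hr⟩ := Ideal.Quotient.mk_surjective (x.1 n)
  refine ⟨r, ?_⟩
  rw [AdicCompletion.maximalIdeal_eq_map, ← Ideal.map_pow, ← Submodule.restrictScalars_mem R,
    ← Ideal.smul_top_eq_map, AdicCompletion.algebraMap_apply,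
    AdicCompletion.pow_smul_top_eq_ker_eval (maximalIdeal R).fg_of_isNoetherianRing]
  simpa [AdicCompletion.eval, sub_eq_zero] using hr.symm

end FormalCompletion

/-! ### Radical elements, normality and geometric reducedness. -/

section Radicial

/-- Over the algebraic closure `b` acquires a twin `β` with the same `p ^ ν`-th power, so `1 ⊗ b - β
⊗ 1` is nilpotent, hence zero. This is impossible when `1` and `b` are independent over `F`. -/
theorem Algebra.IsGeometricallyReduced.mem_range_of_pow_mem {F K : Type*} [Field F] [Field K]
    [Algebra F K] [Algebra.IsGeometricallyReduced F K] (p : ℕ) [ExpChar F p] {b : K} {ν : ℕ}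
    (hb : b ^ p ^ ν ∈ (algebraMap F K).range) : b ∈ (algebraMap F K).range := by
  obtain ⟨r, hr⟩ := hb
  by_contra hbF
  let Ω := AlgebraicClosure F
  have hred : IsReduced (Ω ⊗[F] K) := inferInstance
  obtain ⟨β, hβ⟩ := IsAlgClosed.exists_pow_nat_eq (algebraMap F Ω r)
    (pow_pos (expChar_pos F p) ν)
  have hexp : ExpChar (Ω ⊗[F] K) p :=
    expChar_of_injective_ringHom (algebraMap F (Ω ⊗[F] K)).injective p
  have h0 : (1 ⊗ₜ b - β ⊗ₜ 1 : Ω ⊗[F] K) = 0 := by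
    refine eq_zero_of_pow_eq_zero (n := p ^ ν) ?_
    rw [sub_pow_expChar_pow, Algebra.TensorProduct.tmul_pow, Algebra.TensorProduct.tmul_pow, hβ,
      ← hr, one_pow, one_pow, Algebra.algebraMap_eq_smul_one, Algebra.algebraMap_eq_smul_one,
      TensorProduct.tmul_smul, TensorProduct.smul_tmul', sub_self]
  have hb' : b ∉ Submodule.span F {(1 : K)} := by
    rw [Submodule.mem_span_singleton]
    rintro ⟨c, hc⟩
    exact hbF ⟨c, by rw [Algebra.algebraMap_eq_smul_one, hc]⟩
  -- A linear form that kills `1` but not `b` separates `1 ⊗ b` from `β ⊗ 1`.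
  obtain ⟨f, hf, hf1⟩ := Submodule.exists_le_ker_of_notMem hb'
  have hf1' : f 1 = 0 := hf1 (Submodule.mem_span_singleton_self 1)
  have h1 := congrArg (_root_.TensorProduct.rid F Ω ∘ LinearMap.lTensor Ω f) h0
  simp [hf1'] at h1
  exact hf h1

theorem Algebra.IsGeometricallyReduced.of_surjective {F E K : Type*} [Field F] [Field E] [Field K]
    [Algebra F E] [Algebra E K] [Algebra F K] [IsScalarTower F E K]
    (h : Function.Surjective (algebraMap F E)) [Algebra.IsGeometricallyReduced E K] :
    Algebra.IsGeometricallyReduced F K := by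
  rw [isGeometricallyReduced_field_iff]
  let Ω := AlgebraicClosure F
  let e : F ≃+* E := RingEquiv.ofBijective _ ⟨(algebraMap F E).injective, h⟩
  let : Algebra E Ω := ((algebraMap F Ω).comp (e.symm : E →+* F)).toAlgebra
  have : IsScalarTower F E Ω := .of_algebraMap_eq fun x ↦ by
    change _ = algebraMap F Ω (e.symm (e x))
    rw [e.symm_apply_apply]
  have : Algebra.IsAlgebraic E Ω := Algebra.IsAlgebraic.tower_top (K := F) E
  have : TensorProduct.CompatibleSMul F E Ω K := ⟨fun c x y ↦ by
    obtain ⟨c, rfl⟩ := h c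
    rw [algebraMap_smul, algebraMap_smul, TensorProduct.smul_tmul]⟩
  let ε : Ω ⊗[E] K ≃ₐ[E] Ω ⊗[F] K := Algebra.TensorProduct.equivOfCompatibleSMul F E E Ω K
  exact isReduced_of_injective ε.symm ε.symm.injective

/-- An integral fraction `r / s` lies in `A` by normality, so `r` is in `sA ∩ R`, which is `sR` by
faithful flatness. -/
theorem IsIntegrallyClosed.of_faithfullyFlat {R A : Type*} [CommRing R] [IsDomain R] [CommRing A]
    [IsDomain A] [Algebra R A] [Module.FaithfullyFlat R A] [IsIntegrallyClosed A] :
    IsIntegrallyClosed R := by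
  let F := FractionRing R
  let K := FractionRing A
  have hRA : Function.Injective (algebraMap R A) := FaithfulSMul.algebraMap_injective R A
  have hRK : Function.Injective ((algebraMap A K).comp (algebraMap R A)) :=
    (IsFractionRing.injective A K).comp hRA
  let φ : F →+* K := IsFractionRing.lift hRK
  have hφ (r : R) : φ (algebraMap R F r) = algebraMap A K (algebraMap R A r) :=
    IsFractionRing.lift_algebraMap hRK r
  rw [isIntegrallyClosed_iff F]
  intro x hx
  have hx' : IsIntegral A (φ x) := by
    obtain ⟨p, hp, hpx⟩ := hx
    refine ⟨p.map (algebraMap R A), hp.map _, ?_⟩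
    rw [Polynomial.eval₂_map, ← map_zero φ, ← hpx, Polynomial.hom_eval₂]
    congr 1
    ext r
    exact (hφ r).symm
  obtain ⟨b, hb⟩ := IsIntegrallyClosed.algebraMap_eq_of_integral hx'
  obtain ⟨r, s, hs, rfl⟩ := IsFractionRing.div_surjective R x
  have hsF : algebraMap R F s ≠ 0 := IsFractionRing.to_map_ne_zero_of_mem_nonZeroDivisors hs
  have h1 : algebraMap R A r = algebraMap R A s * b := by
    apply IsFractionRing.injective A K
    rw [map_mul, hb, ← hφ, ← hφ, ← map_mul, mul_div_cancel₀ _ hsF]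
  have h2 : r ∈ ((Ideal.span {s}).map (algebraMap R A)).comap (algebraMap R A) := by
    rw [Ideal.mem_comap, Ideal.map_span, Set.image_singleton, Ideal.mem_span_singleton]
    exact ⟨b, h1⟩
  rw [Ideal.comap_map_eq_self_of_faithfullyFlat, Ideal.mem_span_singleton] at h2
  obtain ⟨t, rfl⟩ := h2
  exact ⟨t, by rw [map_mul, mul_div_cancel_left₀ _ hsF]⟩

/-- Geometric reducedness places `b` in `F`; there it is a root of an element of `R`, hence integral
over `R`. -/
theorem IsIntegrallyClosed.mem_range_of_pow_mem {R A : Type*} (F K : Type*) [CommRing R]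
    [IsDomain R] [Field F] [Algebra R F] [IsFractionRing R F] [CommRing A] [IsDomain A]
    [Algebra R A] [Field K] [Algebra A K] [IsFractionRing A K] [Algebra R K] [IsScalarTower R A K]
    [Algebra F K] [IsScalarTower R F K] (p : ℕ) [ExpChar F p] [IsIntegrallyClosed R]
    [Algebra.IsGeometricallyReduced F K] {b : A} {ν : ℕ}
    (hb : b ^ p ^ ν ∈ (algebraMap R A).range) : b ∈ (algebraMap R A).range := by
  obtain ⟨r, hr⟩ := hb
  have h1 : algebraMap F K (algebraMap R F r) = algebraMap A K b ^ p ^ ν := by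
    rw [← map_pow, ← hr, ← IsScalarTower.algebraMap_apply, ← IsScalarTower.algebraMap_apply]
  obtain ⟨c, hc⟩ := Algebra.IsGeometricallyReduced.mem_range_of_pow_mem p ⟨_, h1⟩
  have h2 : c ^ p ^ ν = algebraMap R F r := by
    apply (algebraMap F K).injective
    rw [map_pow, hc, h1]
  have h3 : IsIntegral R c := by
    refine IsIntegral.of_pow (pow_pos (expChar_pos F p) ν) ?_
    rw [h2]
    exact isIntegral_algebraMap
  obtain ⟨t, rfl⟩ := IsIntegrallyClosed.algebraMap_eq_of_integral h3
  refine ⟨t, IsFractionRing.injective A K ?_⟩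
  rw [← hc, ← IsScalarTower.algebraMap_apply, ← IsScalarTower.algebraMap_apply]

/-- If `e ^ (p ^ ν) = r / s`, the `p ^ ν`-th power of `s e` is in `R`. So `s e` is integral over the
normal ring `A`, lies in `A`, and by hypothesis in `R`. -/
theorem IsPurelyInseparable.algebraMap_surjective_of_pow_mem {R F A E K : Type*} [CommRing R]
    [IsDomain R] [Field F] [Algebra R F] [IsFractionRing R F] [CommRing A] [IsDomain A]
    [IsIntegrallyClosed A] [Algebra R A] [Field K] [Algebra A K] [IsFractionRing A K] [Algebra R K]
    [IsScalarTower R A K] [Algebra F K] [IsScalarTower R F K] (p : ℕ) [ExpChar F p] [Field E]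
    [Algebra F E] [Algebra E K] [IsScalarTower F E K] [IsPurelyInseparable F E]
    (h : ∀ (b : A) (ν : ℕ), b ^ p ^ ν ∈ (algebraMap R A).range → b ∈ (algebraMap R A).range) :
    Function.Surjective (algebraMap F E) := by
  intro e
  obtain ⟨ν, y, hy⟩ := IsPurelyInseparable.pow_mem F p e
  obtain ⟨r, s, hs, rfl⟩ := IsFractionRing.div_surjective R y
  have hsF : algebraMap R F s ≠ 0 := IsFractionRing.to_map_ne_zero_of_mem_nonZeroDivisors hs
  have hq : 0 < p ^ ν := pow_pos (expChar_pos F p) ν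
  have h1 : (algebraMap R K s * algebraMap E K e) ^ p ^ ν =
      algebraMap R K (s ^ (p ^ ν - 1) * r) := by
    rw [mul_pow, ← map_pow (algebraMap E K), ← hy, ← IsScalarTower.algebraMap_apply F E K,
      IsScalarTower.algebraMap_apply R F K s, ← map_pow, ← map_mul,
      IsScalarTower.algebraMap_apply R F K, map_mul (algebraMap R F), map_pow]
    congr 1
    obtain ⟨q, hq'⟩ := Nat.exists_eq_succ_of_ne_zero hq.ne'
    rw [hq', Nat.succ_eq_add_one, Nat.add_sub_cancel, pow_succ]
    field_simp
  have h2 : IsIntegral A (algebraMap R K s * algebraMap E K e) := by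
    refine IsIntegral.of_pow hq ?_
    rw [h1, IsScalarTower.algebraMap_apply R A K]
    exact isIntegral_algebraMap
  obtain ⟨b, hb⟩ := IsIntegrallyClosed.algebraMap_eq_of_integral h2
  obtain ⟨t, rfl⟩ := h b ν ⟨s ^ (p ^ ν - 1) * r, by
    apply IsFractionRing.injective A K
    rw [map_pow, hb, h1, ← IsScalarTower.algebraMap_apply]⟩
  refine ⟨algebraMap R F t / algebraMap R F s, (algebraMap E K).injective ?_⟩
  rw [← IsScalarTower.algebraMap_apply R A K, IsScalarTower.algebraMap_apply R F K,
    IsScalarTower.algebraMap_apply R F K] at hb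
  have hsK : algebraMap F K (algebraMap R F s) ≠ 0 := by
    rwa [Ne, map_eq_zero_iff _ (algebraMap F K).injective]
  rw [← IsScalarTower.algebraMap_apply F E K, map_div₀, hb, mul_div_cancel_left₀ _ hsK]

end Radicial

/-! ### The generic formal fibre and the japanese property. -/

section Japanese

open nonZeroDivisors

variable (R F : Type u) [CommRing R] [IsLocalRing R] [IsDomain R] [Field F]
    [Algebra R F] [IsFractionRing R F]

theorem isGeometricallyReduced_genericFormalFiber_of_isJapanese [IsNoetherianRing R]
    (h : ∀ R' : Subalgebra R F, R'.FG → IsJapanese R') :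
    Algebra.IsGeometricallyReduced F (GenericFormalFiber R F) := by
  rw [isGeometricallyReduced_genericFiber_iff]
  exact isReduced_tensorProduct_of_forall_isJapanese AdicCompletion.maximalIdeal_eq_map.symm
    (FormalCompletion.exists_sub_algebraMap_mem R) h

variable [IsDomain (FormalCompletion R)] (K : Type u) [Field K] [Algebra (FormalCompletion R) K]
    [IsFractionRing (FormalCompletion R) K] [Algebra R K]
    [IsScalarTower R (FormalCompletion R) K] [Algebra F K] [IsScalarTower R F K]

/-- The fibre is a subring of `K`, and `K` arises from it by inverting further elements of the
completion; neither passage affects reducedness after extension of `F`. -/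
theorem isGeometricallyReduced_genericFormalFiber_iff :
    Algebra.IsGeometricallyReduced F (GenericFormalFiber R F) ↔
      Algebra.IsGeometricallyReduced F K := by
  constructor
  · rw [isGeometricallyReduced_genericFiber_iff, Algebra.isGeometricallyReduced_field_iff]
    intro h
    have : IsReduced (K ⊗[F] AlgebraicClosure F) :=
      isReduced_tensorProduct_of_isFractionRing (R := R) (A := FormalCompletion R)
    exact isReduced_of_injective (Algebra.TensorProduct.comm F (AlgebraicClosure F) K)
      (Algebra.TensorProduct.comm F (AlgebraicClosure F) K).injective
  · intro h
    obtain ⟨ψ, hψ, -⟩ := exists_injective_algHom_tensorProduct R F (FormalCompletion R) K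
    exact Algebra.IsGeometricallyReduced.of_injective ψ hψ

theorem isJapanese_of_isGeometricallyReduced [IsNoetherianRing R]
    [Algebra.IsGeometricallyReduced F K]
    (R' : Subalgebra R F) (hR' : R'.FG) : IsJapanese R' := by
  have := R'.isFractionRing
  have : Algebra.FiniteType R R' := (Subalgebra.fg_iff_finiteType _).1 hR'
  refine IsJapanese.of_isFractionRing F fun L _ _ _ _ _ ↦ ?_
  have : IsReduced (K ⊗[F] L) := isReduced_of_injective (Algebra.TensorProduct.comm F K L)
    (Algebra.TensorProduct.comm F K L).injective
  exact Module.Finite.integralClosure_of_isReduced_tensorProduct (R := R) (F := F)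
    (A := FormalCompletion R) (K := K)

end Japanese

/-! ### The equivalences. -/

theorem proposition2p2 (R F K : Type u) [CommRing R] [IsLocalRing R] [IsNoetherianRing R]
    [IsDomain (FormalCompletion R)]
    [Field F] [Algebra R F] [IsFractionRing R F]
    [Field K] [Algebra (FormalCompletion R) K] [IsFractionRing (FormalCompletion R) K]
    [Algebra R K] [IsScalarTower R (FormalCompletion R) K]
    [Algebra F K] [IsScalarTower R F K] :
    (Algebra.IsGeometricallyReduced F (GenericFormalFiber R F) ↔
      ∀ R' : Subalgebra R F, R'.FG → IsJapanese R') ∧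
    (IsIntegrallyClosed R →
      Algebra.IsGeometricallyReduced F (GenericFormalFiber R F) → pRadicalClosure R = ⊥) ∧
    (IsIntegrallyClosed (FormalCompletion R) → IsPurelyInseparableThenSeparable F K →
      List.TFAE [
        pRadicalClosure R = ⊥,
        Algebra.IsGeometricallyReduced F (GenericFormalFiber R F),
        ∀ R' : Subalgebra R F, R'.FG → IsJapanese R']) := by
  have hinj : Function.Injective (algebraMap R (FormalCompletion R)) :=
    FaithfulSMul.algebraMap_injective R (FormalCompletion R)
  have hR : IsDomain R := hinj.isDomain
  have hiff : Algebra.IsGeometricallyReduced F (GenericFormalFiber R F) ↔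
      ∀ R' : Subalgebra R F, R'.FG → IsJapanese R' := by
    refine ⟨fun h ↦ ?_, isGeometricallyReduced_genericFormalFiber_of_isJapanese R F⟩
    have := (isGeometricallyReduced_genericFormalFiber_iff R F K).1 h
    exact isJapanese_of_isGeometricallyReduced R F K
  obtain ⟨p, hp⟩ : ∃ p, ringExpChar (FractionRing (FormalCompletion R)) = p := ⟨_, rfl⟩
  have hpA : ExpChar (FormalCompletion R) p := by
    have : ExpChar (FractionRing (FormalCompletion R)) p := hp ▸ inferInstance
    exact RingHom.expChar (algebraMap (FormalCompletion R) (FractionRing (FormalCompletion R)))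
      (IsFractionRing.injective _ _) p
  -- The exponent in the definition of the closure is read off from the completion; it agrees with
  -- that of `F`, because `F` and the completion both embed in `K`.
  have hpF : ExpChar F p := by
    have : ExpChar K p := expChar_of_injective_ringHom
      (IsFractionRing.injective (FormalCompletion R) K) p
    exact RingHom.expChar (algebraMap F K) (algebraMap F K).injective p
  have hbot : pRadicalClosure R = ⊥ ↔ ∀ (b : FormalCompletion R) (ν : ℕ),
      b ^ p ^ ν ∈ (algebraMap R (FormalCompletion R)).range →
        b ∈ (algebraMap R (FormalCompletion R)).range := by
    rw [eq_bot_iff]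
    constructor
    · intro h b ν hb
      have hb' : b ∈ pRadicalClosure R := ⟨ν, by rwa [hp]⟩
      obtain ⟨r, hr⟩ := Algebra.mem_bot.1 (h hb')
      exact ⟨r, hr⟩
    · rintro h b ⟨ν, hb⟩
      rw [hp] at hb
      obtain ⟨r, hr⟩ := h b ν hb
      exact Algebra.mem_bot.2 ⟨r, hr⟩
  have hnormal : IsIntegrallyClosed R →
      Algebra.IsGeometricallyReduced F (GenericFormalFiber R F) → pRadicalClosure R = ⊥ := by
    intro _ h
    have := (isGeometricallyReduced_genericFormalFiber_iff R F K).1 h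
    exact hbot.2 fun b ν ↦ IsIntegrallyClosed.mem_range_of_pow_mem F K p
  refine ⟨hiff, hnormal, ?_⟩
  rintro _ ⟨E, hE, hEK⟩
  have : Algebra.IsGeometricallyReduced E K := hEK
  tfae_have 2 ↔ 3 := hiff
  tfae_have 2 → 1 := hnormal (IsIntegrallyClosed.of_faithfullyFlat (A := FormalCompletion R))
  -- The closure condition collapses `E` to `F`, so that `K` is separable over `F` itself.
  tfae_have 1 → 2 := by
    intro h
    rw [isGeometricallyReduced_genericFormalFiber_iff R F K]
    exact Algebra.IsGeometricallyReduced.of_surjective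
      (IsPurelyInseparable.algebraMap_surjective_of_pow_mem (E := E) (K := K) p (hbot.1 h))
  tfae_finish
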